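/- **Setting.** For integers $0\le k\le n$ and a weight $\omega$, the syndrome decoding problem asks, given a parity-check matrix $H\in\mathbb F_2^{(n-k)\times n}$ of rank $n-k$ and $s\in\mathbb F_2^{n-k}$, for $x\in\mathbb F_2^n$ of Hamming weight $\omega$ with $Hx=s$. Put $T_{\mathrm C}=\binom n\omega/\binom{n-k}\omega$ (the time of the classical algorithm up to polynomial factors). *Hybrid Prange* with qubit reduction factor $\delta\in[0,1]$: let $\kappa=\lfloor\delta k\rfloor$ and $r=n-k$. Repeat independent rounds until one of them returns a vector. In a round, draw a uniformly random permutation $P$ of the coordinates, guess that the last $k-\kappa$ coordinates of $P^{-1}e$ are zero, i.e. keep only the first $r+\kappa$ columns of $HP$, and bring them classically to systematic form $(1\mid M)$ with syndrome $s'$ (give up the round if the first $r$ of these columns are not invertible). Then run the quantum circuit $(A S_0A^{\dagger}S_t)^{j}A$ on the input $(M,s')$ and measure a set $I$ of $r$ columns. Here $A$ prepares the uniform superposition over all sets $I$ of $r$ of the $r+\kappa$ columns; $S_t$ flips the sign of those $I$ for which the linear system on the columns $I$ of $(1\mid M)$ with right-hand side $s'$ is uniquely solvable with a solution of weight $\omega$;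 $S_0$ flips the sign of the initial state; and $j=\lfloor\pi/(4\sqrt q)\rfloor$ with $q=\binom r\omega/\binom{r+\kappa}\omega$. Finally solve the system on the columns $I$ for $y$, and return $P(y,0)$ if it is a solution of the original instance. Circuits consist of controlled one-qubit gates, a gate with $c$ controls costing $c+1$. The running time $T$ is the expected total cost: every executed round costs the full quantum circuit plus $c_n$ classical steps, where $c_n$ is any polynomially bounded sequence. **Corollary (Hybrid Prange for sublinear error weight).** There are circuits for $A$ and $S_t$ that depend only on $(r,\kappa,\omega)$, with cost and number of ancillas polynomial in $r+\kappa$, such that the following holds for all $R\in(0,1)$, all $\delta\in[0,1]$, and all sequences $k=k_n$, $\omega=\omega_n\ge1$ with $k/n\to R$ and $\tau_n:=\omega/n\to0$. Let $$t(\delta)=\frac12\left(1+\frac{\log(1-(1-\delta)R)}{\log(1-R)}\right).$$ 1. $t(\delta)$ is the limit of the time exponent for positive error rate: with $\mathrm H$ the binary entropy function and $$t(R,\delta,\tau)=1-\frac{\frac12\left((1-\alpha)\mathrm H\!\left(\frac{\tau}{1-\alpha}\right)-(1-R)\mathrm H\!\left(\frac{\tau}{1-R}\right)\right)}{\mathrm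 H(\tau)-(1-R)\mathrm H\!\left(\frac{\tau}{1-R}\right)},\qquad \alpha=(1-\delta)R,$$ one has $t(k_n/n,\delta,\tau_n)\to t(\delta)$. 2. The matrix $M$ occupies $(n-k)\kappa$ qubits, which is at most $\delta(1-\frac kn)\frac kn\,n^2$ for all large $n$ and equals $(\delta(1-R)R+o(1))\,n^2$. 3. Up to polynomial factors the running time is $T_{\mathrm C}^{\,t(\delta)+o(1)}$: there is a constant $K$ such that for every $\varepsilon>0$, all sufficiently large $n$ and every $e\in\mathbb F_2^n$ of weight $\omega$, with probability at least $1-\varepsilon$ over a uniformly random parity-check matrix $H\in\mathbb F_2^{(n-k)\times n}$ of rank $n-k$, Hybrid Prange on the instance $(H,He,\omega)$ returns a solution with probability one, $T$ is finite, and $$\bigl|\log T-t(\delta)\log T_{\mathrm C}\bigr|\le\varepsilon\log T_{\mathrm C}+K\log n .$$ 4. If moreover $\log n=o(\omega)$, then, in the same sense (for every $\varepsilon>0$, all large $n$ and all $e$, with probability at least $1-\varepsilon$ over $H$), the algorithm returns a solution with probability one, $T$ is finite, and $\bigl|\log T/\log T_{\mathrm C}-t(\delta)\bigr|\le\varepsilon$.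 -/

import Mathlib

open Filter Topology
open scoped ENNReal

noncomputable section

namespace HybridPrange

/-! ### Quantum circuits -/

/-- A (multi-)controlled one-qubit gate on the wires `W`: the unitary `op` acts on the wire `target`
if every wire `c ∈ controls` carries the value `value c`, and nothing happens otherwise. -/
structure Gate (W : Type) where
  target : W
  controls : Finset W
  value : W → ZMod 2
  target_notMem : target ∉ controls
  op : Matrix.unitaryGroup (ZMod 2) ℂ

/-- A vector of amplitudes, one for every classical configuration of the wires. -/
abbrev QState (W : Type) := (W → ZMod 2) → ℂ

/-- A circuit: a list of gates, the first gate of the list being applied first. -/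
abbrev Circuit (W : Type) := List (Gate W)

section
variable {W : Type} [DecidableEq W]

/-- The action of a gate on a state vector. -/
def Gate.apply (g : Gate W) (ψ : QState W) : QState W := fun x =>
  open Classical in
  if ∀ c ∈ g.controls, x c = g.value c then
    ∑ b : ZMod 2, (g.op : Matrix (ZMod 2) (ZMod 2) ℂ) (x g.target) b
      * ψ (Function.update x g.target b)
  else ψ x

/-- The action of a circuit on a state vector. -/
def Circuit.run (C : Circuit W) (ψ : QState W) : QState W :=
  C.foldl (fun φ g => g.apply φ) ψ

/-- The computational basis state `|x⟩`. -/
def ket (x : W → ZMod 2) : QState W := fun y => open Classical in if y = x then 1 else 0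

end

section
variable {W : Type}

/-- The adjoint gate. -/
def Gate.adj (g : Gate W) : Gate W := { g with op := g.op⁻¹ }

/-- The adjoint circuit. -/
def Circuit.adj (C : Circuit W) : Circuit W := (C.map Gate.adj).reverse

/-- The number of elementary gates: a gate with `c` controls is charged `c + 1`, in accordance with
its decomposition into `O(c + 1)` one-qubit, CNOT and Toffoli gates. -/
def Circuit.cost (C : Circuit W) : ℕ := (C.map fun g => g.controls.card + 1).sum

end

/-! ### Syndrome decoding -/

/-- `x` is a solution of the instance `(H, s, w)` of the syndrome decoding problem. -/
def IsSolution {r : ℕ} {ι : Type} [Fintype ι] (H : Matrix (Fin r) ι (ZMod 2))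
    (s : Fin r → ZMod 2) (w : ℕ) (x : ι → ZMod 2) : Prop :=
  hammingNorm x = w ∧ H.mulVec x = s

/-- `y` is the unique vector supported on the column set `I` that has syndrome `s`, that is, the
linear system `H_I y_I = s` has exactly one solution, and it is `y_I`. -/
def SolvesOn {r : ℕ} {ι : Type} [Fintype ι] (H : Matrix (Fin r) ι (ZMod 2))
    (s : Fin r → ZMod 2) (I : Finset ι) (y : ι → ZMod 2) : Prop :=
  ((∀ i, i ∉ I → y i = 0) ∧ H.mulVec y = s) ∧
    ∀ z : ι → ZMod 2, (∀ i, i ∉ I → z i = 0) → H.mulVec z = s → z = y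

/-- The parity-check matrices with `r` rows of the binary linear `[n, n - r]` codes. -/
abbrev ParityCheck (r n : ℕ) := {H : Matrix (Fin r) (Fin n) (ZMod 2) // H.rank = r}

/-- The proportion of the parity-check matrices with the property `p`, that is, the probability
of `p` for a uniformly random parity-check matrix. -/
def proportion {r n : ℕ} (p : ParityCheck r n → Prop) : ℝ :=
  (Nat.card {H : ParityCheck r n // p H} : ℝ) / Nat.card (ParityCheck r n)

/-! ### The quantum version of Prange's algorithm

The input is a matrix in systematic form `(1 | M)` with `r` rows and `r + κ` columns, of which only
`M` is stored, and a syndrome `s`. -/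

/-- The columns of a matrix `(1 | M)` with `r` rows and `r + κ` columns. -/
abbrev Col (r κ : ℕ) := Fin r ⊕ Fin κ

/-- The wires: the matrix register (`r * κ` qubits), the syndrome register, the register for the
selected subset of columns, and `a + 1` ancillas. -/
abbrev Wire (r κ a : ℕ) := ((Fin r × Fin κ) ⊕ Fin r) ⊕ (Col r κ ⊕ Fin (a + 1))

/-- The number of qubits of the matrix register. -/
def matrixQubits (r κ : ℕ) : ℕ := Fintype.card (Fin r × Fin κ)

/-- The configuration of the wires with matrix `M`, syndrome `s`, selection register `b` and all
ancillas equal to zero. -/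
def config {r κ : ℕ} (a : ℕ) (M : Matrix (Fin r) (Fin κ) (ZMod 2)) (s : Fin r → ZMod 2)
    (b : Col r κ → ZMod 2) : Wire r κ a → ZMod 2 :=
  Sum.elim (Sum.elim (fun p => M p.1 p.2) s) (Sum.elim b 0)

/-- The bit vector that represents a set of columns. -/
def bits {r κ : ℕ} (I : Finset (Col r κ)) : Col r κ → ZMod 2 := fun c => if c ∈ I then 1 else 0

/-- The matrix `(1 | M)`. -/
def systematic {r κ : ℕ} (M : Matrix (Fin r) (Fin κ) (ZMod 2)) :
    Matrix (Fin r) (Col r κ) (ZMod 2) := Matrix.fromCols 1 M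

/-- The set `I` is good: the linear system on the columns `I` of `(1 | M)` is uniquely solvable and
its solution has weight `w`. -/
def Marked {r κ : ℕ} (M : Matrix (Fin r) (Fin κ) (ZMod 2)) (s : Fin r → ZMod 2) (w : ℕ)
    (I : Finset (Col r κ)) : Prop :=
  ∃ y, SolvesOn (systematic M) s I y ∧ hammingNorm y = w

/-- Circuits for the two building blocks of the quantum search, for given `r`, `κ` and `w`; they do
not depend on the instance `(M, s)`, which is part of the input configuration.
* `prep` creates the uniform superposition over all sets of `r` columns;
* `oracle` flips the sign of the good sets of `r` columns. -/
structure SearchCircuits (r κ w : ℕ) where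
  anc : ℕ
  prep : Circuit (Wire r κ anc)
  oracle : Circuit (Wire r κ anc)
  prep_spec : ∀ (M : Matrix (Fin r) (Fin κ) (ZMod 2)) (s : Fin r → ZMod 2),
    prep.run (ket (config anc M s 0)) =
      ((Real.sqrt ((r + κ).choose r) : ℝ) : ℂ)⁻¹ •
        ∑ I ∈ (Finset.univ : Finset (Col r κ)).powersetCard r, ket (config anc M s (bits I))
  oracle_spec : ∀ (M : Matrix (Fin r) (Fin κ) (ZMod 2)) (s : Fin r → ZMod 2)
    (I : Finset (Col r κ)), I.card = r →
    oracle.run (ket (config anc M s (bits I))) =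
      (open Classical in if Marked M s w I then (-1 : ℂ) else 1) • ket (config anc M s (bits I))

/-- The one-qubit gate `|0⟩ ↦ -|0⟩`, `|1⟩ ↦ |1⟩`. -/
def flipZero : Matrix.unitaryGroup (ZMod 2) ℂ :=
  ⟨Matrix.diagonal fun b => if b = 0 then -1 else 1, by
    rw [Matrix.mem_unitaryGroup_iff, Matrix.star_eq_conjTranspose, Matrix.diagonal_conjTranspose,
      Matrix.diagonal_mul_diagonal, ← Matrix.diagonal_one]
    congr 1
    funext b
    by_cases hb : b = 0 <;> simp [hb]⟩

/-- The circuit that flips the sign of the configurations whose selection register and ancillas are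
all zero. -/
def flipInitial (r κ a : ℕ) : Circuit (Wire r κ a) :=
  [{ target := Sum.inr (Sum.inr 0)
     controls := Finset.univ.filter fun c =>
       (∃ v : Col r κ ⊕ Fin (a + 1), c = Sum.inr v) ∧ c ≠ Sum.inr (Sum.inr 0)
     value := 0
     target_notMem := by simp
     op := flipZero }]

/-- The proportion of the sets of `r` among `r + κ` columns that contain `w` given columns. -/
def goodProportion (r κ w : ℕ) : ℝ := (r.choose w : ℝ) / ((r + κ).choose w : ℝ)

/-- The number `⌊π / (4 a)⌋` of amplification steps, where `a` is the amplitude of the good sets. -/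
def iterations (r κ w : ℕ) : ℕ := ⌊Real.pi / (4 * Real.sqrt (goodProportion r κ w))⌋₊

namespace SearchCircuits

variable {r κ w : ℕ} (D : SearchCircuits r κ w)

/-- The full quantum circuit, `A` followed by `⌊π / (4 a)⌋` amplitude amplification steps
`A S₀ A† S_t`. -/
def amplified : Circuit (Wire r κ D.anc) :=
  D.prep ++ (List.replicate (iterations r κ w)
    (D.oracle ++ D.prep.adj ++ flipInitial r κ D.anc ++ D.prep)).flatten

/-- The probability that the measurement of the selection register after a run of the full circuit
on the input `(M, s)` gives the set `I`. -/
def measureProb (M : Matrix (Fin r) (Fin κ) (ZMod 2)) (s : Fin r → ZMod 2)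
    (I : Finset (Col r κ)) : ℝ :=
  ∑ x : Wire r κ D.anc → ZMod 2, open Classical in
    if ∀ c : Col r κ, x (Sum.inr (Sum.inl c)) = bits I c then
      ‖D.amplified.run (ket (config D.anc M s 0)) x‖ ^ 2
    else 0

end SearchCircuits

/-! ### Hybrid Prange

A permutation of the `n` coordinates is a bijection from the `n = (r + κ) + l` positions to the
coordinates; the last `l` positions are those at which the error is guessed to be zero. -/

section
variable {r κ l n w : ℕ}

/-- The first `r + κ` columns of the permuted matrix `H P`. -/
def shortened (H : Matrix (Fin r) (Fin n) (ZMod 2)) (P : Col r κ ⊕ Fin l ≃ Fin n) :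
    Matrix (Fin r) (Col r κ) (ZMod 2) :=
  H.submatrix id fun c => P (Sum.inl c)

/-- The vector `P (y, 0)`. -/
def extend (P : Col r κ ⊕ Fin l ≃ Fin n) (y : Col r κ → ZMod 2) : Fin n → ZMod 2 :=
  fun i => Sum.elim y 0 (P.symm i)

/-- The probability that one round of the algorithm ends with the output `x`. In a round, a
uniformly random permutation `P` is drawn, the shortened matrix is brought to systematic form
`(1 | M)` with syndrome `s'` (if its first `r` columns are not invertible, the round is given up),
the quantum circuit is run on `(M, s')`, a set `I` is measured, the linear system on the columns `I`
is solved for `y`, and `P (y, 0)` is returned if it is a solution of the instance. -/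
def roundProb (D : SearchCircuits r κ w) (l : ℕ) (H : Matrix (Fin r) (Fin n) (ZMod 2))
    (s : Fin r → ZMod 2) (x : Fin n → ZMod 2) : ℝ :=
  (∑ P : Col r κ ⊕ Fin l ≃ Fin n, ∑ I : Finset (Col r κ), open Classical in
    let B := (shortened H P).toCols₁
    let M := B⁻¹ * (shortened H P).toCols₂
    let s' := B⁻¹.mulVec s
    if IsUnit B.det ∧ IsSolution H s w x ∧
        ∃ y, SolvesOn (systematic M) s' I y ∧ x = extend P y then
      D.measureProb M s' I
    else 0) / Fintype.card (Col r κ ⊕ Fin l ≃ Fin n)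

/-- The probability that a round ends with an output. -/
def successProb (D : SearchCircuits r κ w) (l : ℕ) (H : Matrix (Fin r) (Fin n) (ZMod 2))
    (s : Fin r → ZMod 2) : ℝ :=
  ∑ x, roundProb D l H s x

/-- The probability that the algorithm, which repeats independent rounds until one of them ends with
an output, returns `x`; round number `i` is executed with probability `(1 - successProb) ^ i`. -/
def returnProb (D : SearchCircuits r κ w) (l : ℕ) (H : Matrix (Fin r) (Fin n) (ZMod 2))
    (s : Fin r → ZMod 2) (x : Fin n → ZMod 2) : ℝ≥0∞ :=
  ∑' i : ℕ, ENNReal.ofReal (1 - successProb D l H s) ^ i * ENNReal.ofReal (roundProb D l H s x)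

/-- The algorithm solves the instance: it returns a solution with probability one. -/
def Solves (D : SearchCircuits r κ w) (l : ℕ) (H : Matrix (Fin r) (Fin n) (ZMod 2))
    (s : Fin r → ZMod 2) : Prop :=
  (∑ x : Fin n → ZMod 2, open Classical in
    if IsSolution H s w x then returnProb D l H s x else 0) = 1

/-- The expected running time of the algorithm: every executed round costs the gates of the full
quantum circuit and `c` steps for the classical work of the round. -/
def expectedTime (D : SearchCircuits r κ w) (c l : ℕ) (H : Matrix (Fin r) (Fin n) (ZMod 2))
    (s : Fin r → ZMod 2) : ℝ≥0∞ :=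
  ∑' i : ℕ, ENNReal.ofReal (1 - successProb D l H s) ^ i * ((D.amplified.cost + c : ℕ) : ℝ≥0∞)

end

/-! ### Time exponents (quotients of logarithms, hence independent of the base) -/

/-- The running time `T_C` of the classical algorithm, up to polynomial factors. -/
def classicalTime (n k w : ℕ) : ℝ := (n.choose w : ℝ) / ((n - k).choose w : ℝ)

/-- The time exponent for error rate `τ`. -/
def exponent (R δ τ : ℝ) : ℝ :=
  let α := (1 - δ) * R
  1 - (1 / 2 * ((1 - α) * Real.binEntropy (τ / (1 - α))
        - (1 - R) * Real.binEntropy (τ / (1 - R))))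
      / (Real.binEntropy τ - (1 - R) * Real.binEntropy (τ / (1 - R)))

/-- The time exponent for sublinear error weight. -/
def sublinearExponent (R δ : ℝ) : ℝ :=
  1 / 2 * (1 + Real.log (1 - (1 - δ) * R) / Real.log (1 - R))

/-- For the qubit reduction factor `δ`: the number `⌊δ k⌋` of columns of the matrix register. -/
def keptColumns (δ : ℝ) (k : ℕ) : ℕ := ⌊δ * k⌋₊

end HybridPrange

end

open HybridPrange

noncomputable section

namespace HybridPrange

/-! The circuits are explicit. `prepCircuit` draws the bits of a random `r`-subset one after the
other, rotating each according to the number of ones so far, which is kept in a unary grid of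
ancillas. `oracleCircuit` runs Gaussian elimination with every step written to a fresh layer of
ancillas, counts the ones of the final right-hand side, applies a sign and undoes the computation;
`solvesOn_iff_elim` says that the final layer recognises the good sets. Both reflections treat all
good sets alike and all bad sets alike, so amplification is a rotation in a plane up to sign
(`amplified_run`, `sqrt_mul_amplitudes`), and a good set is measured with probability `sin²
((2j+1)θ)`.

The number `j` of steps is tuned to the proportion `q` of sets that contain the support of `e`, but
only some of these are good, since the columns must also be independent. If the good share is `βq`,
the probability is still at least `β/100` (`le_sin_sq_amplified`). Hence, if `e` is the only
solution, a round succeeds with probability at most `C(r+κ,w)/C(n,w)`, the probability that the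
permutation keeps the whole error (`successProb_le`), and at least a constant times this number,
provided that constant shares of the relevant `r`-sets of columns are independent
(`le_successProb`).

That share has to be bounded below with probability `1 - ε` over `H` for every `ε`, and a first
moment bound for `r`-sets does not give this. Instead, a set of `r - m` columns is dependent with
probability at most `2^(-m)`, so by Markov's inequality at least half of these sets are independent
except with probability `2 · 2^(-m)`. The missing `m` columns are added one by one: fewer than `r`
columns are annihilated by a nonzero combination `u` of the rows, and every column where `u H` is
nonzero preserves independence. By a Chernoff bound all combinations have linearly many such columns
(`freq_not_rowDistance_le`), so each extension costs a constant factor (`freq_indepRatio_lt_le`).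
This requires linearly many columns beyond `r`. For `δ > 0` the kept columns suffice
(`freq_successProb_le`); for `δ = 0` none is spare, and sets among all `n` columns are used, the
permutation supplying the average (`freq_successProb_le_of_zero`). Uniqueness of `e` fails with
probability at most `C(n,ω)/2^r`, which tends to zero for `ω = o(n)`.

A round costs `q^(-1/2)` up to polynomial factors, so `log T` equals `log C(n,ω) - (log C(r+κ,ω) +
log C(r,ω))/2` up to `O(log n)` (`abs_log_time_sub_le`). If `m/n → β` and `ω = o(n)`, then `log
(C(n,ω)/C(m,ω)) / ω → -log β` (`tendsto_log_choose_sub`). Taking `β = 1 - R` and `β = 1 - (1-δ)R`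
yields `t(δ)`; the entropies have the same limits (`tendsto_binEntropy_sub`). -/

lemma sum_zmod_two {M : Type*} [AddCommMonoid M] (f : ZMod 2 → M) : ∑ b, f b = f 0 + f 1 :=
  Fin.sum_univ_two f

lemma zmod_two_cases (b : ZMod 2) : b = 0 ∨ b = 1 := by
  revert b
  decide

/-! ### Circuits as linear maps and their adjoints -/

section
variable {W : Type} [DecidableEq W]

/-- All controls of the gate carry the prescribed values. -/
def Gate.Active (g : Gate W) (x : W → ZMod 2) : Prop := ∀ c ∈ g.controls, x c = g.value c

lemma Gate.active_update (g : Gate W) (x : W → ZMod 2) (b : ZMod 2) :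
    g.Active (Function.update x g.target b) ↔ g.Active x := by
  refine forall₂_congr fun c hc => ?_
  rw [Function.update_of_ne]
  rintro rfl
  exact g.target_notMem hc

lemma Gate.apply_of_active {g : Gate W} {x : W → ZMod 2} (h : g.Active x) (ψ : QState W) :
    g.apply ψ x = ∑ b : ZMod 2, (g.op : Matrix (ZMod 2) (ZMod 2) ℂ) (x g.target) b
      * ψ (Function.update x g.target b) := if_pos h

lemma Gate.apply_of_not_active {g : Gate W} {x : W → ZMod 2} (h : ¬ g.Active x) (ψ : QState W) :
    g.apply ψ x = ψ x := if_neg h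

lemma Gate.apply_add (g : Gate W) (φ ψ : QState W) : g.apply (φ + ψ) = g.apply φ + g.apply ψ := by
  ext x
  by_cases h : g.Active x
  · simp [Gate.apply_of_active h, mul_add, Finset.sum_add_distrib]
  · simp [Gate.apply_of_not_active h]

lemma Gate.apply_smul (g : Gate W) (a : ℂ) (ψ : QState W) : g.apply (a • ψ) = a • g.apply ψ := by
  ext x
  by_cases h : g.Active x
  · simp [Gate.apply_of_active h, Finset.mul_sum, mul_left_comm]
  · simp [Gate.apply_of_not_active h]

lemma Circuit.run_nil (ψ : QState W) : Circuit.run ([] : Circuit W) ψ = ψ := rfl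

lemma Circuit.run_cons (g : Gate W) (C : Circuit W) (ψ : QState W) :
    Circuit.run (g :: C) ψ = C.run (g.apply ψ) := rfl

lemma Circuit.run_append (C D : Circuit W) (ψ : QState W) :
    Circuit.run (C ++ D) ψ = D.run (C.run ψ) := by
  simp [Circuit.run]

lemma Circuit.run_add (C : Circuit W) (φ ψ : QState W) :
    C.run (φ + ψ) = C.run φ + C.run ψ := by
  induction C generalizing φ ψ with
  | nil => rfl
  | cons g C ih => simp only [Circuit.run_cons, Gate.apply_add, ih]

lemma Circuit.run_smul (C : Circuit W) (a : ℂ) (ψ : QState W) :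
    C.run (a • ψ) = a • C.run ψ := by
  induction C generalizing ψ with
  | nil => rfl
  | cons g C ih => simp only [Circuit.run_cons, Gate.apply_smul, ih]

/-- The action of a circuit as a linear map. -/
def Circuit.lin (C : Circuit W) : QState W →ₗ[ℂ] QState W where
  toFun := C.run
  map_add' := C.run_add
  map_smul' := C.run_smul

lemma Circuit.run_sum {ι : Type*} (C : Circuit W) (s : Finset ι) (f : ι → QState W) :
    C.run (∑ i ∈ s, f i) = ∑ i ∈ s, C.run (f i) := map_sum C.lin f s

lemma Circuit.run_sub (C : Circuit W) (φ ψ : QState W) :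
    C.run (φ - ψ) = C.run φ - C.run ψ := map_sub C.lin φ ψ

omit [DecidableEq W] in
lemma ket_apply_self (x : W → ZMod 2) : ket x x = 1 := if_pos rfl

omit [DecidableEq W] in
lemma ket_apply_of_ne {x y : W → ZMod 2} (h : y ≠ x) : ket x y = 0 := if_neg h

/-- The action of a gate on a basis state. -/
lemma Gate.apply_ket (g : Gate W) (x : W → ZMod 2) (h : g.Active x) :
    g.apply (ket x) = ∑ b : ZMod 2, (g.op : Matrix (ZMod 2) (ZMod 2) ℂ) b (x g.target)
      • ket (Function.update x g.target b) := by
  ext y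
  rw [Finset.sum_apply]
  simp only [Pi.smul_apply, smul_eq_mul]
  by_cases hy : g.Active y
  · rw [Gate.apply_of_active hy]
    by_cases hxy : ∃ b, y = Function.update x g.target b
    · obtain ⟨b, rfl⟩ := hxy
      rw [Finset.sum_eq_single (x g.target), Finset.sum_eq_single b]
      · simp [ket_apply_self]
      · intro b' _ hb'
        rw [ket_apply_of_ne, mul_zero]
        intro hcon
        have := congrFun hcon g.target
        simp only [Function.update_self] at this
        exact hb' this.symm
      · simp
      · intro b' _ hb'
        rw [ket_apply_of_ne, mul_zero]
        intro hcon
        have := congrFun hcon g.target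
        simp only [Function.update_self] at this
        exact hb' this
      · simp
    · rw [Finset.sum_eq_zero, Finset.sum_eq_zero]
      · intro b _
        rw [ket_apply_of_ne, mul_zero]
        exact fun hcon => hxy ⟨b, hcon⟩
      · intro b _
        rw [ket_apply_of_ne, mul_zero]
        intro hcon
        refine hxy ⟨y g.target, ?_⟩
        rw [← hcon]
        simp
  · rw [Gate.apply_of_not_active hy, ket_apply_of_ne, Finset.sum_eq_zero]
    · intro b _
      rw [ket_apply_of_ne, mul_zero]
      rintro rfl
      exact hy ((g.active_update x b).2 h)
    · rintro rfl
      exact hy h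

lemma Gate.apply_ket_of_not_active (g : Gate W) (x : W → ZMod 2) (h : ¬ g.Active x) :
    g.apply (ket x) = ket x := by
  ext y
  by_cases hy : g.Active y
  · rw [Gate.apply_of_active hy, ket_apply_of_ne (by rintro rfl; exact h hy), Finset.sum_eq_zero]
    intro b _
    rw [ket_apply_of_ne, mul_zero]
    rintro rfl
    exact h ((g.active_update y b).2 hy)
  · rw [Gate.apply_of_not_active hy]

omit [DecidableEq W] in
lemma Gate.adj_adj (g : Gate W) : g.adj.adj = g := by
  cases g
  simp [Gate.adj]

/-- The target is no control, so the inner gate is active at every updated configuration as well,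
and the two sums compose to the product of the matrix with its inverse. -/
lemma Gate.apply_adj_apply (g : Gate W) (ψ : QState W) : g.apply (g.adj.apply ψ) = ψ := by
  ext x
  by_cases h : g.Active x
  · rw [Gate.apply_of_active h]
    have h1 : ∀ b, g.adj.apply ψ (Function.update x g.target b) =
        ∑ b' : ZMod 2, (g.adj.op : Matrix (ZMod 2) (ZMod 2) ℂ) b b'
          * ψ (Function.update x g.target b') := by
      intro b
      have h2 : g.adj.Active (Function.update x g.target b) := (g.active_update x b).2 h
      rw [Gate.apply_of_active h2]
      simp [Gate.adj]
    simp only [h1, Finset.mul_sum]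
    rw [Finset.sum_comm]
    simp only [← mul_assoc, ← Finset.sum_mul]
    have h3 : (g.op : Matrix (ZMod 2) (ZMod 2) ℂ) * (g.adj.op : Matrix (ZMod 2) (ZMod 2) ℂ) = 1 := by
      rw [← Submonoid.coe_mul]
      simp [Gate.adj]
    have h4 : ∀ b', ∑ b, (g.op : Matrix (ZMod 2) (ZMod 2) ℂ) (x g.target) b *
        (g.adj.op : Matrix (ZMod 2) (ZMod 2) ℂ) b b' = if x g.target = b' then 1 else 0 := by
      intro b'
      rw [← Matrix.mul_apply, h3, Matrix.one_apply]
    simp [h4]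
  · rw [Gate.apply_of_not_active h]
    exact Gate.apply_of_not_active (g := g.adj) h ψ

omit [DecidableEq W] in
lemma Circuit.adj_cons (g : Gate W) (C : Circuit W) :
    Circuit.adj (g :: C) = Circuit.adj C ++ [g.adj] := by
  simp [Circuit.adj]

lemma Circuit.run_adj_run (C : Circuit W) (ψ : QState W) : C.adj.run (C.run ψ) = ψ := by
  induction C generalizing ψ with
  | nil => rfl
  | cons g C ih =>
    rw [Circuit.adj_cons, Circuit.run_append, Circuit.run_cons, Circuit.run_cons, ih,
      Circuit.run_nil]
    simpa [Gate.adj_adj] using Gate.apply_adj_apply g.adj ψ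

lemma Circuit.run_run_adj (C : Circuit W) (ψ : QState W) : C.run (C.adj.run ψ) = ψ := by
  induction C generalizing ψ with
  | nil => rfl
  | cons g C ih =>
    rw [Circuit.adj_cons, Circuit.run_append, Circuit.run_cons, Circuit.run_cons,
      Circuit.run_nil, Gate.apply_adj_apply, ih]

variable [Fintype W]

/-- Inactive configurations contribute equally to both sides. On the active ones, exchanging the
value of the target with the summation index is an involution of the pairs that matches the two
double sums. -/
lemma Gate.star_dotProduct_apply (g : Gate W) (φ χ : QState W) :
    star φ ⬝ᵥ g.apply χ = star (g.adj.apply φ) ⬝ᵥ χ := by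
  classical
  simp only [dotProduct, Pi.star_apply]
  rw [← Finset.sum_filter_add_sum_filter_not _ g.Active,
    ← Finset.sum_filter_add_sum_filter_not (f := fun x => star (g.adj.apply φ x) * χ x) _ g.Active]
  congr 1
  · have h1 : ∀ x ∈ Finset.univ.filter g.Active, star (φ x) * g.apply χ x =
        ∑ b : ZMod 2, star (φ x) * ((g.op : Matrix (ZMod 2) (ZMod 2) ℂ) (x g.target) b
          * χ (Function.update x g.target b)) := by
      intro x hx
      rw [Gate.apply_of_active (Finset.mem_filter.1 hx).2, Finset.mul_sum]
    have h2 : ∀ x ∈ Finset.univ.filter g.Active, star (g.adj.apply φ x) * χ x =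
        ∑ b : ZMod 2, star (φ (Function.update x g.target b)) *
          ((g.op : Matrix (ZMod 2) (ZMod 2) ℂ) b (x g.target) * χ x) := by
      intro x hx
      have h3 : g.adj.Active x := (Finset.mem_filter.1 hx).2
      rw [Gate.apply_of_active h3, star_sum, Finset.sum_mul]
      refine Finset.sum_congr rfl fun b _ => ?_
      have h4 : star ((g.adj.op : Matrix (ZMod 2) (ZMod 2) ℂ) (x g.target) b) =
          (g.op : Matrix (ZMod 2) (ZMod 2) ℂ) b (x g.target) := by
        change star ((star (g.op : Matrix (ZMod 2) (ZMod 2) ℂ)) (x g.target) b) = _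
        rw [Matrix.star_apply, star_star]
      change star ((g.adj.op : Matrix (ZMod 2) (ZMod 2) ℂ) (x g.target) b *
        φ (Function.update x g.target b)) * χ x = _
      rw [star_mul', h4]
      ring
    rw [Finset.sum_congr rfl h1, Finset.sum_congr rfl h2, ← Finset.sum_product',
      ← Finset.sum_product']
    refine Finset.sum_nbij' (fun p => (Function.update p.1 g.target p.2, p.1 g.target))
      (fun p => (Function.update p.1 g.target p.2, p.1 g.target)) ?_ ?_ ?_ ?_ ?_
    · intro p hp
      simp only [Finset.mem_product, Finset.mem_filter, Finset.mem_univ, true_and, and_true] at hp ⊢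
      exact (g.active_update _ _).2 hp
    · intro p hp
      simp only [Finset.mem_product, Finset.mem_filter, Finset.mem_univ, true_and, and_true] at hp ⊢
      exact (g.active_update _ _).2 hp
    · intro p _
      simp
    · intro p _
      simp
    · intro p _
      simp
  · refine Finset.sum_congr rfl fun x hx => ?_
    have hx' := (Finset.mem_filter.1 hx).2
    rw [Gate.apply_of_not_active hx', Gate.apply_of_not_active (g := g.adj) hx']

/-- This turns an amplitude of `A†ψ` at an initial state into the inner product of `ψ` with a
uniform superposition, which is all that the analysis of the amplification needs. -/
lemma Circuit.star_dotProduct_run (C : Circuit W) (φ χ : QState W) :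
    star φ ⬝ᵥ C.run χ = star (C.adj.run φ) ⬝ᵥ χ := by
  induction C generalizing φ χ with
  | nil => rfl
  | cons g C ih =>
    rw [Circuit.run_cons, ih, Gate.star_dotProduct_apply, Circuit.adj_cons, Circuit.run_append,
      Circuit.run_cons, Circuit.run_nil]

omit [DecidableEq W] [Fintype W] in
lemma star_ket_dotProduct [Fintype (W → ZMod 2)] (x : W → ZMod 2) (φ : QState W) :
    star (ket x) ⬝ᵥ φ = φ x := by
  classical
  simp only [dotProduct, Pi.star_apply]
  rw [Finset.sum_eq_single x]
  · simp [ket_apply_self]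
  · intro y _ hy
    simp [ket_apply_of_ne hy]
  · simp

end

/-! ### Cost, action on basis states, elementary gates -/

section
variable {W : Type}

lemma Circuit.cost_append (C D : Circuit W) :
    Circuit.cost (C ++ D) = C.cost + D.cost := by simp [Circuit.cost]

lemma Circuit.cost_adj (C : Circuit W) : C.adj.cost = C.cost := by
  simp [Circuit.cost, Circuit.adj, Gate.adj, Function.comp_def]

/-- The target and the controls of a gate are distinct wires. Hence it suffices to count gates and
wires, and the number of controls need not be tracked. -/
lemma Circuit.cost_le [Fintype W] [DecidableEq W] (C : Circuit W) :
    C.cost ≤ C.length * Fintype.card W := by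
  unfold Circuit.cost
  refine (List.sum_le_card_nsmul _ (Fintype.card W) ?_).trans (by simp)
  intro m hm
  obtain ⟨g, _, rfl⟩ := List.mem_map.1 hm
  have h := Finset.card_le_univ (insert g.target g.controls)
  rwa [Finset.card_insert_of_notMem g.target_notMem] at h

/-- The circuit maps the basis state `x` to the basis state `y`. -/
def Circuit.Maps [DecidableEq W] (C : Circuit W) (x y : W → ZMod 2) : Prop :=
  C.run (ket x) = ket y

variable [DecidableEq W]

lemma Circuit.Maps.append {C D : Circuit W} {x y z : W → ZMod 2} (h : C.Maps x y)
    (h' : D.Maps y z) : Circuit.Maps (C ++ D) x z := by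
  rw [Circuit.Maps, Circuit.run_append, h, h']

lemma Circuit.Maps.adj {C : Circuit W} {x y : W → ZMod 2} (h : C.Maps x y) : C.adj.Maps y x := by
  rw [Circuit.Maps, ← h, Circuit.run_adj_run]

/-- The one-qubit gate that exchanges `|0⟩` and `|1⟩`. -/
def notOp : Matrix.unitaryGroup (ZMod 2) ℂ :=
  ⟨Matrix.of fun a b => if a = b then 0 else 1, by
    rw [Matrix.mem_unitaryGroup_iff]
    ext i j
    rcases zmod_two_cases i with rfl | rfl <;> rcases zmod_two_cases j with rfl | rfl <;>
      simp [Matrix.mul_apply, sum_zmod_two, Matrix.star_apply]⟩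

/-- The one-qubit gate that flips the sign of `|1⟩`. -/
def signOp : Matrix.unitaryGroup (ZMod 2) ℂ :=
  ⟨Matrix.diagonal fun b => if b = 1 then -1 else 1, by
    rw [Matrix.mem_unitaryGroup_iff, Matrix.star_eq_conjTranspose, Matrix.diagonal_conjTranspose,
      Matrix.diagonal_mul_diagonal, ← Matrix.diagonal_one]
    congr 1
    funext b
    by_cases hb : b = 1 <;> simp [hb]⟩

/-- The one-qubit gate with `|0⟩ ↦ √(1 - p) |0⟩ + √p |1⟩`. -/
def rotOp (p : Set.Icc (0 : ℝ) 1) : Matrix.unitaryGroup (ZMod 2) ℂ :=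
  ⟨Matrix.of fun a b => if a = b then ((Real.sqrt (1 - p) : ℝ) : ℂ)
      else if a = 1 then ((Real.sqrt p : ℝ) : ℂ) else -((Real.sqrt p : ℝ) : ℂ), by
    have h1 : ((Real.sqrt p : ℝ) : ℂ) * ((Real.sqrt p : ℝ) : ℂ) = ((p : ℝ) : ℂ) := by
      rw [← Complex.ofReal_mul, Real.mul_self_sqrt p.2.1]
    have h2 : ((Real.sqrt (1 - p) : ℝ) : ℂ) * ((Real.sqrt (1 - p) : ℝ) : ℂ) = 1 - ((p : ℝ) : ℂ) := by
      rw [← Complex.ofReal_mul, Real.mul_self_sqrt (sub_nonneg.2 p.2.2)]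
      simp
    rw [Matrix.mem_unitaryGroup_iff]
    ext i j
    rcases zmod_two_cases i with rfl | rfl <;> rcases zmod_two_cases j with rfl | rfl <;>
      simp [Matrix.mul_apply, sum_zmod_two, Matrix.star_apply, h1, h2, mul_comm]⟩

/-- The negation of the wire `t`, controlled on the value one of the wires `pos` and the value zero
of the wires `neg`. -/
def controlled (op : Matrix.unitaryGroup (ZMod 2) ℂ) (t : W) (pos neg : Finset W) : Gate W where
  target := t
  -- Erasing `t` makes this a gate for all arguments; in `controlled_active` nothing is erased.
  controls := (pos ∪ neg).erase t
  value := fun c => if c ∈ pos then 1 else 0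
  target_notMem := Finset.notMem_erase t _
  op := op

lemma controlled_active {op : Matrix.unitaryGroup (ZMod 2) ℂ} {t : W} {pos neg : Finset W}
    (hp : t ∉ pos) (hn : t ∉ neg) (hd : Disjoint pos neg) (x : W → ZMod 2) :
    (controlled op t pos neg).Active x ↔ (∀ c ∈ pos, x c = 1) ∧ ∀ c ∈ neg, x c = 0 := by
  have h1 : (pos ∪ neg).erase t = pos ∪ neg :=
    Finset.erase_eq_of_notMem (by simp [hp, hn])
  simp only [Gate.Active, controlled, h1, Finset.mem_union]
  constructor
  · intro h
    refine ⟨fun c hc => by simpa [hc] using h c (Or.inl hc), fun c hc => ?_⟩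
    simpa [Finset.disjoint_right.1 hd hc] using h c (Or.inr hc)
  · rintro ⟨h2, h3⟩ c (hc | hc)
    · simp [hc, h2 c hc]
    · simp [Finset.disjoint_right.1 hd hc, h3 c hc]

end

lemma Circuit.adj_adj {W : Type} (C : Circuit W) : C.adj.adj = C := by
  simp [Circuit.adj, Function.comp_def, Gate.adj_adj]

/-! ### The reflection in the initial states and superpositions of column sets -/

section
variable {r κ : ℕ}

lemma config_inj {a : ℕ} {M M' : Matrix (Fin r) (Fin κ) (ZMod 2)} {s s' : Fin r → ZMod 2}
    {b b' : Col r κ → ZMod 2} (h : config a M s b = config a M' s' b') :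
    M = M' ∧ s = s' ∧ b = b' := by
  refine ⟨?_, ?_, ?_⟩
  · ext i j
    exact congrFun h (Sum.inl (Sum.inl (i, j)))
  · ext i
    exact congrFun h (Sum.inl (Sum.inr i))
  · ext i
    exact congrFun h (Sum.inr (Sum.inl i))

lemma bits_injective : Function.Injective (bits : Finset (Col r κ) → Col r κ → ZMod 2) := by
  intro I J h
  ext c
  have := congrFun h c
  by_cases hI : c ∈ I <;> by_cases hJ : c ∈ J <;> simp_all [bits]

/-- The inputs of the search. -/
abbrev SearchInput (r κ : ℕ) := Matrix (Fin r) (Fin κ) (ZMod 2) × (Fin r → ZMod 2)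

/-- The gate ignores the matrix and syndrome registers, so it reflects in the initial states of all
inputs simultaneously; this is why a sum over inputs appears. -/
lemma flipInitial_run (a : ℕ) (φ : QState (Wire r κ a)) :
    (flipInitial r κ a).run φ = φ - (2 : ℂ) • ∑ p : SearchInput r κ,
      φ (config a p.1 p.2 0) • ket (config a p.1 p.2 0) := by
  ext x
  simp only [flipInitial, Circuit.run_cons, Circuit.run_nil, Pi.sub_apply, Pi.smul_apply,
    Finset.sum_apply, smul_eq_mul]
  set g : Gate (Wire r κ a) :=
    { target := Sum.inr (Sum.inr 0)
      controls := Finset.univ.filter fun c =>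
        (∃ v : Col r κ ⊕ Fin (a + 1), c = Sum.inr v) ∧ c ≠ Sum.inr (Sum.inr 0)
      value := 0
      target_notMem := by simp
      op := flipZero } with hg
  have hop : ∀ i j : ZMod 2, (flipZero : Matrix (ZMod 2) (ZMod 2) ℂ) i j =
      if i = j then (if i = 0 then -1 else 1) else 0 := by
    intro i j
    simp [flipZero, Matrix.diagonal_apply]
  have hval : g.apply φ x = if ∀ v, x (Sum.inr v) = 0 then -φ x else φ x := by
    by_cases h : g.Active x
    · rw [Gate.apply_of_active h, Finset.sum_eq_single (x g.target)]
      · have h1 : (g.op : Matrix (ZMod 2) (ZMod 2) ℂ) (x g.target) (x g.target) =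
          if x (Sum.inr (Sum.inr 0)) = 0 then -1 else 1 := by simp [hg, hop]
        rw [h1, Function.update_eq_self]
        have h2 : (∀ v, x (Sum.inr v) = 0) ↔ x (Sum.inr (Sum.inr 0)) = 0 := by
          refine ⟨fun h => h _, fun h3 v => ?_⟩
          by_cases hv : v = Sum.inr 0
          · rw [hv, h3]
          · exact h (Sum.inr v) (Finset.mem_filter.2 ⟨Finset.mem_univ _, ⟨v, rfl⟩,
              fun h4 => hv (Sum.inr_injective h4)⟩)
        rw [if_congr h2 rfl rfl]
        split_ifs <;> ring
      · intro b _ hb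
        have h1 : (g.op : Matrix (ZMod 2) (ZMod 2) ℂ) (x g.target) b = 0 := by
          simp [hg, hop]
          intro h'
          exact absurd h'.symm hb
        rw [h1, zero_mul]
      · simp
    · rw [Gate.apply_of_not_active h, if_neg]
      intro h1
      refine h fun c hc => ?_
      obtain ⟨v, rfl⟩ := (Finset.mem_filter.1 hc).2.1
      exact h1 v
  rw [hval]
  split_ifs with h
  · have hx : x = config a (Matrix.of fun i j => x (Sum.inl (Sum.inl (i, j))))
        (fun i => x (Sum.inl (Sum.inr i))) 0 := by
      ext v
      rcases v with (v | v) | (v | v)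
      · rfl
      · rfl
      · simpa [config] using h _
      · simpa [config] using h _
    rw [Finset.sum_eq_single (Matrix.of fun i j => x (Sum.inl (Sum.inl (i, j))),
        fun i => x (Sum.inl (Sum.inr i)))]
    · rw [← hx, ket_apply_self]
      ring
    · rintro ⟨M, s⟩ _ hp
      rw [ket_apply_of_ne, mul_zero]
      rw [hx]
      intro hcon
      obtain ⟨h1, h2, -⟩ := config_inj hcon
      exact hp (Prod.ext h1.symm h2.symm)
    · simp
  · rw [Finset.sum_eq_zero]
    · simp
    · rintro ⟨M, s⟩ _
      rw [ket_apply_of_ne, mul_zero]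
      rintro rfl
      apply h
      rintro (v | v) <;> rfl

/-- The sets of `r` columns. -/
abbrev columnSets (r κ : ℕ) : Finset (Finset (Col r κ)) :=
  (Finset.univ : Finset (Col r κ)).powersetCard r

lemma card_columnSets : (columnSets r κ).card = (r + κ).choose r := by
  simp [columnSets]

/-- The superposition of the sets of `r` columns with amplitudes `f`. -/
def superposition (a : ℕ) (p : SearchInput r κ) (f : Finset (Col r κ) → ℂ) :
    QState (Wire r κ a) :=
  ∑ I ∈ columnSets r κ, f I • ket (config a p.1 p.2 (bits I))

lemma superposition_apply (a : ℕ) (p : SearchInput r κ) (f : Finset (Col r κ) → ℂ)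
    {I : Finset (Col r κ)} (hI : I ∈ columnSets r κ) :
    superposition a p f (config a p.1 p.2 (bits I)) = f I := by
  rw [superposition, Finset.sum_apply, Finset.sum_eq_single_of_mem I hI]
  · simp [ket_apply_self]
  · intro J _ hJ
    rw [Pi.smul_apply, ket_apply_of_ne, smul_zero]
    intro h
    exact hJ (bits_injective (config_inj h).2.2).symm

lemma superposition_apply_of_ne (a : ℕ) (p : SearchInput r κ) (f : Finset (Col r κ) → ℂ)
    {x : Wire r κ a → ZMod 2} (hx : ∀ I ∈ columnSets r κ, x ≠ config a p.1 p.2 (bits I)) :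
    superposition a p f x = 0 := by
  rw [superposition, Finset.sum_apply]
  refine Finset.sum_eq_zero fun I hI => ?_
  rw [Pi.smul_apply, ket_apply_of_ne (hx I hI), smul_zero]

lemma superposition_congr (a : ℕ) (p : SearchInput r κ) {f g : Finset (Col r κ) → ℂ}
    (h : ∀ I ∈ columnSets r κ, f I = g I) : superposition a p f = superposition a p g :=
  Finset.sum_congr rfl fun I hI => by rw [h I hI]

lemma superposition_sub (a : ℕ) (p : SearchInput r κ) (f g : Finset (Col r κ) → ℂ) :
    superposition a p f - superposition a p g = superposition a p (f - g) := by
  simp [superposition, sub_smul]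

lemma superposition_smul (a : ℕ) (p : SearchInput r κ) (z : ℂ) (f : Finset (Col r κ) → ℂ) :
    z • superposition a p f = superposition a p (z • f) := by
  simp [superposition, Finset.smul_sum, smul_smul]

lemma star_superposition_dotProduct (a : ℕ) (p : SearchInput r κ) (f : Finset (Col r κ) → ℂ)
    (φ : QState (Wire r κ a)) :
    star (superposition a p f) ⬝ᵥ φ =
      ∑ I ∈ columnSets r κ, star (f I) * φ (config a p.1 p.2 (bits I)) := by
  simp only [superposition, star_sum, star_smul, sum_dotProduct, smul_dotProduct,
    star_ket_dotProduct, smul_eq_mul]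

end

/-! ### Exact analysis of the amplitude amplification -/

namespace SearchCircuits
variable {r κ w : ℕ} (D : SearchCircuits r κ w)

/-- The amplitude of a single set of columns in the uniform superposition. -/
def uniformAmplitude (r κ : ℕ) : ℂ := ((Real.sqrt ((r + κ).choose r) : ℝ) : ℂ)⁻¹

lemma uniformAmplitude_sq (r κ : ℕ) :
    uniformAmplitude r κ * uniformAmplitude r κ = (((r + κ).choose r : ℝ) : ℂ)⁻¹ := by
  rw [uniformAmplitude, ← mul_inv, ← Complex.ofReal_mul, Real.mul_self_sqrt (Nat.cast_nonneg _)]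

lemma star_uniformAmplitude (r κ : ℕ) : star (uniformAmplitude r κ) = uniformAmplitude r κ := by
  simp [uniformAmplitude]

lemma prep_run (p : SearchInput r κ) : D.prep.run (ket (config D.anc p.1 p.2 0)) =
    superposition D.anc p fun _ => uniformAmplitude r κ := by
  rw [D.prep_spec, superposition, Finset.smul_sum]
  rfl

/-- The sign which the oracle gives to a set of columns. -/
def oracleSign (w : ℕ) (p : SearchInput r κ) (I : Finset (Col r κ)) : ℂ :=
  open Classical in if Marked p.1 p.2 w I then -1 else 1

lemma oracle_run (p : SearchInput r κ) (f : Finset (Col r κ) → ℂ) :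
    D.oracle.run (superposition D.anc p f) =
      superposition D.anc p fun I => oracleSign w p I * f I := by
  rw [superposition, Circuit.run_sum, superposition]
  refine Finset.sum_congr rfl fun I hI => ?_
  rw [Circuit.run_smul, D.oracle_spec _ _ _ (Finset.mem_powersetCard.1 hI).2, smul_smul, mul_comm]
  rfl

/-- Conjugation with `A` turns the reflection in the initial states into the reflection in the
uniform superpositions of all inputs. Superpositions for different inputs have disjoint supports, so
only the one for `p` contributes. -/
lemma reflection_run (p : SearchInput r κ) (f : Finset (Col r κ) → ℂ) :
    D.prep.run ((flipInitial r κ D.anc).run (D.prep.adj.run (superposition D.anc p f))) =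
      superposition D.anc p fun I =>
        f I - 2 * (((r + κ).choose r : ℝ) : ℂ)⁻¹ * ∑ J ∈ columnSets r κ, f J := by
  rw [flipInitial_run, Circuit.run_sub, Circuit.run_run_adj, Circuit.run_smul, Circuit.run_sum]
  have h1 : ∀ p' : SearchInput r κ,
      D.prep.adj.run (superposition D.anc p f) (config D.anc p'.1 p'.2 0) =
        if p' = p then uniformAmplitude r κ * ∑ J ∈ columnSets r κ, f J else 0 := by
    intro p'
    rw [← star_ket_dotProduct (config D.anc p'.1 p'.2 0)
      (D.prep.adj.run (superposition D.anc p f)), Circuit.star_dotProduct_run, Circuit.adj_adj, D.prep_run,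
      star_superposition_dotProduct]
    split_ifs with h
    · subst h
      rw [Finset.mul_sum]
      refine Finset.sum_congr rfl fun I hI => ?_
      rw [superposition_apply _ _ _ hI, star_uniformAmplitude]
    · refine Finset.sum_eq_zero fun I _ => ?_
      rw [superposition_apply_of_ne, mul_zero]
      intro J _ hJ
      obtain ⟨h2, h3, -⟩ := config_inj hJ
      exact h (Prod.ext h2 h3)
  simp only [Circuit.run_smul, h1]
  rw [Finset.sum_eq_single p (fun p' _ hp' => by rw [if_neg hp', zero_smul]) (by simp), if_pos rfl]
  rw [D.prep_run, superposition_smul, superposition_smul, superposition_sub]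
  refine superposition_congr _ _ fun I _ => ?_
  simp only [Pi.sub_apply, Pi.smul_apply, smul_eq_mul]
  rw [← uniformAmplitude_sq]
  ring

/-- The marked sets of columns. -/
def markedSets (w : ℕ) (p : SearchInput r κ) : Finset (Finset (Col r κ)) :=
  open Classical in (columnSets r κ).filter fun I => Marked p.1 p.2 w I

lemma card_markedSets_le (p : SearchInput r κ) :
    (markedSets w p).card ≤ (r + κ).choose r := by
  classical
  rw [← card_columnSets]
  exact Finset.card_filter_le _ _

/-- The amplitudes of the marked and the unmarked sets of columns after `j` amplification steps,
if `t` of `N` sets are marked. -/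
def amplitudes (N t : ℝ) : ℕ → ℝ × ℝ
  | 0 => ((Real.sqrt N)⁻¹, (Real.sqrt N)⁻¹)
  | j + 1 =>
    let z := amplitudes N t j
    (-z.1 - 2 * N⁻¹ * (-(t * z.1) + (N - t) * z.2), z.2 - 2 * N⁻¹ * (-(t * z.1) + (N - t) * z.2))

/-- The pair of total amplitudes on marked and unmarked sets is a point of the unit circle,
initially `(sin θ, cos θ)` with `sin² θ = t / N`, and every step is a rotation by `2θ` followed by a
change of sign. The factor `(-1) ^ j` arises because `S₀` negates the initial state rather than its
complement. -/
lemma sqrt_mul_amplitudes {N t : ℝ} (hN : 0 < N) (ht : 0 ≤ t) (htN : t ≤ N) (j : ℕ) :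
    Real.sqrt t * (amplitudes N t j).1 =
        (-1) ^ j * Real.sin ((2 * j + 1) * Real.arcsin (Real.sqrt (t / N))) ∧
      Real.sqrt (N - t) * (amplitudes N t j).2 =
        (-1) ^ j * Real.cos ((2 * j + 1) * Real.arcsin (Real.sqrt (t / N))) := by
  set θ := Real.arcsin (Real.sqrt (t / N)) with hθ
  have h0 : 0 ≤ t / N := by positivity
  have h1 : t / N ≤ 1 := (div_le_one hN).2 htN
  have hs : Real.sin θ = Real.sqrt (t / N) := Real.sin_arcsin
    (by linarith [Real.sqrt_nonneg (t / N)]) (Real.sqrt_le_one.2 h1)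
  have hc : Real.cos θ = Real.sqrt ((N - t) / N) := by
    rw [hθ, Real.cos_arcsin, Real.sq_sqrt h0]
    congr 1
    field_simp
  have hN' : Real.sqrt N ≠ 0 := (Real.sqrt_pos.2 hN).ne'
  have hs' : Real.sqrt t = Real.sqrt N * Real.sin θ := by
    rw [hs, Real.sqrt_div ht]
    field_simp
  have hc' : Real.sqrt (N - t) = Real.sqrt N * Real.cos θ := by
    rw [hc, Real.sqrt_div (sub_nonneg.2 htN)]
    field_simp
  have hNs : Real.sqrt N ^ 2 = N := Real.sq_sqrt hN.le
  have ht2 : t = N * Real.sin θ ^ 2 := by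
    rw [← Real.sq_sqrt ht, hs', mul_pow, hNs]
  have ht3 : N - t = N * Real.cos θ ^ 2 := by
    rw [← Real.sq_sqrt (sub_nonneg.2 htN), hc', mul_pow, hNs]
  induction j with
  | zero =>
    simp only [amplitudes, hs', hc']
    constructor <;> simp [mul_comm (Real.sqrt N), hN']
  | succ j ih =>
    obtain ⟨ih1, ih2⟩ := ih
    rw [hs'] at ih1
    rw [hc'] at ih2
    have e : (2 * ((j + 1 : ℕ) : ℝ) + 1) * θ = (2 * j + 1) * θ + 2 * θ := by push_cast; ring
    have hmean : N⁻¹ * (-(t * (amplitudes N t j).1) + (N - t) * (amplitudes N t j).2) =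
        -(Real.sin θ ^ 2 * (amplitudes N t j).1) + Real.cos θ ^ 2 * (amplitudes N t j).2 := by
      rw [ht3, ht2]
      field_simp
    rw [e, Real.sin_add, Real.cos_add, Real.sin_two_mul, Real.cos_two_mul, hs', hc']
    simp only [amplitudes]
    have hsc := Real.sin_sq_add_cos_sq θ
    constructor
    · rw [mul_assoc 2, hmean, pow_succ]
      linear_combination (1 - 2 * Real.cos θ ^ 2) * ih1 - 2 * Real.sin θ * Real.cos θ * ih2
        + 2 * Real.sqrt N * Real.sin θ * (amplitudes N t j).1 * hsc
    · rw [mul_assoc 2, hmean, pow_succ]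
      linear_combination (1 - 2 * Real.cos θ ^ 2) * ih2 + 2 * Real.sin θ * Real.cos θ * ih1

/-- Each step multiplies by a sign that depends only on being marked and then subtracts the same
number from all amplitudes, so two real numbers describe the state throughout. -/
lemma amplified_run (p : SearchInput r κ) (j : ℕ) :
    Circuit.run (D.prep ++ (List.replicate j
      (D.oracle ++ D.prep.adj ++ flipInitial r κ D.anc ++ D.prep)).flatten)
        (ket (config D.anc p.1 p.2 0)) =
      superposition D.anc p fun I => open Classical in
        if Marked p.1 p.2 w I then
          (((amplitudes ((r + κ).choose r) (markedSets w p).card j).1 : ℝ) : ℂ)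
        else (((amplitudes ((r + κ).choose r) (markedSets w p).card j).2 : ℝ) : ℂ) := by
  classical
  induction j with
  | zero =>
    simp [amplitudes, D.prep_run, uniformAmplitude]
  | succ j ih =>
    rw [List.replicate_succ', List.flatten_append, ← List.append_assoc, Circuit.run_append, ih]
    simp only [List.flatten_cons, List.flatten_nil, List.append_nil]
    rw [Circuit.run_append, Circuit.run_append, Circuit.run_append, D.oracle_run, D.reflection_run]
    set z := amplitudes ((r + κ).choose r) (markedSets w p).card j with hz
    have hsum : ∑ J ∈ columnSets r κ, (oracleSign w p J * if Marked p.1 p.2 w J then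
        ((z.1 : ℝ) : ℂ) else ((z.2 : ℝ) : ℂ)) =
        ((-((markedSets w p).card * z.1) +
          (((r + κ).choose r : ℝ) - (markedSets w p).card) * z.2 : ℝ) : ℂ) := by
      rw [← Finset.sum_filter_add_sum_filter_not (columnSets r κ) fun I => Marked p.1 p.2 w I]
      have h1 : ∀ J ∈ (columnSets r κ).filter (fun I => Marked p.1 p.2 w I),
          (oracleSign w p J * if Marked p.1 p.2 w J then ((z.1 : ℝ) : ℂ) else ((z.2 : ℝ) : ℂ)) =
            -((z.1 : ℝ) : ℂ) := by
        intro J hJ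
        simp [oracleSign, (Finset.mem_filter.1 hJ).2]
      have h2 : ∀ J ∈ (columnSets r κ).filter (fun J => ¬ Marked p.1 p.2 w J),
          (oracleSign w p J * if Marked p.1 p.2 w J then ((z.1 : ℝ) : ℂ) else ((z.2 : ℝ) : ℂ)) =
            ((z.2 : ℝ) : ℂ) := by
        intro J hJ
        simp [oracleSign, (Finset.mem_filter.1 hJ).2]
      have h3 : ((columnSets r κ).filter (fun I => Marked p.1 p.2 w I)).card = (markedSets w p).card := by
        rw [markedSets]
      have h4 : (((columnSets r κ).filter (fun J => ¬ Marked p.1 p.2 w J)).card : ℂ) =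
          ((r + κ).choose r : ℂ) - (markedSets w p).card := by
        rw [← card_columnSets, ← Finset.card_filter_add_card_filter_not
          (s := columnSets r κ) fun I => Marked p.1 p.2 w I, h3]
        push_cast
        ring
      rw [Finset.sum_congr rfl h1, Finset.sum_congr rfl h2, Finset.sum_const, Finset.sum_const,
        nsmul_eq_mul, nsmul_eq_mul, h3, h4]
      push_cast
      ring
    rw [hsum]
    refine superposition_congr _ _ fun I _ => ?_
    simp only [amplitudes, ← hz, oracleSign]
    split_ifs
    · push_cast
      ring
    · push_cast
      ring

lemma measureProb_eq (p : SearchInput r κ) (I : Finset (Col r κ)) :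
    D.measureProb p.1 p.2 I = open Classical in
      if I ∈ columnSets r κ then
        (if Marked p.1 p.2 w I then
          (amplitudes ((r + κ).choose r) (markedSets w p).card (iterations r κ w)).1 ^ 2
        else (amplitudes ((r + κ).choose r) (markedSets w p).card (iterations r κ w)).2 ^ 2)
      else 0 := by
  classical
  rw [measureProb, amplified, D.amplified_run]
  split_ifs with hI hM
  · rw [Finset.sum_eq_single (config D.anc p.1 p.2 (bits I))]
    · rw [if_pos (by intro c; rfl), superposition_apply _ _ _ hI]
      simp [hM]
    · intro x _ hx
      split_ifs with hx'
      · rw [superposition_apply_of_ne]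
        · simp
        · rintro J _ rfl
          have : bits J = bits I := funext hx'
          rw [bits_injective this] at hx
          exact hx rfl
      · rfl
    · simp
  · rw [Finset.sum_eq_single (config D.anc p.1 p.2 (bits I))]
    · rw [if_pos (by intro c; rfl), superposition_apply _ _ _ hI]
      simp [hM]
    · intro x _ hx
      split_ifs with hx'
      · rw [superposition_apply_of_ne]
        · simp
        · rintro J _ rfl
          have : bits J = bits I := funext hx'
          rw [bits_injective this] at hx
          exact hx rfl
      · rfl
    · simp
  · refine Finset.sum_eq_zero fun x _ => ?_
    split_ifs with hx'
    · rw [superposition_apply_of_ne]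
      · simp
      · rintro J hJ rfl
        have : bits J = bits I := funext hx'
        rw [bits_injective this] at hJ
        exact hI hJ
    · rfl

lemma measureProb_nonneg (p : SearchInput r κ) (I : Finset (Col r κ)) :
    0 ≤ D.measureProb p.1 p.2 I := by
  rw [measureProb_eq]
  split_ifs <;> positivity

/-- The rotation angle after the amplification. -/
def angle (r κ w t : ℕ) : ℝ := (2 * iterations r κ w + 1) *
  Real.arcsin (Real.sqrt ((t : ℝ) / (r + κ).choose r))

/-- The probability to measure a marked set of columns. -/
lemma sum_markedSets_measureProb (p : SearchInput r κ) :
    ∑ I ∈ markedSets w p, D.measureProb p.1 p.2 I =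
      Real.sin (angle r κ w (markedSets w p).card) ^ 2 := by
  classical
  have hN : (0 : ℝ) < (r + κ).choose r := by
    exact_mod_cast Nat.choose_pos (Nat.le_add_right r κ)
  have h := (sqrt_mul_amplitudes (t := (markedSets w p).card) hN (Nat.cast_nonneg _)
    (by exact_mod_cast card_markedSets_le p) (iterations r κ w)).1
  have h1 : ∀ I ∈ markedSets w p, D.measureProb p.1 p.2 I =
      (amplitudes ((r + κ).choose r) (markedSets w p).card (iterations r κ w)).1 ^ 2 := by
    intro I hI
    rw [markedSets, Finset.mem_filter] at hI
    rw [measureProb_eq, if_pos hI.1, if_pos hI.2]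
  rw [Finset.sum_congr rfl h1, Finset.sum_const, nsmul_eq_mul, angle]
  -- The factor `t` is written as `(√t)²` and absorbed into the squared amplitude.
  conv_lhs => rw [← Real.sq_sqrt (Nat.cast_nonneg (α := ℝ) (markedSets w p).card), ← mul_pow]
  rw [Real.sq_sqrt (Nat.cast_nonneg (α := ℝ) (markedSets w p).card), h, mul_pow]
  rw [← pow_mul, mul_comm _ 2, pow_mul]
  simp

end SearchCircuits

/-! ### Reversible classical computation by controlled negations -/

section
variable {W : Type} [DecidableEq W]

lemma Gate.maps_of_notOp {g : Gate W} (hg : g.op = notOp) (x : W → ZMod 2) :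
    g.apply (ket x) = ket (open Classical in
      if g.Active x then Function.update x g.target (x g.target + 1) else x) := by
  by_cases h : g.Active x
  · rw [Gate.apply_ket _ _ h, hg, if_pos h, sum_zmod_two]
    rcases zmod_two_cases (x g.target) with h0 | h0 <;> simp [notOp, h0]
    rfl
  · rw [Gate.apply_ket_of_not_active _ _ h, if_neg h]

/-- The wires of the first set carry the value one, and those of the second set the value zero. -/
def Holds (q : Finset W × Finset W) (x : W → ZMod 2) : Prop :=
  (∀ c ∈ q.1, x c = 1) ∧ ∀ c ∈ q.2, x c = 0

/-- The indicator of `Holds`. -/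
def holdsBit (q : Finset W × Finset W) (x : W → ZMod 2) : ZMod 2 :=
  open Classical in if Holds q x then 1 else 0

omit [DecidableEq W] in
lemma holdsBit_congr {q : Finset W × Finset W} {x y : W → ZMod 2} (h1 : ∀ c ∈ q.1, x c = y c)
    (h2 : ∀ c ∈ q.2, x c = y c) : holdsBit q x = holdsBit q y := by
  classical
  unfold holdsBit
  refine if_congr (and_congr ?_ ?_) rfl rfl
  · exact forall₂_congr fun c hc => by rw [h1 c hc]
  · exact forall₂_congr fun c hc => by rw [h2 c hc]

/-- For every `v` and every condition in the list `q v`, the wire `tgt v` is negated if the condition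
holds. -/
def togglesOf {V : Type} (vs : List V) (tgt : V → W) (q : V → List (Finset W × Finset W)) :
    Circuit W :=
  vs.flatMap fun v => (q v).map fun q => controlled notOp (tgt v) q.1 q.2

/-- The target occurs in none of the conditions, so earlier negations do not affect later conditions
and the contributions add up modulo two. -/
lemma maps_controlled_list (t : W) (qs : List (Finset W × Finset W))
    (h : ∀ q ∈ qs, t ∉ q.1 ∧ t ∉ q.2 ∧ Disjoint q.1 q.2) (x : W → ZMod 2) :
    Circuit.Maps (qs.map fun q => controlled notOp t q.1 q.2) x
      (Function.update x t (x t + (qs.map fun q => holdsBit q x).sum)) := by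
  induction qs generalizing x with
  | nil => simp [Circuit.Maps, Circuit.run_nil]
  | cons q qs ih =>
    obtain ⟨h1, h2, h3⟩ := h q (by simp)
    rw [List.map_cons, Circuit.Maps, Circuit.run_cons, Gate.maps_of_notOp rfl]
    have h4 : (open Classical in if (controlled notOp t q.1 q.2).Active x then
        Function.update x (controlled notOp t q.1 q.2).target
          (x (controlled notOp t q.1 q.2).target + 1) else x) =
        Function.update x t (x t + holdsBit q x) := by
      rw [holdsBit]
      by_cases hq : Holds q x
      · rw [if_pos ((controlled_active h1 h2 h3 x).2 hq), if_pos hq]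
        rfl
      · rw [if_neg (fun hc => hq ((controlled_active h1 h2 h3 x).1 hc)), if_neg hq, add_zero,
          Function.update_eq_self]
    have h5 := ih (fun q' hq' => h q' (by simp [hq'])) (Function.update x t (x t + holdsBit q x))
    rw [h4]
    refine h5.trans ?_
    congr 1
    rw [Function.update_idem, Function.update_self, List.map_cons, List.sum_cons, ← add_assoc]
    congr 3
    refine List.map_congr_left fun q' hq' => ?_
    obtain ⟨h6, h7, -⟩ := h q' (by simp [hq'])
    refine holdsBit_congr (fun c hc => ?_) (fun c hc => ?_)
    · rw [Function.update_of_ne]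
      rintro rfl
      exact h6 hc
    · rw [Function.update_of_ne]
      rintro rfl
      exact h7 hc

/-- No target is a control of any gate of the circuit, so all conditions may be evaluated in the
initial configuration. The final configuration is a variable `y` with two characterising properties,
so that every application can use its own description of it. -/
lemma maps_togglesOf {V : Type} (vs : List V) (hvs : vs.Nodup) (tgt : V → W)
    (ht : ∀ v ∈ vs, ∀ v' ∈ vs, tgt v = tgt v' → v = v') (q : V → List (Finset W × Finset W))
    (h : ∀ v ∈ vs, ∀ v' ∈ vs, ∀ c ∈ q v', tgt v ∉ c.1 ∧ tgt v ∉ c.2)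
    (hd : ∀ v ∈ vs, ∀ c ∈ q v, Disjoint c.1 c.2) {x y : W → ZMod 2}
    (hy : ∀ v ∈ vs, y (tgt v) = x (tgt v) + ((q v).map fun c => holdsBit c x).sum)
    (hy' : ∀ u, (∀ v ∈ vs, u ≠ tgt v) → y u = x u) :
    (togglesOf vs tgt q).Maps x y := by
  induction vs generalizing x with
  | nil =>
    have : y = x := funext fun u => hy' u (by simp)
    subst this
    rfl
  | cons v vs ih =>
    have h1 := maps_controlled_list (tgt v) (q v)
      (fun c hc => ⟨(h v (by simp) v (by simp) c hc).1, (h v (by simp) v (by simp) c hc).2,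
        hd v (by simp) c hc⟩) x
    rw [togglesOf, List.flatMap_cons]
    refine h1.append (ih (List.nodup_cons.1 hvs).2 ?_ ?_ ?_ ?_ ?_)
    · exact fun v1 hv1 v2 hv2 => ht v1 (by simp [hv1]) v2 (by simp [hv2])
    · exact fun v1 hv1 v2 hv2 => h v1 (by simp [hv1]) v2 (by simp [hv2])
    · exact fun v1 hv1 => hd v1 (by simp [hv1])
    · intro v1 hv1
      have h2 : tgt v1 ≠ tgt v := by
        intro he
        have := ht v1 (by simp [hv1]) v (by simp) he
        subst this
        exact (List.nodup_cons.1 hvs).1 hv1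
      rw [Function.update_of_ne h2, hy v1 (by simp [hv1])]
      congr 2
      refine List.map_congr_left fun c hc => ?_
      obtain ⟨h6, h7⟩ := h v (by simp) v1 (by simp [hv1]) c hc
      refine holdsBit_congr (fun c hc => ?_) (fun c hc => ?_)
      · rw [Function.update_of_ne]
        rintro rfl
        exact h6 hc
      · rw [Function.update_of_ne]
        rintro rfl
        exact h7 hc
    · intro u hu
      by_cases huv : u = tgt v
      · subst huv
        rw [Function.update_self, hy v (by simp)]
      · rw [Function.update_of_ne huv]
        refine hy' u fun v1 hv1 => ?_
        rcases List.mem_cons.1 hv1 with rfl | hv1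
        · exact huv
        · exact hu v1 hv1

omit [DecidableEq W] in
lemma length_flatMap_le {V A : Type} (vs : List V) (f : V → List A) {B : ℕ}
    (h : ∀ v ∈ vs, (f v).length ≤ B) : (vs.flatMap f).length ≤ vs.length * B := by
  rw [List.length_flatMap]
  refine (List.sum_le_card_nsmul _ B ?_).trans (by simp)
  intro m hm
  obtain ⟨v, hv, rfl⟩ := List.mem_map.1 hm
  exact h v hv

lemma length_togglesOf_le {V : Type} (vs : List V) (tgt : V → W)
    (q : V → List (Finset W × Finset W)) {B : ℕ} (h : ∀ v ∈ vs, (q v).length ≤ B) :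
    (togglesOf vs tgt q).length ≤ vs.length * B :=
  length_flatMap_le vs _ fun v hv => by simpa using h v hv

end

/-! ### Counting -/

section
variable {W : Type} [DecidableEq W]

/-- The number of ones among the first `i` bits. -/
def ones (bit : ℕ → W) (x : W → ZMod 2) (i : ℕ) : ℕ :=
  ((Finset.range i).filter fun i' => x (bit i') = 1).card

omit [DecidableEq W] in
lemma ones_succ (bit : ℕ → W) (x : W → ZMod 2) (i : ℕ) :
    ones bit x (i + 1) = ones bit x i + if x (bit i) = 1 then 1 else 0 := by
  rw [ones, Finset.range_add_one, Finset.filter_insert]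
  split_ifs with h
  · rw [Finset.card_insert_of_notMem (by simp), ones]
  · rw [ones, add_zero]

/-- Fills the rows up to number `i` of the grid: row `i'` contains a single one, in the column whose
number is the number of ones among the first `i'` bits. -/
def fillGrid (bit : ℕ → W) (grid : ℕ → ℕ → W) (B i : ℕ) (x : W → ZMod 2) : W → ZMod 2 := fun u =>
  open Classical in
  if ∃ i' c, i' ≤ B ∧ c ≤ B ∧ u = grid i' c then
    if ∃ i' c, i' ≤ B ∧ c ≤ B ∧ u = grid i' c ∧ i' ≤ i ∧ c = ones bit x i' then 1 else 0
  else x u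

/-- The circuit that computes row `i + 1` of the grid from row `i`. -/
def countStep (bit : ℕ → W) (grid : ℕ → ℕ → W) (B i : ℕ) : Circuit W :=
  togglesOf (List.range (B + 1)) (grid (i + 1)) fun c =>
    -- Column zero has no left neighbour; truncated subtraction would wrongly make it its own.
    ({grid i c}, {bit i}) :: if c = 0 then [] else [({grid i (c - 1), bit i}, ∅)]

/-- The circuit that computes the first `m + 1` rows of the grid. -/
def countCircuit (bit : ℕ → W) (grid : ℕ → ℕ → W) (B m : ℕ) : Circuit W :=
  -- The condition `(∅, ∅)` always holds: before any bit is read, the count is zero.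
  togglesOf [()] (fun _ => grid 0 0) (fun _ => [(∅, ∅)]) ++
    (List.range m).flatMap (countStep bit grid B)

/-- The wires of the grid are distinct, and different from the bits. -/
structure IsGrid (bit : ℕ → W) (grid : ℕ → ℕ → W) (B : ℕ) : Prop where
  inj : ∀ i ≤ B, ∀ c ≤ B, ∀ i' ≤ B, ∀ c' ≤ B, grid i c = grid i' c' → i = i' ∧ c = c'
  ne : ∀ j < B, ∀ i ≤ B, ∀ c ≤ B, bit j ≠ grid i c

namespace IsGrid

variable {bit : ℕ → W} {grid : ℕ → ℕ → W} {B : ℕ} (G : IsGrid bit grid B)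
include G

omit [DecidableEq W] in
lemma fillGrid_grid {i c : ℕ} (hi : i ≤ B) (hc : c ≤ B) (m : ℕ) (x : W → ZMod 2) :
    fillGrid bit grid B m x (grid i c) = if i ≤ m ∧ c = ones bit x i then 1 else 0 := by
  classical
  rw [fillGrid, if_pos ⟨i, c, hi, hc, rfl⟩]
  refine if_congr ⟨?_, fun h => ⟨i, c, hi, hc, rfl, h⟩⟩ rfl rfl
  rintro ⟨i', c', hi', hc', he, h⟩
  obtain ⟨rfl, rfl⟩ := G.inj _ hi _ hc _ hi' _ hc' he
  exact h

omit [DecidableEq W] G in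
lemma fillGrid_of_ne {u : W} (hu : ∀ i ≤ B, ∀ c ≤ B, u ≠ grid i c) (m : ℕ) (x : W → ZMod 2) :
    fillGrid bit grid B m x u = x u := by
  rw [fillGrid, if_neg]
  rintro ⟨i, c, hi, hc, rfl⟩
  exact hu i hi c hc rfl

omit [DecidableEq W] in
lemma fillGrid_bit {j : ℕ} (hj : j < B) (m : ℕ) (x : W → ZMod 2) :
    fillGrid bit grid B m x (bit j) = x (bit j) :=
  fillGrid_of_ne (G.ne j hj) m x

/-- The count becomes `c` if it was `c` and the bit is zero, or if it was `c - 1` and the bit is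
one. These cases exclude each other, so the sum modulo two is their disjunction. -/
lemma maps_countStep {i : ℕ} (hi : i + 1 ≤ B) (x : W → ZMod 2) :
    (countStep bit grid B i).Maps (fillGrid bit grid B i x) (fillGrid bit grid B (i + 1) x) := by
  classical
  have hB : ∀ c ∈ List.range (B + 1), c ≤ B := fun c hc => by
    have := List.mem_range.1 hc
    omega
  refine maps_togglesOf _ List.nodup_range _ ?_ _ ?_ ?_ ?_ ?_
  · intro c hc c' hc' h
    exact (G.inj _ hi _ (hB c hc) _ hi _ (hB c' hc') h).2
  · intro c hc c' hc' q hq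
    have h1 : ∀ d ≤ B, grid (i + 1) c ≠ grid i d := fun d hd h => by
      have := (G.inj _ hi _ (hB c hc) _ (by omega) _ hd h).1
      omega
    have h2 : grid (i + 1) c ≠ bit i := (G.ne i (by omega) _ hi _ (hB c hc)).symm
    have h3 := hB c' hc'
    rcases List.mem_cons.1 hq with rfl | hq
    · simp [h1 c' h3, h2]
    · split_ifs at hq with h0
      · simp at hq
      · rw [List.mem_singleton] at hq
        subst hq
        simp [h1 (c' - 1) (by omega), h2]
  · intro c hc q hq
    rcases List.mem_cons.1 hq with rfl | hq
    · simp [(G.ne i (by omega) i (by omega) c (hB c hc)).symm]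
    · split_ifs at hq with h0
      · simp at hq
      · rw [List.mem_singleton] at hq
        subst hq
        simp
  · intro c hc
    have hc' := hB c hc
    rw [G.fillGrid_grid hi hc', G.fillGrid_grid hi hc',
      if_neg (c := i + 1 ≤ i ∧ _) (by omega), zero_add, List.map_cons, List.sum_cons, ones_succ]
    have h1 : holdsBit ({grid i c}, {bit i}) (fillGrid bit grid B i x) =
        if c = ones bit x i ∧ x (bit i) = 0 then 1 else 0 := by
      rw [holdsBit]
      refine if_congr ?_ rfl rfl
      simp [Holds, G.fillGrid_bit (show i < B by omega), G.fillGrid_grid (show i ≤ B by omega) hc']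
    rw [h1]
    by_cases h0 : c = 0
    · subst h0
      rcases zmod_two_cases (x (bit i)) with hb | hb <;> simp [hb]
    · have h2 : holdsBit ({grid i (c - 1), bit i}, ∅) (fillGrid bit grid B i x) =
          if c - 1 = ones bit x i ∧ x (bit i) = 1 then 1 else 0 := by
        rw [holdsBit]
        refine if_congr ?_ rfl rfl
        simp [Holds, G.fillGrid_bit (show i < B by omega),
          G.fillGrid_grid (show i ≤ B by omega) (show c - 1 ≤ B by omega)]
      have h3 : c - 1 = ones bit x i ↔ c = ones bit x i + 1 := by omega
      rcases zmod_two_cases (x (bit i)) with hb | hb <;> simp [hb, h0, h2, h3]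
  · intro u hu
    by_cases h : ∃ i' c, i' ≤ B ∧ c ≤ B ∧ u = grid i' c
    · obtain ⟨i', c, hi', hc, rfl⟩ := h
      have : i' ≠ i + 1 := by
        rintro rfl
        exact hu c (List.mem_range.2 (by omega)) rfl
      rw [G.fillGrid_grid hi' hc, G.fillGrid_grid hi' hc]
      refine if_congr (and_congr_left fun _ => by omega) rfl rfl
    · have h' : ∀ i ≤ B, ∀ c ≤ B, u ≠ grid i c := fun i hi c hc he => h ⟨i, c, hi, hc, he⟩
      rw [fillGrid_of_ne h', fillGrid_of_ne h']

lemma maps_countInit {x : W → ZMod 2} (hx : ∀ i ≤ B, ∀ c ≤ B, x (grid i c) = 0) :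
    (togglesOf [()] (fun _ => grid 0 0) (fun _ => [(∅, ∅)])).Maps x (fillGrid bit grid B 0 x) := by
  refine maps_togglesOf _ (by simp) _ (by simp) _ (by simp) (by simp) ?_ ?_
  · intro _ _
    rw [G.fillGrid_grid (Nat.zero_le _) (Nat.zero_le _), hx _ (Nat.zero_le _) _ (Nat.zero_le _)]
    simp [ones, holdsBit, Holds]
  · intro u hu
    by_cases h : ∃ i' c, i' ≤ B ∧ c ≤ B ∧ u = grid i' c
    · obtain ⟨i', c, hi', hc, rfl⟩ := h
      rw [G.fillGrid_grid hi' hc, hx _ hi' _ hc, if_neg]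
      rintro ⟨h1, h2⟩
      obtain rfl : i' = 0 := by omega
      simp only [ones, Finset.range_zero, Finset.filter_empty, Finset.card_empty] at h2
      subst h2
      exact hu () (by simp) rfl
    · exact fillGrid_of_ne (fun i hi c hc he => h ⟨i, c, hi, hc, he⟩) _ _

lemma maps_countCircuit {m : ℕ} (hm : m ≤ B) {x : W → ZMod 2}
    (hx : ∀ i ≤ B, ∀ c ≤ B, x (grid i c) = 0) :
    (countCircuit bit grid B m).Maps x (fillGrid bit grid B m x) := by
  refine (G.maps_countInit hx).append ?_
  induction m with
  | zero => rfl
  | succ m ih =>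
    rw [List.range_succ, List.flatMap_append]
    refine (ih (by omega)).append ?_
    simpa using G.maps_countStep hm x

end IsGrid

lemma length_countStep_le (bit : ℕ → W) (grid : ℕ → ℕ → W) (B i : ℕ) :
    (countStep bit grid B i).length ≤ (B + 1) * 2 := by
  refine (length_togglesOf_le _ _ _ (B := 2) ?_).trans (by simp)
  intro c _
  split_ifs <;> simp

lemma length_countCircuit_le (bit : ℕ → W) (grid : ℕ → ℕ → W) (B m : ℕ) :
    (countCircuit bit grid B m).length ≤ 1 + m * ((B + 1) * 2) := by
  rw [countCircuit, List.length_append]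
  refine Nat.add_le_add ?_ ?_
  · simp [togglesOf]
  · refine (length_flatMap_le _ _ fun i _ => length_countStep_le bit grid B i).trans (by simp)

end

/-! ### The uniform superposition of the bit strings of a given weight -/

/-- The probability that bit number `i` is one if `c` of the previous bits are ones, for a random
string of `N` bits with `r` ones. -/
def bitProb (N r i c : ℕ) : Set.Icc (0 : ℝ) 1 :=
  -- For `i < N` the projection changes the quotient only if `c > r` or `r - c > N - i`, and then
  -- `bitAmplitude` vanishes.
  Set.projIcc 0 1 zero_le_one (((r : ℝ) - c) / ((N : ℝ) - i))

/-- The amplitude of a string of `i` bits with `c` ones. -/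
def bitAmplitude (N r i c : ℕ) : ℝ :=
  if c ≤ r then Real.sqrt (((N - i).choose (r - c) : ℝ) / N.choose r) else 0

lemma bitAmplitude_zero_zero {N r : ℕ} (h : r ≤ N) : bitAmplitude N r 0 0 = 1 := by
  have : (N.choose r : ℝ) ≠ 0 := by exact_mod_cast (Nat.choose_pos h).ne'
  simp [bitAmplitude, div_self this]

lemma bitAmplitude_last (N r c : ℕ) :
    bitAmplitude N r N c = if c = r then (Real.sqrt (N.choose r))⁻¹ else 0 := by
  rw [bitAmplitude]
  by_cases hc : c = r
  · simp [hc]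
  · by_cases hcr : c ≤ r
    · have : Nat.choose (N - N) (r - c) = 0 := Nat.choose_eq_zero_of_lt (by omega)
      rw [if_pos hcr, this]
      simp [hc]
    · simp [hc, hcr]

/-- With `M = N - i` and `d = r - c` these are the identities `C(M-1,d) = C(M,d) (M-d)/M` and
`C(M-1,d-1) = C(M,d) d/M` under square roots: a string with `d` ones left among `M` bits continues
with a zero or with a one. -/
lemma bitAmplitude_mul_sqrt {N r i c : ℕ} (hi : i < N) :
    bitAmplitude N r i c * Real.sqrt (1 - bitProb N r i c) = bitAmplitude N r (i + 1) c ∧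
      bitAmplitude N r i c * Real.sqrt (bitProb N r i c) = bitAmplitude N r (i + 1) (c + 1) := by
  obtain ⟨m, hm⟩ : ∃ m, N - i = m + 1 := ⟨N - i - 1, by omega⟩
  have hm' : N - (i + 1) = m := by omega
  have hNi : (N : ℝ) - i = m + 1 := by
    have : ((N - i : ℕ) : ℝ) = (m + 1 : ℕ) := by rw [hm]
    rw [Nat.cast_sub hi.le] at this
    push_cast at this
    exact this
  by_cases hcr : c ≤ r
  · obtain ⟨d, rfl⟩ := Nat.exists_eq_add_of_le hcr
    have hd : c + d - c = d := by omega
    have hrc : ((c + d : ℕ) : ℝ) - c = d := by push_cast; ring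
    simp only [bitAmplitude, hm, hm', hd, if_pos hcr]
    by_cases hdm : d ≤ m + 1
    · have hp : ((bitProb N (c + d) i c : Set.Icc (0 : ℝ) 1) : ℝ) = (d : ℝ) / (m + 1) := by
        rw [bitProb, Set.coe_projIcc, hrc, hNi, min_eq_right, max_eq_right]
        · positivity
        · rw [div_le_one (by positivity)]
          exact_mod_cast hdm
      have hm0 : (0 : ℝ) < m + 1 := by positivity
      rw [hp]
      constructor
      · rw [← Real.sqrt_mul (by positivity)]
        congr 1
        have h1 : ((m + 1).choose d : ℝ) * ((m : ℝ) + 1 - d) = m.choose d * (m + 1) := by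
          have h2 := Nat.choose_mul_succ_eq m d
          have h3 : ((m + 1 - d : ℕ) : ℝ) = (m : ℝ) + 1 - d := by
            rw [Nat.cast_sub hdm]
            push_cast
            ring
          rw [← h3]
          exact_mod_cast h2.symm
        rw [div_mul_eq_mul_div]
        congr 1
        field_simp
        linear_combination h1
      · rw [← Real.sqrt_mul (by positivity)]
        rcases d with _ | d
        · simp
        · rw [if_pos (by omega)]
          congr 1
          have hd' : c + (d + 1) - (c + 1) = d := by omega
          rw [hd']
          have h1 : ((m : ℝ) + 1) * (m.choose d) = (m + 1).choose (d + 1) * (d + 1) := by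
            exact_mod_cast Nat.add_one_mul_choose_eq m d
          rw [div_mul_eq_mul_div]
          congr 1
          field_simp
          push_cast
          linear_combination -h1
    · have h1 : (m + 1).choose d = 0 := Nat.choose_eq_zero_of_lt (by omega)
      have h2 : m.choose d = 0 := Nat.choose_eq_zero_of_lt (by omega)
      have h3 : m.choose (c + d - (c + 1)) = 0 := Nat.choose_eq_zero_of_lt (by omega)
      simp [h1, h2, h3]
  · simp [bitAmplitude, hcr, show ¬ (c + 1 ≤ r) by omega]

section
variable {W : Type} [DecidableEq W]

/-- The rotations of bit number `i`. -/
def rotations (bit : ℕ → W) (grid : ℕ → ℕ → W) (N r i : ℕ) : Circuit W :=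
  (List.range (N + 1)).map fun c => controlled (rotOp (bitProb N r i c)) (bit i) {grid i c} ∅

/-- The circuit that creates the uniform superposition of the strings of `N` bits with `r` ones. -/
def prepCircuit (bit : ℕ → W) (grid : ℕ → ℕ → W) (N r : ℕ) : Circuit W :=
  togglesOf [()] (fun _ => grid 0 0) (fun _ => [(∅, ∅)]) ++
    (List.range N).flatMap (fun i => rotations bit grid N r i ++ countStep bit grid N i) ++
    (countCircuit bit grid N N).adj

lemma run_inactive (C : Circuit W) (z : W → ZMod 2) (h : ∀ g ∈ C, ¬ g.Active z) :
    C.run (ket z) = ket z := by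
  induction C with
  | nil => rfl
  | cons g C ih =>
    rw [Circuit.run_cons, Gate.apply_ket_of_not_active _ _ (h g (by simp))]
    exact ih fun g' hg' => h g' (by simp [hg'])

/-- Row `i` of the grid has its single one in column `c`, so exactly one of the rotations acts. It
changes only bit `i`, which lies outside the grid, so the remaining rotations stay idle in both
branches. -/
lemma run_rotations {bit : ℕ → W} {grid : ℕ → ℕ → W} {N : ℕ} (G : IsGrid bit grid N) {r i c : ℕ}
    (hi : i < N) (hc : c ≤ N) {z : W → ZMod 2}
    (hz : ∀ c' ≤ N, z (grid i c') = if c' = c then 1 else 0) (hb : z (bit i) = 0) :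
    (rotations bit grid N r i).run (ket z) =
      ((Real.sqrt (1 - bitProb N r i c) : ℝ) : ℂ) • ket z +
        ((Real.sqrt (bitProb N r i c) : ℝ) : ℂ) • ket (Function.update z (bit i) 1) := by
  have hact : ∀ c' ≤ N, ∀ z' : W → ZMod 2,
      (controlled (rotOp (bitProb N r i c')) (bit i) {grid i c'} ∅).Active z' ↔
        z' (grid i c') = 1 := by
    intro c' hc' z'
    rw [controlled_active (by simpa using G.ne i hi i hi.le c' hc') (by simp) (by simp)]
    simp
  obtain ⟨l1, l2, hl⟩ := List.append_of_mem (List.mem_range.2 (show c < N + 1 by omega))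
  have hnd : (List.range (N + 1)).Nodup := List.nodup_range
  rw [hl] at hnd
  have hin : ∀ l : List ℕ, (∀ c' ∈ l, c' ∈ List.range (N + 1) ∧ c' ≠ c) → ∀ z' : W → ZMod 2,
      (∀ c' ≤ N, z' (grid i c') = z (grid i c')) →
      Circuit.run (l.map fun c => controlled (rotOp (bitProb N r i c)) (bit i) {grid i c} ∅)
        (ket z') = ket z' := by
    intro l h z' hz'
    refine run_inactive _ _ fun g hg => ?_
    obtain ⟨c', hc', rfl⟩ := List.mem_map.1 hg
    obtain ⟨h1, h2⟩ := h c' hc'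
    have h3 : c' ≤ N := by
      have := List.mem_range.1 h1
      omega
    rw [hact c' h3, hz' c' h3, hz c' h3, if_neg h2]
    simp
  have hl1 : ∀ c' ∈ l1, c' ∈ List.range (N + 1) ∧ c' ≠ c := by
    intro c' hc'
    refine ⟨by rw [hl]; simp [hc'], ?_⟩
    rintro rfl
    exact (List.nodup_append.1 hnd).2.2 c' hc' c' (by simp) rfl
  have hl2 : ∀ c' ∈ l2, c' ∈ List.range (N + 1) ∧ c' ≠ c := by
    intro c' hc'
    refine ⟨by rw [hl]; simp [hc'], ?_⟩
    rintro rfl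
    exact (List.nodup_cons.1 (List.nodup_append.1 hnd).2.1).1 hc'
  rw [rotations, hl, List.map_append, List.map_cons, Circuit.run_append, hin l1 hl1 z (by simp),
    Circuit.run_cons, Gate.apply_ket _ _ ((hact c hc z).2 (by simp [hz c hc])), sum_zmod_two,
    Circuit.run_add, Circuit.run_smul, Circuit.run_smul]
  have ht : (controlled (rotOp (bitProb N r i c)) (bit i) {grid i c} ∅).target = bit i := rfl
  have hu : Function.update z (bit i) 0 = z := by
    rw [← hb, Function.update_eq_self]
  rw [ht, hu, hin l2 hl2 z (by simp), hin l2 hl2]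
  · simp [controlled, rotOp, hb]
  · intro c' hc'
    rw [Function.update_of_ne (G.ne i hi i hi.le c' hc').symm]

/-- The bits in the set `A` are set to one. -/
def setBits (bit : ℕ → W) (x : W → ZMod 2) (A : Finset ℕ) : W → ZMod 2 := fun u =>
  open Classical in if ∃ i ∈ A, u = bit i then 1 else x u

variable {bit : ℕ → W} {grid : ℕ → ℕ → W} {N : ℕ}

lemma setBits_empty (x : W → ZMod 2) : setBits bit x ∅ = x := by
  ext u
  simp [setBits]

lemma setBits_bit (hbit : ∀ i < N, ∀ j < N, bit i = bit j → i = j) {x : W → ZMod 2}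
    (hx : ∀ i < N, x (bit i) = 0) {A : Finset ℕ} (hA : ∀ i ∈ A, i < N) {i : ℕ} (hi : i < N) :
    setBits bit x A (bit i) = if i ∈ A then 1 else 0 := by
  rw [setBits, hx i hi]
  refine if_congr ⟨?_, fun h => ⟨i, h, rfl⟩⟩ rfl rfl
  rintro ⟨j, hj, h⟩
  rwa [hbit i hi j (hA j hj) h]

lemma ones_setBits (hbit : ∀ i < N, ∀ j < N, bit i = bit j → i = j) {x : W → ZMod 2}
    (hx : ∀ i < N, x (bit i) = 0) {A : Finset ℕ} (hA : ∀ i ∈ A, i < N) {i : ℕ} (hi : i ≤ N) :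
    ones bit (setBits bit x A) i = (A.filter (· < i)).card := by
  rw [ones]
  congr 1
  ext j
  simp only [Finset.mem_filter, Finset.mem_range]
  constructor
  · rintro ⟨h1, h2⟩
    rw [setBits_bit hbit hx hA (by omega)] at h2
    exact ⟨by_contra fun h => by simp [h] at h2, h1⟩
  · rintro ⟨h1, h2⟩
    refine ⟨h2, ?_⟩
    rw [setBits_bit hbit hx hA (by omega), if_pos h1]

/-- The rows up to `i` count only the bits before bit `i`, so setting this bit does not alter them.
-/
lemma fillGrid_setBits_insert (G : IsGrid bit grid N)
    (hbit : ∀ i < N, ∀ j < N, bit i = bit j → i = j) {x : W → ZMod 2}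
    (hx : ∀ i < N, x (bit i) = 0) {i : ℕ} (hi : i < N) {A : Finset ℕ} (hA : A ⊆ Finset.range i) :
    Function.update (fillGrid bit grid N i (setBits bit x A)) (bit i) 1 =
      fillGrid bit grid N i (setBits bit x (insert i A)) := by
  have hA1 : ∀ j ∈ A, j < N := fun j hj => by
    have := Finset.mem_range.1 (hA hj)
    omega
  have hA2 : ∀ j ∈ insert i A, j < N := fun j hj => by
    rcases Finset.mem_insert.1 hj with rfl | hj
    · exact hi
    · exact hA1 j hj
  ext u
  by_cases hu : u = bit i
  · subst hu
    rw [Function.update_self, G.fillGrid_bit hi, setBits_bit hbit hx hA2 hi,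
      if_pos (Finset.mem_insert_self i A)]
  · rw [Function.update_of_ne hu]
    by_cases h : ∃ i' c, i' ≤ N ∧ c ≤ N ∧ u = grid i' c
    · obtain ⟨i', c, hi', hc, rfl⟩ := h
      rw [G.fillGrid_grid hi' hc, G.fillGrid_grid hi' hc, ones_setBits hbit hx hA1 hi',
        ones_setBits hbit hx hA2 hi', Finset.filter_insert]
      refine if_congr (and_congr_right fun h => ?_) rfl rfl
      rw [if_neg (by omega)]
    · have h' : ∀ i ≤ N, ∀ c ≤ N, u ≠ grid i c := fun i hi c hc he => h ⟨i, c, hi, hc, he⟩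
      rw [IsGrid.fillGrid_of_ne h', IsGrid.fillGrid_of_ne h', setBits, setBits]
      refine if_congr ?_ rfl rfl
      simp [hu]

/-- The amplitude of a partial string depends only on its length and its number of ones. The
rotation of bit `m` splits the term of `A` into those of `A` and `insert m A`, which is the
decomposition of the powerset of `range (m + 1)`. -/
lemma run_prep_steps (G : IsGrid bit grid N)
    (hbit : ∀ i < N, ∀ j < N, bit i = bit j → i = j) {x : W → ZMod 2}
    (hx : ∀ i < N, x (bit i) = 0) (hg : ∀ i ≤ N, ∀ c ≤ N, x (grid i c) = 0) {r : ℕ} (hr : r ≤ N)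
    {m : ℕ} (hm : m ≤ N) :
    Circuit.run (togglesOf [()] (fun _ => grid 0 0) (fun _ => [(∅, ∅)]) ++
      (List.range m).flatMap (fun i => rotations bit grid N r i ++ countStep bit grid N i)) (ket x) =
      ∑ A ∈ (Finset.range m).powerset, ((bitAmplitude N r m A.card : ℝ) : ℂ) •
        ket (fillGrid bit grid N m (setBits bit x A)) := by
  induction m with
  | zero =>
    have h := G.maps_countInit hg
    rw [Circuit.Maps] at h
    simp [h, setBits_empty, bitAmplitude_zero_zero hr]
  | succ m ih =>
    rw [List.range_succ, List.flatMap_append, ← List.append_assoc, Circuit.run_append,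
      ih (by omega), Circuit.run_sum, Finset.range_add_one, Finset.sum_powerset_insert (by simp),
      ← Finset.sum_add_distrib]
    refine Finset.sum_congr rfl fun A hA => ?_
    rw [Finset.mem_powerset] at hA
    have hA1 : ∀ j ∈ A, j < m := fun j hj => Finset.mem_range.1 (hA hj)
    have hA2 : ∀ j ∈ A, j < N := fun j hj => (hA1 j hj).trans hm
    have hcard : A.card ≤ m := by simpa using Finset.card_le_card hA
    have hfil : A.filter (· < m) = A := Finset.filter_true_of_mem hA1
    have hmA : m ∉ A := fun h => lt_irrefl _ (hA1 m h)
    obtain ⟨e1, e2⟩ := bitAmplitude_mul_sqrt (N := N) (r := r) (c := A.card) hm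
    simp only [List.flatMap_cons, List.flatMap_nil, List.append_nil]
    rw [Circuit.run_smul, Circuit.run_append, run_rotations G (c := A.card) (by omega) (by omega),
      fillGrid_setBits_insert G hbit hx hm hA, Circuit.run_add, Circuit.run_smul, Circuit.run_smul,
      G.maps_countStep hm, G.maps_countStep hm, smul_add, smul_smul, smul_smul,
      Finset.card_insert_of_notMem hmA, ← e1, ← e2]
    · push_cast
      rfl
    · intro c' hc'
      rw [G.fillGrid_grid (by omega) hc', ones_setBits hbit hx hA2 (by omega), hfil]
      simp
    · rw [G.fillGrid_bit hm, setBits_bit hbit hx hA2 hm, if_neg hmA]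

/-- At full length only the strings with `r` ones have nonzero amplitude, and these amplitudes
agree. In every branch the grid is what a plain count of the final bits produces, so one reversed
counting circuit clears it in all branches. -/
lemma run_prepCircuit (G : IsGrid bit grid N)
    (hbit : ∀ i < N, ∀ j < N, bit i = bit j → i = j) {x : W → ZMod 2}
    (hx : ∀ i < N, x (bit i) = 0) (hg : ∀ i ≤ N, ∀ c ≤ N, x (grid i c) = 0) {r : ℕ} (hr : r ≤ N) :
    (prepCircuit bit grid N r).run (ket x) = (((Real.sqrt (N.choose r))⁻¹ : ℝ) : ℂ) •
      ∑ A ∈ (Finset.range N).powersetCard r, ket (setBits bit x A) := by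
  rw [prepCircuit, Circuit.run_append, run_prep_steps G hbit hx hg hr le_rfl, Circuit.run_sum,
    Finset.smul_sum, Finset.powersetCard_eq_filter, Finset.sum_filter]
  refine Finset.sum_congr rfl fun A hA => ?_
  have hg' : ∀ i ≤ N, ∀ c ≤ N, setBits bit x A (grid i c) = 0 := by
    intro i hi c hc
    rw [setBits, hg i hi c hc, if_neg]
    rintro ⟨j, hj, h⟩
    exact G.ne j (Finset.mem_range.1 (Finset.mem_powerset.1 hA hj)) i hi c hc h.symm
  have h := (G.maps_countCircuit le_rfl hg').adj
  rw [Circuit.run_smul, h, bitAmplitude_last]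
  split_ifs <;> simp

lemma length_prepCircuit_le (bit : ℕ → W) (grid : ℕ → ℕ → W) (N r : ℕ) :
    (prepCircuit bit grid N r).length ≤ 2 + N * ((N + 1) * 5) := by
  have h1 : ((List.range N).flatMap
      (fun i => rotations bit grid N r i ++ countStep bit grid N i)).length ≤ N * ((N + 1) * 3) := by
    refine (length_flatMap_le _ _ (B := (N + 1) * 3) fun i _ => ?_).trans (by simp)
    have := length_countStep_le bit grid N i
    rw [List.length_append, rotations, List.length_map, List.length_range]
    omega
  have h2 : (countCircuit bit grid N N).adj.length ≤ 1 + N * ((N + 1) * 2) := by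
    simpa [Circuit.adj] using length_countCircuit_le bit grid N N
  rw [prepCircuit, List.length_append, List.length_append]
  have h3 : (togglesOf [()] (fun _ => grid 0 0) (fun _ => [(∅, ∅)])).length = 1 := by
    simp [togglesOf]
  rw [h3]
  nlinarith

end

/-! ### Gaussian elimination on a set of columns -/

section
variable {r : ℕ} {C : Type}

/-- The entries of an augmented matrix (with the right-hand side in the column `none`) and a flag for
every row that has been used as a pivot row. -/
abbrev ElimIndex (r : ℕ) (C : Type) := (Fin r × Option C) ⊕ Fin r

/-- The entry in row `p` and column `c` is taken as a pivot. -/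
def IsPivot (b : C → ZMod 2) (cp : C × Fin r) (σ : ElimIndex r C → ZMod 2) : Prop :=
  b cp.1 = 1 ∧ σ (Sum.inl (cp.2, some cp.1)) = 1 ∧ σ (Sum.inr cp.2) = 0

/-- One step of the elimination: if the entry `cp` is a pivot, then the column is cleared with the
row, and the row is marked as used. -/
def elimStep (b : C → ZMod 2) (σ : ElimIndex r C → ZMod 2) (cp : C × Fin r) :
    ElimIndex r C → ZMod 2 := fun v =>
  open Classical in
  match v with
  | Sum.inl (i, j) => σ (Sum.inl (i, j)) +
      if i ≠ cp.2 ∧ IsPivot b cp σ ∧ σ (Sum.inl (i, some cp.1)) = 1 ∧ σ (Sum.inl (cp.2, j)) = 1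
        then 1 else 0
  | Sum.inr i => σ (Sum.inr i) + if i = cp.2 ∧ IsPivot b cp σ then 1 else 0

lemma elimStep_of_not_isPivot {b : C → ZMod 2} {σ : ElimIndex r C → ZMod 2} {cp : C × Fin r}
    (h : ¬ IsPivot b cp σ) : elimStep b σ cp = σ := by
  ext v
  rcases v with ⟨i, j⟩ | i <;> simp [elimStep, h]

/-- The factor with which the pivot row is added to row `i`. -/
def rowFactor (σ : ElimIndex r C → ZMod 2) (cp : C × Fin r) (i : Fin r) : ZMod 2 :=
  if i ≠ cp.2 then σ (Sum.inl (i, some cp.1)) else 0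

lemma elimStep_inl {b : C → ZMod 2} {σ : ElimIndex r C → ZMod 2} {cp : C × Fin r}
    (h : IsPivot b cp σ) (i : Fin r) (j : Option C) :
    elimStep b σ cp (Sum.inl (i, j)) =
      σ (Sum.inl (i, j)) + rowFactor σ cp i * σ (Sum.inl (cp.2, j)) := by
  by_cases hi : i = cp.2
  · simp [elimStep, rowFactor, hi]
  · rcases zmod_two_cases (σ (Sum.inl (i, some cp.1))) with h1 | h1 <;>
      rcases zmod_two_cases (σ (Sum.inl (cp.2, j))) with h2 | h2 <;>
      simp [elimStep, rowFactor, hi, h1, h2, h]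

lemma elimStep_inr {b : C → ZMod 2} {σ : ElimIndex r C → ZMod 2} {cp : C × Fin r}
    (h : IsPivot b cp σ) (i : Fin r) :
    elimStep b σ cp (Sum.inr i) = if i = cp.2 then 1 else σ (Sum.inr i) := by
  by_cases hi : i = cp.2
  · subst hi
    simp [elimStep, h, h.2.2]
  · simp [elimStep, hi]

/-- The column `c` is zero in all unused rows among the rows `S`. -/
def ColumnDone (σ : ElimIndex r C → ZMod 2) (c : C) (S : Set (Fin r)) : Prop :=
  ∀ p ∈ S, σ (Sum.inl (p, some c)) = 0 ∨ σ (Sum.inr p) = 1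

/-- A pivot lies in an unused row, and there a finished column is zero. Adding the pivot row
therefore does not change the column, and flags are never reset. -/
lemma ColumnDone.step {b : C → ZMod 2} {σ : ElimIndex r C → ZMod 2} {c : C}
    (h : ColumnDone σ c Set.univ) (cp : C × Fin r) :
    ColumnDone (elimStep b σ cp) c Set.univ := by
  by_cases hp : IsPivot b cp σ
  · intro p _
    rw [elimStep_inl hp, elimStep_inr hp]
    have h1 : σ (Sum.inl (cp.2, some c)) = 0 := by
      rcases h cp.2 trivial with h1 | h1
      · exact h1
      · rw [hp.2.2] at h1
        simp at h1
    rw [h1, mul_zero, add_zero]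
    rcases h p trivial with h2 | h2
    · exact Or.inl h2
    · right
      split_ifs
      · rfl
      · exact h2
  · rwa [elimStep_of_not_isPivot hp]

/-- If the entry is a pivot, row `p` becomes used, and a row of `S` with entry zero gets factor
zero. If it is not, then, the column being selected, the entry is zero or the row is already used.
-/
lemma ColumnDone.step_insert {b : C → ZMod 2} {σ : ElimIndex r C → ZMod 2} {c : C}
    {S : Set (Fin r)} (h : ColumnDone σ c S) (hb : b c = 1) (p : Fin r) :
    ColumnDone (elimStep b σ (c, p)) c (insert p S) := by
  by_cases hp : IsPivot b (c, p) σ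
  · intro i hi
    rw [elimStep_inl hp, elimStep_inr hp]
    by_cases hip : i = p
    · simp [hip]
    · rcases h i (hi.resolve_left hip) with h2 | h2
      · simp [rowFactor, h2]
      · simp [h2]
  · rw [elimStep_of_not_isPivot hp]
    rintro i (rfl | hi)
    · rcases zmod_two_cases (σ (Sum.inl (i, some c))) with h1 | h1
      · exact Or.inl h1
      · rcases zmod_two_cases (σ (Sum.inr i)) with h2 | h2
        · exact absurd ⟨hb, h1, h2⟩ hp
        · exact Or.inr h2
    · exact h i hi

/-- Every used row is the pivot row of a selected column. -/
def PivotsOk (b : C → ZMod 2) (σ : ElimIndex r C → ZMod 2) : Prop :=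
  ∀ p, σ (Sum.inr p) = 1 → ∃ c, b c = 1 ∧ ∀ i, σ (Sum.inl (i, some c)) = if i = p then 1 else 0

/-- The new pivot column is cleared outside its pivot row. The pivot column of another used row has
a zero in the new pivot row, so it is left unchanged. -/
lemma PivotsOk.step {b : C → ZMod 2} {σ : ElimIndex r C → ZMod 2} (h : PivotsOk b σ)
    (cp : C × Fin r) : PivotsOk b (elimStep b σ cp) := by
  by_cases hp : IsPivot b cp σ
  · intro p hup
    rw [elimStep_inr hp] at hup
    by_cases hpc : p = cp.2
    · refine ⟨cp.1, hp.1, fun i => ?_⟩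
      rw [elimStep_inl hp, hp.2.1, mul_one, rowFactor]
      by_cases hi : i = cp.2
      · simp [hi, hpc, hp.2.1]
      · rw [if_pos hi, if_neg (by rwa [hpc]), CharTwo.add_self_eq_zero]
    · rw [if_neg hpc] at hup
      obtain ⟨c, hc, h1⟩ := h p hup
      refine ⟨c, hc, fun i => ?_⟩
      rw [elimStep_inl hp, h1, h1 cp.2, if_neg (Ne.symm hpc), mul_zero, add_zero]
  · rwa [elimStep_of_not_isPivot hp]

variable [Fintype C]

/-- The vector `y` solves the linear system. -/
def IsElimSolution (σ : ElimIndex r C → ZMod 2) (y : C → ZMod 2) : Prop :=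
  ∀ i, ∑ c, σ (Sum.inl (i, some c)) * y c = σ (Sum.inl (i, none))

/-- Multiples of the pivot row are added to the other rows only. The equation of the pivot row
itself survives unchanged, so the others can be recovered. -/
lemma isElimSolution_step (b : C → ZMod 2) (σ : ElimIndex r C → ZMod 2) (cp : C × Fin r)
    (y : C → ZMod 2) : IsElimSolution (elimStep b σ cp) y ↔ IsElimSolution σ y := by
  by_cases hp : IsPivot b cp σ
  · have h1 : ∀ i, ∑ c, elimStep b σ cp (Sum.inl (i, some c)) * y c =
        ∑ c, σ (Sum.inl (i, some c)) * y c +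
          rowFactor σ cp i * ∑ c, σ (Sum.inl (cp.2, some c)) * y c := by
      intro i
      rw [Finset.mul_sum, ← Finset.sum_add_distrib]
      refine Finset.sum_congr rfl fun c _ => ?_
      rw [elimStep_inl hp]
      ring
    constructor
    · intro h
      have h2 := h cp.2
      have h3 : rowFactor σ cp cp.2 = 0 := by simp [rowFactor]
      rw [h1, elimStep_inl hp, h3, zero_mul, zero_mul, add_zero, add_zero] at h2
      intro i
      have h4 := h i
      rw [h1, elimStep_inl hp, h2] at h4
      exact add_right_cancel h4
    · intro h i
      rw [h1, elimStep_inl hp, h i, h cp.2]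
  · rw [elimStep_of_not_isPivot hp]

/-- The pairs of a column and a row, in the order in which they are processed. -/
def elimOrder (r : ℕ) (cs : List C) : List (C × Fin r) :=
  cs.flatMap fun c => (List.finRange r).map fun p => (c, p)

lemma elim_invariants (b : C → ZMod 2) (L : List (C × Fin r)) (σ : ElimIndex r C → ZMod 2)
    (h : PivotsOk b σ) :
    PivotsOk b (L.foldl (elimStep b) σ) ∧
      (∀ y, IsElimSolution (L.foldl (elimStep b) σ) y ↔ IsElimSolution σ y) ∧
      ∀ c, ColumnDone σ c Set.univ → ColumnDone (L.foldl (elimStep b) σ) c Set.univ := by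
  induction L generalizing σ with
  | nil => exact ⟨h, fun _ => Iff.rfl, fun _ h => h⟩
  | cons cp L ih =>
    obtain ⟨h1, h2, h3⟩ := ih (elimStep b σ cp) (h.step cp)
    exact ⟨h1, fun y => (h2 y).trans (isElimSolution_step b σ cp y), fun c hc => h3 c (hc.step cp)⟩

omit [Fintype C] in
lemma columnDone_foldl_rows (b : C → ZMod 2) {c : C} (hb : b c = 1) (ps : List (Fin r))
    (S : Set (Fin r)) (σ : ElimIndex r C → ZMod 2) (h : ColumnDone σ c S) :
    ColumnDone ((ps.map fun p => (c, p)).foldl (elimStep b) σ) c (S ∪ {p | p ∈ ps}) := by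
  induction ps generalizing S σ with
  | nil => simpa using h
  | cons p ps ih =>
    have h1 := ih (insert p S) (elimStep b σ (c, p)) (h.step_insert hb p)
    refine fun i hi => h1 i ?_
    rcases hi with hi | hi
    · exact Or.inl (Or.inr hi)
    · rcases List.mem_cons.1 hi with rfl | hi
      · exact Or.inl (Or.inl rfl)
      · exact Or.inr hi

/-- The block of pairs belonging to `c` finishes the column, and all later blocks preserve this. -/
lemma columnDone_elim (b : C → ZMod 2) (cs : List C) (σ : ElimIndex r C → ZMod 2)
    (h : PivotsOk b σ) {c : C} (hc : c ∈ cs) (hb : b c = 1) :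
    ColumnDone ((elimOrder r cs).foldl (elimStep b) σ) c Set.univ := by
  induction cs generalizing σ with
  | nil => simp at hc
  | cons c' cs ih =>
    rw [elimOrder, List.flatMap_cons, List.foldl_append]
    have h1 := elim_invariants b ((List.finRange r).map fun p => (c', p)) σ h
    rcases List.mem_cons.1 hc with rfl | hc
    · refine (elim_invariants b (elimOrder r cs) _ h1.1).2.2 c ?_
      have h2 := columnDone_foldl_rows b hb (List.finRange r) ∅ σ (by simp [ColumnDone])
      exact fun p _ => h2 p (Or.inr (by simp))
    · exact ih _ h1.1 hc

/-- The initial state of the elimination. -/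
def elimInit (A : Matrix (Fin r) C (ZMod 2)) (s : Fin r → ZMod 2) : ElimIndex r C → ZMod 2 :=
  Sum.elim (fun q => q.2.elim (s q.1) (A q.1)) 0

lemma isElimSolution_init (A : Matrix (Fin r) C (ZMod 2)) (s : Fin r → ZMod 2) (y : C → ZMod 2) :
    IsElimSolution (elimInit A s) y ↔ A.mulVec y = s := by
  simp [IsElimSolution, elimInit, funext_iff, Matrix.mulVec, dotProduct]

/-- The result of the elimination decides whether the system has a unique solution on the selected
columns, and the weight of the solution. -/
lemma solvesOn_iff_elim (A : Matrix (Fin r) C (ZMod 2)) (s : Fin r → ZMod 2) (I : Finset C)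
    (hI : I.card = r) (cs : List C) (hcs : ∀ c, c ∈ cs) {b : C → ZMod 2}
    (hb : ∀ c, b c = 1 ↔ c ∈ I) (w : ℕ) :
    (∃ y, SolvesOn A s I y ∧ hammingNorm y = w) ↔
      (∀ p, (elimOrder r cs).foldl (elimStep b) (elimInit A s) (Sum.inr p) = 1) ∧
        (Finset.univ.filter fun i : Fin r =>
          (elimOrder r cs).foldl (elimStep b) (elimInit A s) (Sum.inl (i, none)) = 1).card = w := by
  classical
  have h0 : PivotsOk b (elimInit A s) := by
    intro p hp
    simp [elimInit] at hp
  obtain ⟨hpiv, hsol, -⟩ := elim_invariants b (elimOrder r cs) (elimInit A s) h0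
  have hdone : ∀ c ∈ I, ColumnDone ((elimOrder r cs).foldl (elimStep b) (elimInit A s)) c Set.univ :=
    fun c hc => columnDone_elim b cs _ h0 (hcs c) ((hb c).2 hc)
  set σ := (elimOrder r cs).foldl (elimStep b) (elimInit A s) with hσ
  have hsol' : ∀ y, A.mulVec y = s ↔ IsElimSolution σ y := fun y =>
    (isElimSolution_init A s y).symm.trans (hsol y).symm
  -- If all rows are used, the pivot columns are `r` distinct elements of `I`, hence all of `I`, and
  -- restricted to them the matrix is a permutation matrix. The system then simply prescribes the
  -- entries of `y`.
  have key : (∀ p, σ (Sum.inr p) = 1) → ∃ c : Fin r → C, Function.Injective c ∧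
      (∀ a, a ∈ I ↔ ∃ p, c p = a) ∧
      ∀ y : C → ZMod 2, (∀ a ∉ I, y a = 0) →
        (A.mulVec y = s ↔ ∀ p, y (c p) = σ (Sum.inl (p, none))) := by
    intro hu
    choose c hc1 hc2 using fun p => hpiv p (hu p)
    have hinj : Function.Injective c := by
      intro p p' hpp
      have h1 := hc2 p p
      rw [hpp, hc2 p' p] at h1
      by_contra hne
      simp [hne] at h1
    have himg : Finset.univ.image c = I := by
      refine Finset.eq_of_subset_of_card_le ?_ ?_
      · intro a ha
        obtain ⟨p, _, rfl⟩ := Finset.mem_image.1 ha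
        exact (hb _).1 (hc1 p)
      · rw [Finset.card_image_of_injective _ hinj, hI]
        simp
    refine ⟨c, hinj, fun a => by rw [← himg]; simp, fun y hy => ?_⟩
    rw [hsol']
    refine forall_congr' fun i => ?_
    have h1 : ∑ a, σ (Sum.inl (i, some a)) * y a = y (c i) := by
      rw [← Finset.sum_subset (Finset.subset_univ (Finset.univ.image c)),
        Finset.sum_image (fun _ _ _ _ h => hinj h)]
      · simp [hc2]
      · intro a _ ha
        rw [hy a (by rwa [← himg]), mul_zero]
    rw [h1]
  constructor
  · rintro ⟨y, ⟨⟨hy1, hy2⟩, hy3⟩, hw⟩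
    have hu : ∀ p, σ (Sum.inr p) = 1 := by
      intro p
      by_contra hp
      -- An unused row is zero on all selected columns, which will contradict surjectivity.
      have hrow : ∀ a ∈ I, σ (Sum.inl (p, some a)) = 0 := fun a ha =>
        (hdone a ha p trivial).resolve_right hp
      let f : (I → ZMod 2) →ₗ[ZMod 2] (Fin r → ZMod 2) :=
        Matrix.mulVecLin (Matrix.of fun (i : Fin r) (a : I) => σ (Sum.inl (i, some a.1)))
      -- A kernel vector, extended by zero, could be added to `y` to give a second solution on `I`.
      have hfinj : Function.Injective f := by
        rw [← LinearMap.ker_eq_bot, LinearMap.ker_eq_bot']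
        intro z hz
        let z' : C → ZMod 2 := fun a => if h : a ∈ I then z ⟨a, h⟩ else 0
        have hz' : ∀ a ∉ I, z' a = 0 := fun a ha => by simp [z', ha]
        have h1 : ∀ i, ∑ a, σ (Sum.inl (i, some a)) * z' a = 0 := by
          intro i
          rw [← Finset.sum_subset (Finset.subset_univ I) (fun a _ ha => by rw [hz' a ha, mul_zero]),
            ← Finset.sum_coe_sort]
          have h2 := congrFun hz i
          simp only [f, Matrix.mulVecLin_apply, Matrix.mulVec, dotProduct, Matrix.of_apply,
            Pi.zero_apply] at h2
          rw [← h2]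
          exact Finset.sum_congr rfl fun a _ => by simp [z']
        have h3 := hy3 (y + z') (fun a ha => by simp [hy1 a ha, hz' a ha])
          ((hsol' _).2 fun i => by
            simp only [Pi.add_apply, mul_add, Finset.sum_add_distrib, h1 i, add_zero]
            exact (hsol' y).1 hy2 i)
        ext a
        have h4 := congrFun h3 a.1
        simpa [z'] using h4
      -- Here `I.card = r` enters: the restricted matrix is square.
      have hfsurj : Function.Surjective f := by
        refine (LinearMap.injective_iff_surjective_of_finrank_eq_finrank ?_).1 hfinj
        simp [hI]
      obtain ⟨z, hz⟩ := hfsurj (Pi.single p 1)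
      have h1 := congrFun hz p
      simp only [f, Matrix.mulVecLin_apply, Matrix.mulVec, dotProduct, Matrix.of_apply,
        Pi.single_eq_same] at h1
      rw [Finset.sum_eq_zero (fun a _ => by rw [hrow a.1 a.2, zero_mul])] at h1
      exact zero_ne_one h1
    refine ⟨hu, ?_⟩
    obtain ⟨c, hinj, hcI, hc⟩ := key hu
    have h1 := (hc y hy1).1 hy2
    rw [← hw, hammingNorm]
    refine Finset.card_bij (fun p _ => c p) ?_ (fun _ _ _ _ h => hinj h) ?_
    · intro p hp
      rw [Finset.mem_filter] at hp ⊢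
      refine ⟨Finset.mem_univ _, ?_⟩
      rw [h1 p, hp.2]
      exact one_ne_zero
    · intro a ha
      rw [Finset.mem_filter] at ha
      have haI : a ∈ I := by
        by_contra h
        exact ha.2 (hy1 a h)
      obtain ⟨p, rfl⟩ := (hcI a).1 haI
      refine ⟨p, ?_, rfl⟩
      rw [Finset.mem_filter]
      refine ⟨Finset.mem_univ _, ?_⟩
      rw [← h1 p]
      exact (zmod_two_cases _).resolve_left ha.2
  · rintro ⟨hu, hw⟩
    obtain ⟨c, hinj, hcI, hc⟩ := key hu
    let y : C → ZMod 2 := fun a => if h : ∃ p, c p = a then σ (Sum.inl (h.choose, none)) else 0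
    have hy0 : ∀ a ∉ I, y a = 0 := fun a ha => by
      have : ¬ ∃ p, c p = a := fun h => ha ((hcI a).2 h)
      simp only [y, this, dif_neg, not_false_iff]
    have hyc : ∀ p, y (c p) = σ (Sum.inl (p, none)) := by
      intro p
      have h : ∃ p', c p' = c p := ⟨p, rfl⟩
      simp only [y, dif_pos h]
      rw [hinj h.choose_spec]
    refine ⟨y, ⟨⟨hy0, (hc y hy0).2 hyc⟩, fun z hz hz' => ?_⟩, ?_⟩
    · ext a
      by_cases ha : a ∈ I
      · obtain ⟨p, rfl⟩ := (hcI a).1 ha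
        rw [hyc, (hc z hz).1 hz' p]
      · rw [hz a ha, hy0 a ha]
    · rw [← hw, hammingNorm]
      symm
      refine Finset.card_bij (fun p _ => c p) ?_ (fun _ _ _ _ h => hinj h) ?_
      · intro p hp
        rw [Finset.mem_filter] at hp ⊢
        refine ⟨Finset.mem_univ _, ?_⟩
        rw [hyc p, hp.2]
        exact one_ne_zero
      · intro a ha
        rw [Finset.mem_filter] at ha
        have haI : a ∈ I := by
          by_contra h
          exact ha.2 (hy0 a h)
        obtain ⟨p, rfl⟩ := (hcI a).1 haI
        refine ⟨p, ?_, rfl⟩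
        rw [Finset.mem_filter]
        refine ⟨Finset.mem_univ _, ?_⟩
        rw [← hyc p]
        exact (zmod_two_cases _).resolve_left ha.2

end

/-! ### The circuit for the elimination -/

section
variable {W : Type} [DecidableEq W] {r : ℕ} {C : Type}

/-- The conditions under which an entry of layer `t + 1` is negated. -/
def elimConditions (sel : C → W) (lay : ℕ → ElimIndex r C → W) (t : ℕ) (cp : C × Fin r) :
    ElimIndex r C → List (Finset W × Finset W)
  -- The first condition copies the entry from the previous layer; the second adds the pivot row.
  -- The pivot row itself is only copied.
  | Sum.inl (i, j) => ({lay t (Sum.inl (i, j))}, ∅) :: if i = cp.2 then [] else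
      [({sel cp.1, lay t (Sum.inl (cp.2, some cp.1)), lay t (Sum.inl (i, some cp.1)),
        lay t (Sum.inl (cp.2, j))}, {lay t (Sum.inr cp.2)})]
  | Sum.inr i => ({lay t (Sum.inr i)}, ∅) :: if i = cp.2 then
      [({sel cp.1, lay t (Sum.inl (cp.2, some cp.1))}, {lay t (Sum.inr cp.2)})] else []

/-- The wires of the layers are distinct, and different from the selection wires. -/
structure IsLayered (sel : C → W) (lay : ℕ → ElimIndex r C → W) (T : ℕ) : Prop where
  inj : ∀ t ≤ T, ∀ t' ≤ T, ∀ v v', lay t v = lay t' v' → t = t' ∧ v = v'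
  ne : ∀ c, ∀ t ≤ T, ∀ v, sel c ≠ lay t v

variable [Fintype C]

/-- The circuit that performs the elimination steps of a list, each of them from one layer to the
next. -/
def elimCircuit (sel : C → W) (lay : ℕ → ElimIndex r C → W) : ℕ → List (C × Fin r) → Circuit W
  | _, [] => []
  | t, cp :: L => togglesOf Finset.univ.toList (lay (t + 1)) (elimConditions sel lay t cp) ++
      elimCircuit sel lay (t + 1) L

lemma length_elimCircuit_le (sel : C → W) (lay : ℕ → ElimIndex r C → W) (t : ℕ)
    (L : List (C × Fin r)) :
    (elimCircuit sel lay t L).length ≤ L.length * (Fintype.card (ElimIndex r C) * 2) := by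
  induction L generalizing t with
  | nil => simp [elimCircuit]
  | cons cp L ih =>
    have h : (togglesOf Finset.univ.toList (lay (t + 1)) (elimConditions sel lay t cp)).length ≤
        Fintype.card (ElimIndex r C) * 2 := by
      refine (length_togglesOf_le _ _ _ (B := 2) ?_).trans (by simp)
      rintro (⟨i, j⟩ | i) _ <;> simp only [elimConditions] <;> split_ifs <;> simp
    have := ih (t + 1)
    rw [elimCircuit, List.length_append, List.length_cons]
    linarith

variable {sel : C → W} {lay : ℕ → ElimIndex r C → W} {T : ℕ}

/-- Writing the result into a fresh layer makes the step reversible whatever it computes, and it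
keeps the targets apart from all controls, as `maps_togglesOf` requires. -/
lemma IsLayered.maps_step (h : IsLayered sel lay T) {t : ℕ} (ht : t + 1 ≤ T) (cp : C × Fin r)
    {x : W → ZMod 2} (hx : ∀ v, x (lay (t + 1) v) = 0) :
    ∃ y, (togglesOf Finset.univ.toList (lay (t + 1)) (elimConditions sel lay t cp)).Maps x y ∧
      (∀ v, y (lay (t + 1) v) = elimStep (fun c => x (sel c)) (fun v => x (lay t v)) cp v) ∧
      ∀ u, (∀ v, u ≠ lay (t + 1) v) → y u = x u := by
  classical
  have hl : ∀ v v', lay (t + 1) v ≠ lay t v' := fun v v' he => by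
    have := (h.inj _ ht _ (by omega) _ _ he).1
    omega
  have hs : ∀ v c, lay (t + 1) v ≠ sel c := fun v c => (h.ne c _ ht v).symm
  have hd : ∀ v v', lay t v = lay t v' ↔ v = v' :=
    fun v v' => ⟨fun he => (h.inj _ (by omega) _ (by omega) _ _ he).2, fun he => by rw [he]⟩
  have hd' : ∀ c v, sel c ≠ lay t v := fun c v => h.ne c t (by omega) v
  let y : W → ZMod 2 := fun u => if hu : ∃ v, u = lay (t + 1) v then
    elimStep (fun c => x (sel c)) (fun v => x (lay t v)) cp hu.choose else x u
  have hy1 : ∀ v, y (lay (t + 1) v) =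
      elimStep (fun c => x (sel c)) (fun v => x (lay t v)) cp v := by
    intro v
    have hu : ∃ v', lay (t + 1) v = lay (t + 1) v' := ⟨v, rfl⟩
    simp only [y, dif_pos hu]
    rw [← (h.inj _ ht _ ht _ _ hu.choose_spec).2]
  have hy2 : ∀ u, (∀ v, u ≠ lay (t + 1) v) → y u = x u := by
    intro u hu
    have hu' : ¬ ∃ v, u = lay (t + 1) v := fun ⟨v, hv⟩ => hu v hv
    simp only [y, dif_neg hu']
  refine ⟨y, maps_togglesOf _ (Finset.nodup_toList _) _ ?_ _ ?_ ?_ ?_ ?_, hy1, hy2⟩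
  · exact fun v _ v' _ he => (h.inj _ ht _ ht _ _ he).2
  · rintro v _ (⟨i, j⟩ | i) _ c hc
    · simp only [elimConditions] at hc
      split_ifs at hc <;> simp only [List.mem_cons, List.not_mem_nil, or_false] at hc
      · subst hc
        simp [hl]
      · rcases hc with rfl | rfl <;> simp [hl, hs]
    · simp only [elimConditions] at hc
      split_ifs at hc <;> simp only [List.mem_cons, List.not_mem_nil, or_false] at hc
      · rcases hc with rfl | rfl <;> simp [hl, hs]
      · subst hc
        simp [hl]
  · rintro (⟨i, j⟩ | i) _ c hc
    · simp only [elimConditions] at hc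
      split_ifs at hc <;> simp only [List.mem_cons, List.not_mem_nil, or_false] at hc
      · subst hc
        simp
      · rcases hc with rfl | rfl
        · simp
        · simp [hd, (hd' _ _).symm]
    · simp only [elimConditions] at hc
      split_ifs at hc <;> simp only [List.mem_cons, List.not_mem_nil, or_false] at hc
      · rcases hc with rfl | rfl
        · simp
        · simp [hd, (hd' _ _).symm]
      · subst hc
        simp
  · have hbit : ∀ v, holdsBit ({lay t v}, ∅) x = x (lay t v) := by
      intro v
      rcases zmod_two_cases (x (lay t v)) with h0 | h0 <;> simp [holdsBit, Holds, h0]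
    rintro (⟨i, j⟩ | i) _
    · rw [hy1, hx, zero_add]
      simp only [elimConditions, elimStep, List.map_cons, List.sum_cons, hbit]
      congr 1
      by_cases hi : i = cp.2
      · simp [hi]
      · simp only [hi, if_false, List.map_cons, List.map_nil, List.sum_cons, List.sum_nil, add_zero,
          holdsBit]
        refine if_congr ?_ rfl rfl
        simp only [Holds, IsPivot, Finset.mem_insert, Finset.mem_singleton, forall_eq_or_imp,
          forall_eq, ne_eq]
        tauto
    · rw [hy1, hx, zero_add]
      simp only [elimConditions, elimStep, List.map_cons, List.sum_cons, hbit]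
      congr 1
      by_cases hi : i = cp.2
      · simp only [hi, if_true, List.map_cons, List.map_nil, List.sum_cons, List.sum_nil, add_zero,
          holdsBit]
        refine if_congr ?_ rfl rfl
        simp only [Holds, IsPivot, Finset.mem_insert, Finset.mem_singleton, forall_eq_or_imp,
          forall_eq, true_and]
        tauto
      · simp [hi]
  · exact fun u hu => hy2 u fun v => hu v (by simp)

lemma IsLayered.maps_elimCircuit (h : IsLayered sel lay T) (L : List (C × Fin r)) {t : ℕ}
    (ht : t + L.length ≤ T) {x : W → ZMod 2}
    (hx : ∀ t' v, t < t' → t' ≤ T → x (lay t' v) = 0) :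
    ∃ y, (elimCircuit sel lay t L).Maps x y ∧
      (∀ v, y (lay (t + L.length) v) =
        L.foldl (elimStep fun c => x (sel c)) (fun v => x (lay t v)) v) ∧
      ∀ u, (∀ t' v, t < t' → t' ≤ T → u ≠ lay t' v) → y u = x u := by
  induction L generalizing t x with
  | nil => exact ⟨x, rfl, fun v => rfl, fun u _ => rfl⟩
  | cons cp L ih =>
    rw [List.length_cons] at ht
    obtain ⟨y, hy1, hy2, hy3⟩ := h.maps_step (t := t) (by omega) cp
      (hx := fun v => hx (t + 1) v (by omega) (by omega))
    obtain ⟨z, hz1, hz2, hz3⟩ := ih (t := t + 1) (x := y) (by omega) (by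
      intro t' v h1 h2
      rw [hy3, hx t' v (by omega) h2]
      intro v' he
      have := (h.inj _ h2 _ (by omega) _ _ he).1
      omega)
    refine ⟨z, hy1.append hz1, fun v => ?_, fun u hu => ?_⟩
    · rw [List.length_cons, show t + (L.length + 1) = t + 1 + L.length by ring, hz2 v,
        List.foldl_cons]
      have e1 : (fun v => y (lay (t + 1) v)) =
          elimStep (fun c => x (sel c)) (fun v => x (lay t v)) cp := funext hy2
      have e2 : (fun c => y (sel c)) = fun c => x (sel c) :=
        funext fun c => hy3 _ fun v => h.ne c _ (by omega) v
      rw [e1, e2]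
    · rw [hz3 u fun t' v h1 h2 => hu t' v (by omega) h2,
        hy3 u fun v => hu (t + 1) v (by omega) (by omega)]

/-- A computation followed by a sign and the reversed computation. -/
lemma run_compute_sign {W : Type} [DecidableEq W] {C : Circuit W} {g : Gate W} {x y : W → ZMod 2}
    {z : ℂ} (h : C.Maps x y) (hg : g.apply (ket y) = z • ket y) :
    Circuit.run (C ++ [g] ++ C.adj) (ket x) = z • ket x := by
  rw [Circuit.run_append, Circuit.run_append, h, Circuit.run_cons, Circuit.run_nil, hg,
    Circuit.run_smul, h.adj]

lemma apply_controlled_signOp {W : Type} [DecidableEq W] {t : W} {pos : Finset W} (ht : t ∉ pos)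
    (x : W → ZMod 2) : (controlled signOp t pos ∅).apply (ket x) =
      (open Classical in if (∀ c ∈ pos, x c = 1) ∧ x t = 1 then (-1 : ℂ) else 1) • ket x := by
  classical
  have hact := controlled_active (op := signOp) ht (Finset.notMem_empty t) (by simp) x
  have hu : Function.update x t (x t) = x := Function.update_eq_self _ _
  by_cases h : ∀ c ∈ pos, x c = 1
  · rw [Gate.apply_ket _ _ (hact.2 ⟨h, by simp⟩), sum_zmod_two]
    have e : (controlled signOp t pos ∅).target = t := rfl
    rw [e]
    rcases zmod_two_cases (x t) with h0 | h0
    · rw [h0] at hu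
      simp [h0, hu, controlled, signOp]
    · rw [if_pos ⟨h, h0⟩, h0]
      rw [h0] at hu
      simp [hu, controlled, signOp]
  · rw [Gate.apply_ket_of_not_active _ _ (fun hc => h (hact.1 hc).1), if_neg (fun hc => h hc.1),
      one_smul]

end

/-! ### The circuits for the search -/

section
variable (r κ : ℕ)

/-- The ancillas: the layers of the elimination and a grid for counting. -/
abbrev Work : Type :=
  (Fin ((r + κ) * r + 1) × ElimIndex r (Col r κ)) ⊕ (Fin (r + κ + 1) × Fin (r + κ + 1))

/-- The number of ancillas minus one. -/
def workSize : ℕ := Fintype.card (Work r κ) - 1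

/-- The numbering of the ancillas. -/
def workEquiv : Work r κ ≃ Fin (workSize r κ + 1) :=
  Fintype.equivFinOfCardEq (by
    have : 0 < Fintype.card (Work r κ) := Fintype.card_pos_iff.2 ⟨Sum.inr (0, 0)⟩
    rw [workSize]
    omega)

/-- The wire of an ancilla. -/
def workWire (v : Work r κ) : Wire r κ (workSize r κ) := Sum.inr (Sum.inr (workEquiv r κ v))

/-- The selection wires. -/
def selWire (c : Col r κ) : Wire r κ (workSize r κ) := Sum.inr (Sum.inl c)

/-- The wires of the layers of the elimination. -/
def layWire (t : ℕ) (v : ElimIndex r (Col r κ)) : Wire r κ (workSize r κ) :=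
  workWire r κ (Sum.inl (Fin.ofNat _ t, v))

/-- The wires of the grid. -/
def gridWire (i c : ℕ) : Wire r κ (workSize r κ) :=
  workWire r κ (Sum.inr (Fin.ofNat _ i, Fin.ofNat _ c))

/-- The selection wires, numbered. -/
def selBit (i : ℕ) : Wire r κ (workSize r κ) :=
  -- The default wire is never read: only the numbers below `r + κ` are used.
  if h : i < r + κ then selWire r κ (finSumFinEquiv.symm ⟨i, h⟩) else gridWire r κ 0 0

/-- The wires of the right-hand side in the last layer. -/
def rhsBit (i : ℕ) : Wire r κ (workSize r κ) :=
  if h : i < r then layWire r κ ((r + κ) * r) (Sum.inl (⟨i, h⟩, none)) else gridWire r κ 0 0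

/-- The conditions under which an entry of the first layer is negated. -/
def loadConditions : ElimIndex r (Col r κ) →
    List (Finset (Wire r κ (workSize r κ)) × Finset (Wire r κ (workSize r κ)))
  | Sum.inl (i, none) => [({Sum.inl (Sum.inr i)}, ∅)]
  | Sum.inl (i, some (Sum.inl i')) => if i = i' then [(∅, ∅)] else []
  | Sum.inl (i, some (Sum.inr j)) => [({Sum.inl (Sum.inl (i, j))}, ∅)]
  | Sum.inr _ => []

/-- The circuit that computes the result of the elimination and the weight of the solution. -/
def decideCircuit : Circuit (Wire r κ (workSize r κ)) :=
  togglesOf Finset.univ.toList (layWire r κ 0) (loadConditions r κ) ++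
    elimCircuit (selWire r κ) (layWire r κ) 0 (elimOrder r Finset.univ.toList) ++
    countCircuit (rhsBit r κ) (gridWire r κ) r r

/-- The circuit for the oracle. -/
def oracleCircuit (w : ℕ) : Circuit (Wire r κ (workSize r κ)) :=
  -- For `w > r` no set of `r` columns carries a solution of weight `w`, so the empty circuit is
  -- correct. Otherwise cell `(r, w)` lies in the part of the grid that has been filled.
  if w ≤ r then
    decideCircuit r κ ++ [controlled signOp (gridWire r κ r w)
      (Finset.univ.image fun p => layWire r κ ((r + κ) * r) (Sum.inr p)) ∅] ++
      (decideCircuit r κ).adj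
  else []

variable {r κ}

lemma workWire_injective : Function.Injective (workWire r κ) := by
  intro v v' h
  exact (workEquiv r κ).injective (Sum.inr_injective (Sum.inr_injective h))

lemma ofNat_eq_iff {n i j : ℕ} (hi : i ≤ n) (hj : j ≤ n) :
    Fin.ofNat (n + 1) i = Fin.ofNat (n + 1) j ↔ i = j := by
  rw [Fin.ext_iff]
  simp [Fin.ofNat, Nat.mod_eq_of_lt (Nat.lt_succ_of_le hi), Nat.mod_eq_of_lt (Nat.lt_succ_of_le hj)]

lemma layWire_ne_gridWire (t v i c) : layWire r κ t v ≠ gridWire r κ i c := fun h =>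
  Sum.inl_ne_inr (workWire_injective h)

lemma isLayered : IsLayered (selWire r κ) (layWire r κ) ((r + κ) * r) where
  inj t ht t' ht' v v' h := by
    have h1 := Sum.inl_injective (workWire_injective h)
    exact ⟨(ofNat_eq_iff ht ht').1 (Prod.ext_iff.1 h1).1, (Prod.ext_iff.1 h1).2⟩
  ne c t _ v h := Sum.inl_ne_inr (Sum.inr_injective h)

lemma gridWire_inj {i c i' c' : ℕ} (hi : i ≤ r + κ) (hc : c ≤ r + κ) (hi' : i' ≤ r + κ)
    (hc' : c' ≤ r + κ) (h : gridWire r κ i c = gridWire r κ i' c') : i = i' ∧ c = c' := by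
  have h1 := Sum.inr_injective (workWire_injective h)
  exact ⟨(ofNat_eq_iff hi hi').1 (Prod.ext_iff.1 h1).1, (ofNat_eq_iff hc hc').1 (Prod.ext_iff.1 h1).2⟩

lemma isGrid_selBit : IsGrid (selBit r κ) (gridWire r κ) (r + κ) where
  inj _ hi _ hc _ hi' _ hc' h := gridWire_inj hi hc hi' hc' h
  ne j hj i _ c _ h := by
    rw [selBit, dif_pos hj] at h
    exact Sum.inl_ne_inr (Sum.inr_injective h)

/-- The oracle reuses the grid of the preparation, which is clear again by then; it only needs the
corner of size `r`. -/
lemma isGrid_rhsBit : IsGrid (rhsBit r κ) (gridWire r κ) r where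
  inj _ hi _ hc _ hi' _ hc' h :=
    gridWire_inj (by omega) (by omega) (by omega) (by omega) h
  ne j hj i _ c _ h := by
    rw [rhsBit, dif_pos hj] at h
    exact layWire_ne_gridWire _ _ _ _ h

variable (M : Matrix (Fin r) (Fin κ) (ZMod 2)) (s : Fin r → ZMod 2)

lemma config_selWire (b : Col r κ → ZMod 2) (c : Col r κ) :
    config (workSize r κ) M s b (selWire r κ c) = b c := rfl

lemma length_elimOrder {C : Type} (cs : List C) : (elimOrder r cs).length = cs.length * r := by
  simp [elimOrder, List.length_flatMap]

/-- The identity block of `(1 | M)` is not stored in any register, so its diagonal is loaded by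
unconditional negations. The flags stay zero. -/
lemma maps_load (b : Col r κ → ZMod 2) :
    ∃ y, (togglesOf Finset.univ.toList (layWire r κ 0) (loadConditions r κ)).Maps
        (config (workSize r κ) M s b) y ∧
      (∀ v, y (layWire r κ 0 v) = elimInit (systematic M) s v) ∧
      ∀ u, (∀ v, u ≠ layWire r κ 0 v) → y u = config (workSize r κ) M s b u := by
  classical
  have hinj : ∀ v v', layWire r κ 0 v = layWire r κ 0 v' → v = v' := fun v v' h =>
    (isLayered.inj 0 (Nat.zero_le _) 0 (Nat.zero_le _) v v' h).2
  let y : Wire r κ (workSize r κ) → ZMod 2 := fun u => if hu : ∃ v, u = layWire r κ 0 v then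
    elimInit (systematic M) s hu.choose else config (workSize r κ) M s b u
  have hy1 : ∀ v, y (layWire r κ 0 v) = elimInit (systematic M) s v := by
    intro v
    have hu : ∃ v', layWire r κ 0 v = layWire r κ 0 v' := ⟨v, rfl⟩
    simp only [y, dif_pos hu]
    rw [← hinj _ _ hu.choose_spec]
  have hy2 : ∀ u, (∀ v, u ≠ layWire r κ 0 v) → y u = config (workSize r κ) M s b u := by
    intro u hu
    have hu' : ¬ ∃ v, u = layWire r κ 0 v := fun ⟨v, hv⟩ => hu v hv
    simp only [y, dif_neg hu']
  have hne : ∀ v z, layWire r κ 0 v ≠ Sum.inl z := fun v z h => Sum.inr_ne_inl h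
  refine ⟨y, maps_togglesOf _ (Finset.nodup_toList _) _ ?_ _ ?_ ?_ ?_ ?_, hy1, hy2⟩
  · exact fun v _ v' _ he => hinj _ _ he
  · rintro v _ (⟨i, _ | (i' | j)⟩ | i) _ c hc <;> simp only [loadConditions] at hc
    · rw [List.mem_singleton.1 hc]
      simp [hne]
    · split_ifs at hc
      · rw [List.mem_singleton.1 hc]
        simp
      · simp at hc
    · rw [List.mem_singleton.1 hc]
      simp [hne]
    · simp at hc
  · rintro (⟨i, _ | (i' | j)⟩ | i) _ c hc <;> simp only [loadConditions] at hc
    · rw [List.mem_singleton.1 hc]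
      simp
    · split_ifs at hc
      · rw [List.mem_singleton.1 hc]
        simp
      · simp at hc
    · rw [List.mem_singleton.1 hc]
      simp
    · simp at hc
  · have hbit : ∀ z, holdsBit ({Sum.inl z}, ∅) (config (workSize r κ) M s b) =
        config (workSize r κ) M s b (Sum.inl z) := by
      intro z
      rcases zmod_two_cases (config (workSize r κ) M s b (Sum.inl z)) with h0 | h0 <;>
        simp [holdsBit, Holds, h0]
    have h0 : ∀ v, config (workSize r κ) M s b (layWire r κ 0 v) = 0 := fun v => rfl
    rintro (⟨i, _ | (i' | j)⟩ | i) _ <;> rw [hy1, h0, zero_add]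
    · simp only [loadConditions, List.map_cons, List.map_nil, List.sum_cons, List.sum_nil, hbit,
        add_zero]
      rfl
    · by_cases h : i = i'
      · simp [loadConditions, elimInit, systematic, h, holdsBit, Holds]
      · simp [loadConditions, elimInit, systematic, h]
    · simp only [loadConditions, List.map_cons, List.map_nil, List.sum_cons, List.sum_nil, hbit,
        add_zero]
      rfl
    · simp [loadConditions, elimInit]
  · exact fun u hu => hy2 u fun v => hu v (by simp)

lemma ones_rhsBit (x : Wire r κ (workSize r κ) → ZMod 2) : ones (rhsBit r κ) x r =
    (Finset.univ.filter fun i : Fin r =>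
      x (layWire r κ ((r + κ) * r) (Sum.inl (i, none))) = 1).card := by
  rw [ones]
  symm
  refine Finset.card_bij (fun i _ => i.1) ?_ (fun _ _ _ _ h => Fin.ext h) ?_
  · intro i hi
    rw [Finset.mem_filter] at hi ⊢
    refine ⟨Finset.mem_range.2 i.2, ?_⟩
    rw [rhsBit, dif_pos i.2]
    exact hi.2
  · intro i hi
    rw [Finset.mem_filter, Finset.mem_range] at hi
    refine ⟨⟨i, hi.1⟩, ?_, rfl⟩
    rw [Finset.mem_filter]
    refine ⟨Finset.mem_univ _, ?_⟩
    have := hi.2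
    rwa [rhsBit, dif_pos hi.1] at this

/-- By `solvesOn_iff_elim` a set is marked exactly if all flags of the last layer are one and its
right-hand side has `w` ones. Counting does not touch the layers, so one sign gate on the cell `(r,
w)`, controlled by the flags, produces the sign before everything is uncomputed. -/
lemma oracleCircuit_run (w : ℕ) (I : Finset (Col r κ)) (hI : I.card = r) :
    (oracleCircuit r κ w).run (ket (config (workSize r κ) M s (bits I))) =
      (open Classical in if Marked M s w I then (-1 : ℂ) else 1) •
        ket (config (workSize r κ) M s (bits I)) := by
  classical
  have hb : ∀ c, bits I c = 1 ↔ c ∈ I := by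
    intro c
    by_cases hc : c ∈ I <;> simp [bits, hc]
  have hmark : ∀ w, Marked M s w I ↔ _ := fun w => solvesOn_iff_elim (systematic M) s I hI
    Finset.univ.toList (fun c => Finset.mem_toList.2 (Finset.mem_univ c)) hb w
  have hlen : (elimOrder r (Finset.univ.toList : List (Col r κ))).length = (r + κ) * r := by
    simp [length_elimOrder]
  obtain ⟨x1, hx1, hx1a, hx1b⟩ := maps_load M s (bits I)
  have hsel : (fun c => x1 (selWire r κ c)) = bits I := funext fun c => by
    rw [hx1b _ fun v => isLayered.ne c 0 (Nat.zero_le _) v, config_selWire]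
  obtain ⟨x2, hx2, hx2a, hx2b⟩ := isLayered.maps_elimCircuit
    (elimOrder r (Finset.univ.toList : List (Col r κ))) (t := 0) (x := x1) (by omega) (by
      intro t' v h1 h2
      rw [hx1b _ fun v' h => ?_]
      · rfl
      · have := (isLayered.inj t' h2 0 (Nat.zero_le _) _ _ h).1
        omega)
  have hgrid : ∀ i ≤ r, ∀ c ≤ r, x2 (gridWire r κ i c) = 0 := by
    intro i _ c _
    rw [hx2b _ fun t' v _ _ h => layWire_ne_gridWire _ _ _ _ h.symm,
      hx1b _ fun v h => layWire_ne_gridWire _ _ _ _ h.symm]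
    rfl
  have hx3 := isGrid_rhsBit.maps_countCircuit le_rfl hgrid
  have hcomp : (decideCircuit r κ).Maps (config (workSize r κ) M s (bits I)) _ :=
    (hx1.append hx2).append hx3
  have hfinal : ∀ v, x2 (layWire r κ ((r + κ) * r) v) =
      (elimOrder r (Finset.univ.toList : List (Col r κ))).foldl (elimStep (bits I))
        (elimInit (systematic M) s) v := by
    intro v
    have h1 := hx2a v
    rw [zero_add, hlen, hsel] at h1
    rw [h1, show (fun v => x1 (layWire r κ 0 v)) = elimInit (systematic M) s from funext hx1a]
  have hlast : ∀ v, fillGrid (rhsBit r κ) (gridWire r κ) r r x2 (layWire r κ ((r + κ) * r) v) =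
      x2 (layWire r κ ((r + κ) * r) v) := fun v =>
    IsGrid.fillGrid_of_ne (fun i _ c _ => layWire_ne_gridWire _ _ _ _) _ _
  have hones : ∀ w, (Finset.univ.filter fun i : Fin r =>
      (elimOrder r (Finset.univ.toList : List (Col r κ))).foldl (elimStep (bits I))
        (elimInit (systematic M) s) (Sum.inl (i, none)) = 1).card = w ↔
      w = ones (rhsBit r κ) x2 r := by
    intro w
    rw [ones_rhsBit, eq_comm]
    simp only [hfinal]
  rw [oracleCircuit]
  split_ifs with hw h
  · refine run_compute_sign hcomp ?_
    rw [apply_controlled_signOp, if_pos]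
    · rw [hmark, hones] at h
      refine ⟨?_, ?_⟩
      · intro c hc
        obtain ⟨p, _, rfl⟩ := Finset.mem_image.1 hc
        rw [hlast, hfinal]
        exact h.1 p
      · rw [isGrid_rhsBit.fillGrid_grid le_rfl hw, if_pos ⟨le_rfl, h.2⟩]
    · intro hc
      obtain ⟨p, _, hp⟩ := Finset.mem_image.1 hc
      exact layWire_ne_gridWire _ _ _ _ hp
  · refine run_compute_sign hcomp ?_
    rw [apply_controlled_signOp, if_neg]
    · rintro ⟨h1, h2⟩
      refine h ((hmark w).2 ⟨fun p => ?_, (hones w).2 ?_⟩)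
      · have := h1 (layWire r κ ((r + κ) * r) (Sum.inr p)) (Finset.mem_image_of_mem _ (by simp))
        rwa [hlast, hfinal] at this
      · rw [isGrid_rhsBit.fillGrid_grid le_rfl hw] at h2
        by_contra hne
        simp [hne] at h2
    · intro hc
      obtain ⟨p, _, hp⟩ := Finset.mem_image.1 hc
      exact layWire_ne_gridWire _ _ _ _ hp
  -- The remaining marked case has `w > r`, but the right-hand side has only `r` entries.
  · exfalso
    rename_i h
    rw [hmark, hones, ones_rhsBit] at h
    have := h.2
    have h2 := (Finset.card_filter_le (Finset.univ : Finset (Fin r)) fun i =>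
      x2 (layWire r κ ((r + κ) * r) (Sum.inl (i, none))) = 1)
    simp only [Finset.card_univ, Fintype.card_fin] at h2
    omega
  · rw [Circuit.run_nil, one_smul]

lemma selBit_inj : ∀ i < r + κ, ∀ j < r + κ, selBit r κ i = selBit r κ j → i = j := by
  intro i hi j hj h
  rw [selBit, selBit, dif_pos hi, dif_pos hj] at h
  have h1 := finSumFinEquiv.symm.injective (Sum.inl_injective (Sum.inr_injective h))
  simpa using h1

/-- Numbering the columns identifies their `r`-subsets with those of `range (r + κ)`, which carries
the sum of `run_prepCircuit` over to column sets. -/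
lemma prepCircuit_run :
    (prepCircuit (selBit r κ) (gridWire r κ) (r + κ) r).run
        (ket (config (workSize r κ) M s 0)) =
      ((Real.sqrt ((r + κ).choose r) : ℝ) : ℂ)⁻¹ •
        ∑ I ∈ (Finset.univ : Finset (Col r κ)).powersetCard r,
          ket (config (workSize r κ) M s (bits I)) := by
  classical
  have hx : ∀ i < r + κ, config (workSize r κ) M s 0 (selBit r κ i) = 0 := by
    intro i hi
    rw [selBit, dif_pos hi]
    rfl
  rw [run_prepCircuit isGrid_selBit selBit_inj hx (fun i _ c _ => rfl) (Nat.le_add_right r κ),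
    Complex.ofReal_inv]
  congr 1
  symm
  let f : Col r κ ↪ ℕ := finSumFinEquiv.toEmbedding.trans Fin.valEmbedding
  have hf : ∀ c, f c < r + κ := fun c => (finSumFinEquiv c).2
  have hf' : ∀ i, ∀ hi : i < r + κ, f (finSumFinEquiv.symm ⟨i, hi⟩) = i := fun i hi => by
    simp [f]
  refine Finset.sum_bij (fun I _ => I.map f) ?_ ?_ ?_ ?_
  · intro I hI
    rw [Finset.mem_powersetCard] at hI ⊢
    refine ⟨fun i hi => ?_, by rw [Finset.card_map, hI.2]⟩
    obtain ⟨c, _, rfl⟩ := Finset.mem_map.1 hi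
    exact Finset.mem_range.2 (hf c)
  · exact fun I _ J _ h => Finset.map_injective f h
  · intro A hA
    rw [Finset.mem_powersetCard] at hA
    have hmap : (Finset.univ.filter fun c => f c ∈ A).map f = A := by
      ext i
      simp only [Finset.mem_map, Finset.mem_filter, Finset.mem_univ, true_and]
      constructor
      · rintro ⟨c, hc, rfl⟩
        exact hc
      · intro hi
        have hi' := Finset.mem_range.1 (hA.1 hi)
        exact ⟨finSumFinEquiv.symm ⟨i, hi'⟩, by rwa [hf'], hf' i hi'⟩
    refine ⟨Finset.univ.filter fun c => f c ∈ A, ?_, hmap⟩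
    rw [Finset.mem_powersetCard]
    refine ⟨Finset.subset_univ _, ?_⟩
    rw [← Finset.card_map f, hmap, hA.2]
  · intro I _
    congr 1
    ext u
    rw [setBits]
    have hsel : ∀ c, selBit r κ (f c) = selWire r κ c := by
      intro c
      rw [selBit, dif_pos (hf c)]
      congr 1
      exact finSumFinEquiv.symm_apply_apply c
    have hiff : (∃ i ∈ I.map f, u = selBit r κ i) ↔ ∃ c ∈ I, u = selWire r κ c := by
      constructor
      · rintro ⟨i, hi, rfl⟩
        obtain ⟨c, hc, rfl⟩ := Finset.mem_map.1 hi
        exact ⟨c, hc, hsel c⟩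
      · rintro ⟨c, hc, rfl⟩
        exact ⟨f c, Finset.mem_map_of_mem f hc, (hsel c).symm⟩
    rw [if_congr hiff rfl rfl]
    rcases u with u | (c | a)
    · rw [if_neg (by rintro ⟨c, _, h⟩; exact Sum.inl_ne_inr h)]
      rfl
    · have : (∃ c' ∈ I, (Sum.inr (Sum.inl c) : Wire r κ (workSize r κ)) = selWire r κ c') ↔
          c ∈ I := by
        constructor
        · rintro ⟨c', hc', h⟩
          rwa [Sum.inl_injective (Sum.inr_injective h)]
        · exact fun h => ⟨c, h, rfl⟩
      rw [if_congr this rfl rfl]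
      rfl
    · rw [if_neg (by rintro ⟨c, _, h⟩; exact Sum.inr_ne_inl (Sum.inr_injective h))]
      rfl

/-- The circuits for the search. -/
def searchCircuits (r κ w : ℕ) : SearchCircuits r κ w where
  anc := workSize r κ
  prep := prepCircuit (selBit r κ) (gridWire r κ) (r + κ) r
  oracle := oracleCircuit r κ w
  prep_spec := prepCircuit_run
  oracle_spec M s I hI := oracleCircuit_run M s w I hI

/-- The lower bound for the running time needs that every amplification step has positive cost. -/
lemma one_le_cost_prep (r κ w : ℕ) : 1 ≤ (searchCircuits r κ w).prep.cost := by
  simp only [searchCircuits, prepCircuit, Circuit.cost_append]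
  have : 1 ≤ (togglesOf [()] (fun _ => gridWire r κ 0 0) (fun _ => [(∅, ∅)])).cost := by
    simp [togglesOf, Circuit.cost]
  omega

end

/-! ### Polynomial bounds for ancillas and cost, with generous exponents -/

section
variable (r κ w : ℕ)

lemma card_elimIndex : Fintype.card (ElimIndex r (Col r κ)) = r * (r + κ + 1) + r := by
  simp

lemma card_elimIndex_le : Fintype.card (ElimIndex r (Col r κ)) ≤ (r + κ + 2) ^ 3 := by
  rw [card_elimIndex]
  have hr : r ≤ r + κ + 2 := by omega
  have hN : r + κ + 1 ≤ r + κ + 2 := by omega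
  have h2 : 2 ≤ r + κ + 2 := by omega
  generalize r + κ + 2 = Z at *
  calc r * (r + κ + 1) + r ≤ Z * Z + Z * 1 := by gcongr; omega
    _ ≤ Z * Z + Z * Z := by gcongr; omega
    _ = 2 * Z ^ 2 := by ring
    _ ≤ Z * Z ^ 2 := by gcongr
    _ = Z ^ 3 := by ring

lemma workSize_le : workSize r κ ≤ (r + κ + 2) ^ 6 := by
  have h : Fintype.card (Work r κ) =
      ((r + κ) * r + 1) * Fintype.card (ElimIndex r (Col r κ)) + (r + κ + 1) * (r + κ + 1) := by
    rw [Fintype.card_sum, Fintype.card_prod, Fintype.card_prod]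
    simp
  have h0 := card_elimIndex_le r κ
  have h1 : (r + κ) * r + 1 ≤ (r + κ + 2) ^ 2 := by nlinarith
  have h2 : (r + κ + 1) * (r + κ + 1) ≤ (r + κ + 2) ^ 2 := by nlinarith
  have h3 : 2 ≤ r + κ + 2 := by omega
  refine (Nat.sub_le _ _).trans ?_
  rw [h]
  generalize Fintype.card (ElimIndex r (Col r κ)) = E at *
  generalize r + κ + 2 = Z at *
  have h4 : 1 ≤ Z := by omega
  calc ((r + κ) * r + 1) * E + (r + κ + 1) * (r + κ + 1) ≤ Z ^ 2 * Z ^ 3 + Z ^ 2 := by gcongr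
    _ ≤ Z ^ 2 * Z ^ 3 + Z ^ 2 * Z ^ 3 := by
      gcongr
      exact Nat.le_mul_of_pos_right _ (by positivity)
    _ = 2 * Z ^ 5 := by ring
    _ ≤ Z * Z ^ 5 := by gcongr
    _ = Z ^ 6 := by ring

lemma card_wire_le : Fintype.card (Wire r κ (workSize r κ)) ≤ (r + κ + 2) ^ 8 := by
  have h0 := workSize_le r κ
  have h : Fintype.card (Wire r κ (workSize r κ)) =
      r * κ + r + (r + κ + (workSize r κ + 1)) := by simp
  have h1 : r * κ + r + (r + κ + 1) ≤ (r + κ + 2) ^ 2 := by nlinarith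
  have h3 : 2 ≤ r + κ + 2 := by omega
  rw [h]
  generalize workSize r κ = E at *
  calc r * κ + r + (r + κ + (E + 1)) = (r * κ + r + (r + κ + 1)) + E := by ring
    _ ≤ (r + κ + 2) ^ 2 + (r + κ + 2) ^ 6 := by gcongr
    _ ≤ (r + κ + 2) ^ 7 + (r + κ + 2) ^ 7 := by gcongr <;> omega
    _ = 2 * (r + κ + 2) ^ 7 := (two_mul _).symm
    _ ≤ (r + κ + 2) * (r + κ + 2) ^ 7 := by gcongr
    _ = (r + κ + 2) ^ 8 := (pow_succ' _ _).symm

lemma cost_prep_le : (searchCircuits r κ w).prep.cost ≤ (r + κ + 2) ^ 20 := by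
  refine (Circuit.cost_le _).trans ?_
  have h0 := length_prepCircuit_le (selBit r κ) (gridWire r κ) (r + κ) r
  have h1 := card_wire_le r κ
  have h3 : 2 ≤ r + κ + 2 := by omega
  have h2 : 2 + (r + κ) * ((r + κ + 1) * 5) ≤ (r + κ + 2) ^ 5 := by
    have hN : r + κ ≤ r + κ + 2 := by omega
    have hN' : r + κ + 1 ≤ r + κ + 2 := by omega
    generalize r + κ + 2 = Z at *
    calc 2 + (r + κ) * ((r + κ + 1) * 5) ≤ Z + Z * (Z * 5) := by gcongr
      _ ≤ Z * Z + Z * (Z * 5) := by nlinarith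
      _ = 6 * Z ^ 2 := by ring
      _ ≤ 2 ^ 3 * Z ^ 2 := by gcongr; norm_num
      _ ≤ Z ^ 3 * Z ^ 2 := by gcongr
      _ = Z ^ 5 := by ring
  calc _ ≤ (r + κ + 2) ^ 5 * (r + κ + 2) ^ 8 := Nat.mul_le_mul (h0.trans h2) h1
    _ = (r + κ + 2) ^ 13 := by rw [← pow_add]
    _ ≤ (r + κ + 2) ^ 20 := by gcongr <;> omega

lemma length_oracleCircuit_le : (oracleCircuit r κ w).length ≤ (r + κ + 2) ^ 12 := by
  have h3 : 2 ≤ r + κ + 2 := by omega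
  have hd : (decideCircuit r κ).length ≤ (r + κ + 2) ^ 10 := by
    rw [decideCircuit, List.length_append, List.length_append]
    have h1 : (togglesOf Finset.univ.toList (layWire r κ 0) (loadConditions r κ)).length ≤
        Fintype.card (ElimIndex r (Col r κ)) * 1 := by
      refine (length_togglesOf_le _ _ _ (B := 1) ?_).trans (by simp)
      rintro (⟨i, _ | (i' | j)⟩ | i) _ <;> simp only [loadConditions]
      · simp
      · split_ifs <;> simp
      · simp
      · simp
    have h2 := length_elimCircuit_le (selWire r κ) (layWire r κ) 0
      (elimOrder r (Finset.univ.toList : List (Col r κ)))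
    have h4 := length_countCircuit_le (rhsBit r κ) (gridWire r κ) r r
    have h5 : (elimOrder r (Finset.univ.toList : List (Col r κ))).length = (r + κ) * r := by
      simp [length_elimOrder]
    rw [h5] at h2
    have h6 := card_elimIndex_le r κ
    have h7 : (r + κ) * r ≤ (r + κ + 2) ^ 2 := by nlinarith
    have h8 : 1 + r * ((r + 1) * 2) ≤ (r + κ + 2) ^ 3 := by
      have : r ≤ r + κ + 2 := by omega
      have : r + 1 ≤ r + κ + 2 := by omega
      have : 1 + r * ((r + 1) * 2) ≤ 2 * (r + κ + 2) ^ 2 := by nlinarith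
      calc _ ≤ _ := this
        _ ≤ (r + κ + 2) * (r + κ + 2) ^ 2 := by gcongr
        _ = (r + κ + 2) ^ 3 := by ring
    generalize Fintype.card (ElimIndex r (Col r κ)) = E at *
    generalize r + κ + 2 = Z at *
    calc _ ≤ E * 1 + (r + κ) * r * (E * 2) + (1 + r * ((r + 1) * 2)) := by gcongr
      _ ≤ Z ^ 3 * 1 + Z ^ 2 * (Z ^ 3 * 2) + Z ^ 3 := by gcongr
      _ = 2 * Z ^ 3 + 2 * Z ^ 5 := by ring
      _ ≤ 2 * Z ^ 5 + 2 * Z ^ 5 := by gcongr <;> omega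
      _ = 2 ^ 2 * Z ^ 5 := by ring
      _ ≤ Z ^ 2 * Z ^ 5 := by gcongr
      _ = Z ^ 7 := by ring
      _ ≤ Z ^ 10 := by gcongr <;> omega
  rw [oracleCircuit]
  split_ifs
  · rw [List.length_append, List.length_append]
    have h1 : (decideCircuit r κ).adj.length = (decideCircuit r κ).length := by simp [Circuit.adj]
    rw [h1, List.length_singleton]
    generalize (decideCircuit r κ).length = E at *
    generalize r + κ + 2 = Z at *
    have h4 : 1 ≤ Z ^ 10 := Nat.one_le_pow _ _ (by omega)
    calc E + 1 + E ≤ Z ^ 10 + Z ^ 10 + Z ^ 10 := by omega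
      _ ≤ 2 ^ 2 * Z ^ 10 := by omega
      _ ≤ Z ^ 2 * Z ^ 10 := by gcongr
      _ = Z ^ 12 := by ring
  · simp

lemma cost_oracle_le : (searchCircuits r κ w).oracle.cost ≤ (r + κ + 2) ^ 20 := by
  refine (Circuit.cost_le _).trans ?_
  calc _ ≤ (r + κ + 2) ^ 12 * (r + κ + 2) ^ 8 :=
        Nat.mul_le_mul (length_oracleCircuit_le r κ w) (card_wire_le r κ)
    _ = (r + κ + 2) ^ 20 := by rw [← pow_add]

lemma anc_le : (searchCircuits r κ w).anc ≤ (r + κ + 2) ^ 20 :=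
  (workSize_le r κ).trans (Nat.pow_le_pow_right (by omega) (by omega))

/-- The cost of the full quantum circuit. -/
lemma cost_amplified {r κ w : ℕ} (D : SearchCircuits r κ w) :
    D.amplified.cost = D.prep.cost + iterations r κ w *
      (D.oracle.cost + D.prep.cost + (flipInitial r κ D.anc).cost + D.prep.cost) := by
  rw [SearchCircuits.amplified, Circuit.cost_append]
  congr 1
  induction iterations r κ w with
  | zero => simp [Circuit.cost]
  | succ j ih =>
    rw [List.replicate_succ, List.flatten_cons, Circuit.cost_append, ih, Circuit.cost_append,
      Circuit.cost_append, Circuit.cost_append, Circuit.cost_adj]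
    ring

lemma cost_amplified_le : (searchCircuits r κ w).amplified.cost ≤
    (r + κ + 2) ^ 22 * (iterations r κ w + 1) := by
  have h1 := cost_prep_le r κ w
  have h2 := cost_oracle_le r κ w
  have h3 : (flipInitial r κ (searchCircuits r κ w).anc).cost ≤ (r + κ + 2) ^ 20 := by
    refine (Circuit.cost_le _).trans ?_
    have : (flipInitial r κ (searchCircuits r κ w).anc).length = 1 := rfl
    rw [this, one_mul]
    exact (card_wire_le r κ).trans (Nat.pow_le_pow_right (by omega) (by omega))
  rw [cost_amplified]
  have h4 : 2 ≤ r + κ + 2 := by omega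
  have h5 : 4 * (r + κ + 2) ^ 20 ≤ (r + κ + 2) ^ 22 := by
    calc 4 * (r + κ + 2) ^ 20 = 2 ^ 2 * (r + κ + 2) ^ 20 := by norm_num
      _ ≤ (r + κ + 2) ^ 2 * (r + κ + 2) ^ 20 := by gcongr
      _ = (r + κ + 2) ^ 22 := by rw [← pow_add]
  generalize (r + κ + 2) ^ 20 = Z at *
  generalize (r + κ + 2) ^ 22 = Z' at *
  rw [mul_add Z', mul_one, add_comm]
  refine Nat.add_le_add ?_ (by omega)
  rw [mul_comm]
  refine Nat.mul_le_mul ?_ le_rfl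
  omega

lemma le_cost_amplified : iterations r κ w + 1 ≤ (searchCircuits r κ w).amplified.cost := by
  rw [cost_amplified]
  have h1 := one_le_cost_prep r κ w
  have h2 : iterations r κ w * 1 ≤ iterations r κ w * ((searchCircuits r κ w).oracle.cost +
      (searchCircuits r κ w).prep.cost + (flipInitial r κ (searchCircuits r κ w).anc).cost +
        (searchCircuits r κ w).prep.cost) := Nat.mul_le_mul le_rfl (by omega)
  omega

end

/-! ### Amplification with an overestimated amplitude -/

/-- A number of amplification steps adapted to the amplitude `√q` also works up to a constant factor
for the smaller amplitude `√(β q)`. -/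
lemma le_sin_sq_amplified {q β : ℝ} (hq0 : 0 < q) (hq1 : q ≤ 1) (hβ0 : 0 ≤ β) (hβ1 : β ≤ 1) :
    β / 100 ≤ Real.sin ((2 * (⌊Real.pi / (4 * Real.sqrt q)⌋₊ : ℝ) + 1) *
      Real.arcsin (Real.sqrt (β * q))) ^ 2 := by
  have hpi := Real.pi_pos
  have hpi3 := Real.pi_gt_d2
  have hpi4 := Real.pi_lt_d4
  set x := Real.sqrt q with hx
  have hx0 : 0 < x := Real.sqrt_pos.2 hq0
  have hxx : x ^ 2 = q := Real.sq_sqrt hq0.le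
  have hx1 : x ≤ 1 := Real.sqrt_le_one.2 hq1
  set y := Real.sqrt (β * q) with hy
  have hyx : y = Real.sqrt β * x := Real.sqrt_mul hβ0 q
  have hb1 : Real.sqrt β ≤ 1 := Real.sqrt_le_one.2 hβ1
  have hb0 := Real.sqrt_nonneg β
  have hbb : Real.sqrt β ^ 2 = β := Real.sq_sqrt hβ0
  have hy0 : 0 ≤ y := Real.sqrt_nonneg _
  have hyx' : y ≤ x := by
    rw [hyx]
    nlinarith
  have hy1 : y ≤ 1 := hyx'.trans hx1
  set θ := Real.arcsin y with hθ
  have hsin : Real.sin θ = y := Real.sin_arcsin (by linarith) hy1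
  have hθ0 : 0 ≤ θ := Real.arcsin_nonneg.2 hy0
  have hyθ : y ≤ θ := by
    rw [← hsin]
    exact Real.sin_le hθ0
  set j := ⌊Real.pi / (4 * x)⌋₊ with hj
  have hjle : (j : ℝ) ≤ Real.pi / (4 * x) := Nat.floor_le (by positivity)
  have hjlt : Real.pi / (4 * x) < j + 1 := Nat.lt_floor_add_one _
  have hj0' : (0 : ℝ) ≤ j := Nat.cast_nonneg j
  -- If `j = 0`, then `√q > π/4`, and even without amplification the probability `β q` is at least
  -- `0.6 β`.
  rcases Nat.eq_zero_or_pos j with hj0 | hj0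
  · rw [hj0] at hjlt ⊢
    simp only [Nat.cast_zero, mul_zero, zero_add, one_mul] at hjlt ⊢
    rw [hsin, hyx, mul_pow, hbb]
    rw [div_lt_one (by positivity)] at hjlt
    have hx2 : 0.6 ≤ x ^ 2 := by nlinarith
    nlinarith
  · have hj1 : (1 : ℝ) ≤ j := by exact_mod_cast hj0
    have hx4 : x ≤ Real.pi / 4 := by
      have h := hj1.trans hjle
      rw [le_div_iff₀ (by positivity)] at h
      linarith
    have hs3 : (1.732 : ℝ) ≤ Real.sqrt 3 := Real.le_sqrt_of_sq_le (by norm_num)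
    have hθ3 : θ ≤ Real.pi / 3 := by
      rw [hθ]
      refine (Real.arcsin_le_iff_le_sin' ⟨by linarith, by linarith⟩).2 ?_
      rw [Real.sin_pi_div_three]
      linarith
    -- On `[0, π/3]` the concave sine lies above its chord. This bounds `θ` by a multiple of `sin θ`
    -- with a constant smaller than `π/2`, which would be too weak below.
    have hconc : Real.sqrt 3 / 2 * (3 * θ / Real.pi) ≤ y := by
      rw [← hsin]
      have hm : Real.pi / 3 ∈ Set.Icc 0 Real.pi := ⟨by positivity, by linarith⟩
      have hm0 : (0 : ℝ) ∈ Set.Icc 0 Real.pi := ⟨le_rfl, hpi.le⟩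
      have ha : 0 ≤ 1 - 3 * θ / Real.pi := by
        rw [sub_nonneg, div_le_one hpi]
        linarith
      have hb : 0 ≤ 3 * θ / Real.pi := by positivity
      have h := strictConcaveOn_sin_Icc.concaveOn.2 hm0 hm ha hb (sub_add_cancel _ _)
      have e : (1 - 3 * θ / Real.pi) • (0 : ℝ) + (3 * θ / Real.pi) • (Real.pi / 3) = θ := by
        simp only [smul_eq_mul]
        field_simp
        ring
      rw [e] at h
      simpa [Real.sin_pi_div_three, mul_comm] using h
    set φ := (2 * (j : ℝ) + 1) * θ with hφ
    -- From `2j + 1 ≥ j + 1 > π / (4√q)` and `θ ≥ √β √q`.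
    have hφlow : Real.pi / 4 * Real.sqrt β ≤ φ := by
      have h1 : Real.pi / (4 * x) * y ≤ (j + 1) * θ :=
        mul_le_mul hjlt.le hyθ hy0 (by positivity)
      have h2 : Real.pi / (4 * x) * y = Real.pi / 4 * Real.sqrt β := by
        rw [hyx]
        field_simp
      rw [h2] at h1
      nlinarith
    -- The final angle must stay away from `π`: `2jθ` is at most `0.606 π`, and the extra `θ` is at
    -- most `π / 3`.
    have hφup : φ ≤ 0.94 * Real.pi := by
      have h1 : 2 * (j : ℝ) * θ ≤ Real.pi / (2 * x) * θ := by
        have : 2 * (j : ℝ) ≤ Real.pi / (2 * x) := by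
          calc 2 * (j : ℝ) ≤ 2 * (Real.pi / (4 * x)) := by linarith
            _ = Real.pi / (2 * x) := by field_simp; norm_num
        exact mul_le_mul_of_nonneg_right this hθ0
      have h2 : θ ≤ x * (2 * Real.pi / (3 * Real.sqrt 3)) := by
        have h3 := hconc.trans hyx'
        have h4 : Real.sqrt 3 / 2 * (3 * θ / Real.pi) * (2 * Real.pi / (3 * Real.sqrt 3)) = θ := by
          have : Real.sqrt 3 ≠ 0 := by positivity
          field_simp
        rw [← h4]
        exact mul_le_mul_of_nonneg_right h3 (by positivity)
      have h3 : Real.pi / (2 * x) * θ ≤ Real.pi / (2 * x) * (x * (2 * Real.pi / (3 * Real.sqrt 3))) :=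
        mul_le_mul_of_nonneg_left h2 (by positivity)
      have h4 : Real.pi / (2 * x) * (x * (2 * Real.pi / (3 * Real.sqrt 3))) =
          Real.pi * (Real.pi / (3 * Real.sqrt 3)) := by
        field_simp
      have h5 : Real.pi / (3 * Real.sqrt 3) ≤ 0.606 := by
        rw [div_le_iff₀ (by positivity)]
        linarith
      nlinarith
    -- Jordan's inequality `2φ/π ≤ sin φ`, applied to `φ` or to `π - φ`, whichever is at most `π /
    -- 2`.
    have hroot : Real.sqrt β / 10 ≤ Real.sin φ := by
      rcases le_or_gt φ (Real.pi / 2) with h | h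
      · refine le_trans ?_ (Real.mul_le_sin (by positivity) h)
        have : 2 / Real.pi * (Real.pi / 4 * Real.sqrt β) = Real.sqrt β / 2 := by
          field_simp
          norm_num
        calc Real.sqrt β / 10 ≤ Real.sqrt β / 2 := by linarith
          _ = 2 / Real.pi * (Real.pi / 4 * Real.sqrt β) := this.symm
          _ ≤ 2 / Real.pi * φ := mul_le_mul_of_nonneg_left hφlow (by positivity)
      · rw [← Real.sin_pi_sub]
        refine le_trans ?_ (Real.mul_le_sin (by linarith) (by linarith))
        have : 2 / Real.pi * (0.06 * Real.pi) = 0.12 := by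
          field_simp
          norm_num
        calc Real.sqrt β / 10 ≤ 0.12 := by linarith
          _ = 2 / Real.pi * (0.06 * Real.pi) := this.symm
          _ ≤ 2 / Real.pi * (Real.pi - φ) :=
            mul_le_mul_of_nonneg_left (by linarith) (by positivity)
    calc β / 100 = (Real.sqrt β / 10) ^ 2 := by rw [div_pow, hbb]; norm_num
      _ ≤ Real.sin φ ^ 2 := pow_le_pow_left₀ (by positivity) hroot 2

/-! ### Uniformly random bijections and supersets -/

section
variable {α β : Type*} [Fintype α] [Fintype β] [DecidableEq α] [DecidableEq β]

/-- A uniformly random bijection maps a given set to a uniformly random set of the same size. -/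
lemma sum_equiv_map (A : Finset α) (f : Finset β → ℝ) :
    (∑ P : α ≃ β, f (A.map P.toEmbedding)) * (Fintype.card β).choose A.card =
      Fintype.card (α ≃ β) * ∑ J ∈ (Finset.univ : Finset β).powersetCard A.card, f J := by
  classical
  set cnt : Finset β → ℕ := fun J =>
    (Finset.univ.filter fun P : α ≃ β => A.map P.toEmbedding = J).card with hcnt
  have hmem : ∀ P : α ≃ β, A.map P.toEmbedding ∈
      (Finset.univ : Finset β).powersetCard A.card := fun P => by simp
  -- Composition with a permutation that carries `J` to `J'` injects one fibre into the other, so by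
  -- symmetry all fibres have the same size.
  have hconst : ∀ J ∈ (Finset.univ : Finset β).powersetCard A.card,
      ∀ J' ∈ (Finset.univ : Finset β).powersetCard A.card, cnt J ≤ cnt J' := by
    intro J hJ J' hJ'
    rw [Finset.mem_powersetCard] at hJ hJ'
    let e : {x // x ∈ J} ≃ {x // x ∈ J'} := Finset.equivOfCardEq (hJ.2.trans hJ'.2.symm)
    let σ : Equiv.Perm β := e.extendSubtype
    have hσ : J.map σ.toEmbedding = J' := by
      refine Finset.eq_of_subset_of_card_le ?_ (by rw [Finset.card_map, hJ.2, hJ'.2])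
      intro b hb
      obtain ⟨a, ha, rfl⟩ := Finset.mem_map.1 hb
      exact e.extendSubtype_mem a ha
    refine Finset.card_le_card_of_injOn (fun P => P.trans σ) ?_ ?_
    · intro P hP
      have hP' := (Finset.mem_filter.1 hP).2
      refine Finset.mem_coe.2 (Finset.mem_filter.2 ⟨Finset.mem_univ _, ?_⟩)
      rw [← hσ, ← hP', Finset.map_map]
      rfl
    · intro P _ P' _ h
      ext a
      exact σ.injective (Equiv.ext_iff.1 h a)
  have hsum : ∀ f : Finset β → ℝ, ∑ P : α ≃ β, f (A.map P.toEmbedding) =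
      ∑ J ∈ (Finset.univ : Finset β).powersetCard A.card, cnt J * f J := by
    intro f
    rw [← Finset.sum_fiberwise_of_maps_to (fun P _ => hmem P)]
    refine Finset.sum_congr rfl fun J _ => ?_
    rw [Finset.sum_congr rfl (g := fun _ => f J)
      (fun P hP => by rw [(Finset.mem_filter.1 hP).2]), Finset.sum_const, nsmul_eq_mul]
  have hcard := hsum fun _ => 1
  simp only [Finset.sum_const, Finset.card_univ, nsmul_eq_mul, mul_one] at hcard
  rw [hsum f, hcard, Finset.sum_mul, Finset.mul_sum]
  refine Finset.sum_congr rfl fun J hJ => ?_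
  have : ∑ J' ∈ (Finset.univ : Finset β).powersetCard A.card, (cnt J' : ℝ) =
      ∑ J' ∈ (Finset.univ : Finset β).powersetCard A.card, (cnt J : ℝ) :=
    Finset.sum_congr rfl fun J' hJ' => by
      rw [le_antisymm (hconst J' hJ' J hJ) (hconst J hJ J' hJ')]
  rw [this, Finset.sum_const, Finset.card_powersetCard, nsmul_eq_mul, Finset.card_univ]
  ring

omit [Fintype α] in
/-- The number of sets of a given size between two sets. -/
lemma card_powersetCard_superset {S U : Finset α} (hSU : S ⊆ U) {a : ℕ} (ha : S.card ≤ a) :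
    ((U.powersetCard a).filter fun J => S ⊆ J).card =
      (U.card - S.card).choose (a - S.card) := by
  rw [← Finset.card_sdiff_of_subset hSU, ← Finset.card_powersetCard]
  refine Finset.card_bij' (fun J _ => J \ S) (fun J _ => J ∪ S) ?_ ?_ ?_ ?_
  · intro J hJ
    obtain ⟨h1, h2⟩ := Finset.mem_filter.1 hJ
    rw [Finset.mem_powersetCard] at h1 ⊢
    exact ⟨Finset.sdiff_subset_sdiff h1.1 le_rfl, by rw [Finset.card_sdiff_of_subset h2, h1.2]⟩
  · intro J hJ
    rw [Finset.mem_powersetCard] at hJ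
    have hd : Disjoint J S := Finset.disjoint_of_subset_left hJ.1 Finset.sdiff_disjoint
    rw [Finset.mem_filter, Finset.mem_powersetCard]
    refine ⟨⟨Finset.union_subset (hJ.1.trans Finset.sdiff_subset) hSU, ?_⟩,
      Finset.subset_union_right⟩
    rw [Finset.card_union_of_disjoint hd, hJ.2]
    omega
  · intro J hJ
    exact Finset.sdiff_union_of_subset (Finset.mem_filter.1 hJ).2
  · intro J hJ
    rw [Finset.mem_powersetCard] at hJ
    have hd : Disjoint J S := Finset.disjoint_of_subset_left hJ.1 Finset.sdiff_disjoint
    rw [Finset.union_sdiff_right, sdiff_eq_left.2 hd]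

end

/-- Quotients of numbers of supersets. -/
lemma choose_sub_div_choose {n a w : ℕ} (hw : w ≤ a) (ha : a ≤ n) :
    ((n - w).choose (a - w) : ℝ) / n.choose a = (a.choose w : ℝ) / n.choose w := by
  have h := Nat.choose_mul (n := n) hw
  have h1 : (0 : ℝ) < n.choose a := by exact_mod_cast Nat.choose_pos ha
  have h2 : (0 : ℝ) < n.choose w := by exact_mod_cast Nat.choose_pos (hw.trans ha)
  rw [div_eq_div_iff h1.ne' h2.ne']
  have h' : (n.choose a : ℝ) * a.choose w = n.choose w * (n - w).choose (a - w) := by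
    exact_mod_cast h
  linarith

lemma goodProportion_pos {r κ w : ℕ} (hw : w ≤ r) : 0 < goodProportion r κ w := by
  have h1 : (0 : ℝ) < r.choose w := by exact_mod_cast Nat.choose_pos hw
  have h2 : (0 : ℝ) < (r + κ).choose w := by exact_mod_cast Nat.choose_pos (by omega)
  exact div_pos h1 h2

lemma goodProportion_le_one (r κ w : ℕ) : goodProportion r κ w ≤ 1 := by
  refine div_le_one_of_le₀ ?_ (Nat.cast_nonneg _)
  exact_mod_cast Nat.choose_le_choose w (Nat.le_add_right r κ)

/-- The proportion `q` is the share of `r`-sets that contain `w` given columns. So `t` marked sets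
form the share `βq` of all `r`-sets, where `β` is the fraction of the supersets that are marked, and
`le_sin_sq_amplified` applies. -/
lemma le_sin_angle_sq {r κ w t : ℕ} (hw : w ≤ r) (ht : t ≤ (r + κ - w).choose (r - w)) :
    (t : ℝ) / (r + κ - w).choose (r - w) / 100 ≤
      Real.sin (SearchCircuits.angle r κ w t) ^ 2 := by
  have h1 : (0 : ℝ) < (r + κ - w).choose (r - w) := by
    exact_mod_cast Nat.choose_pos (by omega)
  have h2 := le_sin_sq_amplified (goodProportion_pos (κ := κ) hw) (goodProportion_le_one r κ w)
    (β := (t : ℝ) / (r + κ - w).choose (r - w)) (by positivity)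
    ((div_le_one h1).2 (by exact_mod_cast ht))
  have h3 : (t : ℝ) / (r + κ - w).choose (r - w) * goodProportion r κ w =
      t / (r + κ).choose r := by
    rw [goodProportion, ← choose_sub_div_choose hw (Nat.le_add_right r κ)]
    field_simp
  rw [h3] at h2
  exact h2

/-! ### The success probability of a round and independent sets of columns -/

/-- The columns of `H` with numbers in `J` are linearly independent. -/
def IndepCols {r : ℕ} {ι : Type} [Fintype ι] (H : Matrix (Fin r) ι (ZMod 2)) (J : Finset ι) :
    Prop :=
  ∀ x : ι → ZMod 2, (∀ i ∉ J, x i = 0) → H.mulVec x = 0 → x = 0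

section
variable {r κ l n w : ℕ}

lemma solvesOn_unique {ι : Type} [Fintype ι] {H : Matrix (Fin r) ι (ZMod 2)} {s : Fin r → ZMod 2}
    {I : Finset ι} {y z : ι → ZMod 2} (hy : SolvesOn H s I y) (hz : SolvesOn H s I z) : z = y :=
  hy.2 z hz.1.1 hz.1.2

lemma hammingNorm_extend (P : Col r κ ⊕ Fin l ≃ Fin n) (y : Col r κ → ZMod 2) :
    hammingNorm (extend P y) = hammingNorm y := by
  rw [hammingNorm, hammingNorm]
  symm
  refine Finset.card_bij (fun c _ => P (Sum.inl c)) ?_ ?_ ?_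
  · intro c hc
    refine Finset.mem_filter.2 ⟨Finset.mem_univ _, ?_⟩
    simpa only [extend, P.symm_apply_apply, Sum.elim_inl] using (Finset.mem_filter.1 hc).2
  · intro c _ c' _ h
    exact Sum.inl_injective (P.injective h)
  · intro i hi
    have hi' := (Finset.mem_filter.1 hi).2
    rw [extend] at hi'
    rcases h : P.symm i with c | c
    · refine ⟨c, ?_, by rw [← h, P.apply_symm_apply]⟩
      rw [h] at hi'
      simpa using hi'
    · rw [h] at hi'
      simp at hi'

lemma mulVec_extend (H : Matrix (Fin r) (Fin n) (ZMod 2)) (P : Col r κ ⊕ Fin l ≃ Fin n)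
    (y : Col r κ → ZMod 2) : H.mulVec (extend P y) = (shortened H P).mulVec y := by
  ext i
  simp only [Matrix.mulVec, dotProduct]
  rw [← P.sum_comp, Fintype.sum_sum_type]
  simp [extend, shortened]

lemma extend_injective (P : Col r κ ⊕ Fin l ≃ Fin n) : Function.Injective (extend P) := by
  intro y z h
  ext c
  have := congrFun h (P (Sum.inl c))
  simpa [extend] using this

/-- The input of the search for the permutation `P`. -/
def reduced (H : Matrix (Fin r) (Fin n) (ZMod 2)) (s : Fin r → ZMod 2)
    (P : Col r κ ⊕ Fin l ≃ Fin n) : SearchInput r κ :=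
  ((shortened H P).toCols₁⁻¹ * (shortened H P).toCols₂, (shortened H P).toCols₁⁻¹.mulVec s)

/-- Multiplying by the invertible block of the first `r` columns, or by its inverse, passes between
the two systems. -/
lemma mulVec_systematic {H : Matrix (Fin r) (Fin n) (ZMod 2)} {s : Fin r → ZMod 2}
    {P : Col r κ ⊕ Fin l ≃ Fin n} (hB : IsUnit (shortened H P).toCols₁.det)
    (y : Col r κ → ZMod 2) :
    (systematic (reduced H s P).1).mulVec y = (reduced H s P).2 ↔ H.mulVec (extend P y) = s := by
  rw [mulVec_extend]
  have h1 : (shortened H P).toCols₁ * systematic (reduced H s P).1 = shortened H P := by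
    rw [systematic, Matrix.mul_fromCols, Matrix.mul_one, reduced, ← Matrix.mul_assoc,
      Matrix.mul_nonsing_inv _ hB, Matrix.one_mul, Matrix.fromCols_toCols]
  constructor
  · intro h
    rw [← h1, ← Matrix.mulVec_mulVec, h, reduced, Matrix.mulVec_mulVec,
      Matrix.mul_nonsing_inv _ hB, Matrix.one_mulVec]
  · intro h
    have h2 : (reduced H s P).2 = (shortened H P).toCols₁⁻¹.mulVec ((shortened H P).mulVec y) := by
      rw [h]
      rfl
    have h3 : (shortened H P).mulVec y =
        (shortened H P).toCols₁.mulVec ((systematic (reduced H s P).1).mulVec y) := by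
      rw [Matrix.mulVec_mulVec, h1]
    rw [h2, h3, Matrix.mulVec_mulVec _ (shortened H P).toCols₁⁻¹,
      Matrix.nonsing_inv_mul _ hB, Matrix.one_mulVec]

variable (D : SearchCircuits r κ w) (H : Matrix (Fin r) (Fin n) (ZMod 2)) (s : Fin r → ZMod 2)

/-- The number of marked sets for the permutation `P`. -/
def markedCount (w : ℕ) (P : Col r κ ⊕ Fin l ≃ Fin n) : ℕ :=
  (SearchCircuits.markedSets w (reduced H s P)).card

lemma roundProb_nonneg (x : Fin n → ZMod 2) : 0 ≤ roundProb D l H s x := by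
  refine div_nonneg (Finset.sum_nonneg fun P _ => Finset.sum_nonneg fun I _ => ?_)
    (Nat.cast_nonneg _)
  dsimp only
  split_ifs
  · exact D.measureProb_nonneg (reduced H s P) I
  · exact le_rfl

lemma roundProb_of_not_isSolution {x : Fin n → ZMod 2} (hx : ¬ IsSolution H s w x) :
    roundProb D l H s x = 0 := by
  rw [roundProb, Finset.sum_eq_zero, zero_div]
  intro P _
  refine Finset.sum_eq_zero fun I _ => ?_
  dsimp only
  rw [if_neg (fun h => hx h.2.1)]

/-- The success probability of a round in terms of the numbers of marked sets. -/
lemma successProb_eq : successProb D l H s = (∑ P : Col r κ ⊕ Fin l ≃ Fin n, open Classical in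
    if IsUnit (shortened H P).toCols₁.det then
      Real.sin (SearchCircuits.angle r κ w (markedCount H s w P)) ^ 2 else 0) /
    Fintype.card (Col r κ ⊕ Fin l ≃ Fin n) := by
  classical
  simp only [successProb, roundProb]
  rw [← Finset.sum_div]
  congr 1
  rw [Finset.sum_comm]
  refine Finset.sum_congr rfl fun P _ => ?_
  rw [Finset.sum_comm]
  split_ifs with hB
  · rw [markedCount, ← D.sum_markedSets_measureProb, SearchCircuits.markedSets, Finset.sum_filter]
    have hsub : ∑ I ∈ columnSets r κ, (if Marked (reduced H s P).1 (reduced H s P).2 w I then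
        D.measureProb (reduced H s P).1 (reduced H s P).2 I else 0) =
        ∑ I, (if Marked (reduced H s P).1 (reduced H s P).2 w I then
        D.measureProb (reduced H s P).1 (reduced H s P).2 I else 0) := by
      refine Finset.sum_subset (Finset.subset_univ _) fun I _ hI => ?_
      rw [D.measureProb_eq, if_neg hI]
      simp
    refine Eq.trans ?_ hsub.symm
    refine Finset.sum_congr rfl fun I _ => ?_
    -- For fixed `P` and `I` the test on the returned vector is the test on the weight of `y`, since
    -- extension by zero preserves weight and syndrome.
    have hcond : ∀ x, (IsUnit (shortened H P).toCols₁.det ∧ IsSolution H s w x ∧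
        ∃ y, SolvesOn (systematic (reduced H s P).1) (reduced H s P).2 I y ∧ x = extend P y) ↔
        ∃ y, SolvesOn (systematic (reduced H s P).1) (reduced H s P).2 I y ∧
          hammingNorm y = w ∧ x = extend P y := by
      intro x
      constructor
      · rintro ⟨-, h1, y, h2, rfl⟩
        exact ⟨y, h2, by rw [← hammingNorm_extend P, h1.1], rfl⟩
      · rintro ⟨y, h1, h2, rfl⟩
        exact ⟨hB, ⟨by rw [hammingNorm_extend, h2], (mulVec_systematic hB y).1 h1.1.2⟩, y, h1, rfl⟩
    split_ifs with hM
    -- Unique solvability makes the output a function of `P` and `I`, so the sum over all outputs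
    -- has a single nonzero term.
    · obtain ⟨y, hy, hyw⟩ := hM
      rw [Finset.sum_eq_single (extend P y)]
      · exact if_pos ((hcond _).2 ⟨y, hy, hyw, rfl⟩)
      · intro x _ hx
        refine if_neg fun h => ?_
        obtain ⟨z, hz, -, rfl⟩ := (hcond _).1 h
        exact hx (by rw [solvesOn_unique hy hz])
      · simp
    · refine Finset.sum_eq_zero fun x _ => if_neg fun h => ?_
      obtain ⟨y, hy, hyw, -⟩ := (hcond _).1 h
      exact hM ⟨y, hy, hyw⟩
  · refine Finset.sum_eq_zero fun I _ => Finset.sum_eq_zero fun x _ => ?_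
    rw [if_neg fun h => hB h.1]

lemma successProb_nonneg : 0 ≤ successProb D l H s :=
  Finset.sum_nonneg fun x _ => roundProb_nonneg D H s x

lemma successProb_le_one : successProb D l H s ≤ 1 := by
  rw [successProb_eq]
  refine div_le_one_of_le₀ ?_ (Nat.cast_nonneg _)
  refine (Finset.sum_le_card_nsmul _ _ 1 fun P _ => ?_).trans (by simp)
  split_ifs
  · exact Real.sin_sq_le_one _
  · exact zero_le_one

lemma geometric_one_sub {p : ℝ} (h0 : 0 ≤ p) (h1 : p ≤ 1) :
    ∑' i : ℕ, ENNReal.ofReal (1 - p) ^ i = (ENNReal.ofReal p)⁻¹ := by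
  rw [ENNReal.tsum_geometric, ENNReal.ofReal_sub _ h0, ENNReal.ofReal_one,
    ENNReal.sub_sub_cancel ENNReal.one_ne_top (ENNReal.ofReal_le_one.2 h1)]

lemma solves_of_pos (hp : 0 < successProb D l H s) : Solves D l H s := by
  have h1 : ∀ x, (open Classical in if IsSolution H s w x then returnProb D l H s x else 0) =
      (ENNReal.ofReal (successProb D l H s))⁻¹ * ENNReal.ofReal (roundProb D l H s x) := by
    intro x
    split_ifs with hx
    · rw [returnProb, ENNReal.tsum_mul_right,
        geometric_one_sub (successProb_nonneg D H s) (successProb_le_one D H s)]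
    · rw [roundProb_of_not_isSolution D H s hx]
      simp
  rw [Solves, Finset.sum_congr rfl fun x _ => h1 x, ← Finset.mul_sum,
    ← ENNReal.ofReal_sum_of_nonneg fun x _ => roundProb_nonneg D H s x]
  exact ENNReal.inv_mul_cancel (by simpa using hp) ENNReal.ofReal_ne_top

lemma expectedTime_of_pos (c : ℕ) (hp : 0 < successProb D l H s) :
    expectedTime D c l H s ≠ ⊤ ∧
      (expectedTime D c l H s).toReal = (D.amplified.cost + c : ℕ) / successProb D l H s := by
  have h1 : expectedTime D c l H s =
      (ENNReal.ofReal (successProb D l H s))⁻¹ * ((D.amplified.cost + c : ℕ) : ℝ≥0∞) := by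
    rw [expectedTime, ENNReal.tsum_mul_right,
      geometric_one_sub (successProb_nonneg D H s) (successProb_le_one D H s)]
  constructor
  · rw [h1]
    exact ENNReal.mul_ne_top (ENNReal.inv_ne_top.2 (by simpa using hp)) (ENNReal.natCast_ne_top _)
  · rw [h1, ENNReal.toReal_mul, ENNReal.toReal_inv, ENNReal.toReal_ofReal hp.le,
      ENNReal.toReal_natCast]
    field_simp

variable {H s} {e : Fin n → ZMod 2}

/-- The support of a vector. -/
def supp {ι : Type*} [Fintype ι] (e : ι → ZMod 2) : Finset ι := Finset.univ.filter fun i => e i ≠ 0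

lemma card_supp {ι : Type*} [Fintype ι] (e : ι → ZMod 2) : (supp e).card = hammingNorm e := rfl

/-- The positions of the columns `I` after the permutation `P`. -/
def positions (P : Col r κ ⊕ Fin l ≃ Fin n) (I : Finset (Col r κ)) : Finset (Fin n) :=
  (I.map Function.Embedding.inl).map P.toEmbedding

lemma mem_positions {P : Col r κ ⊕ Fin l ≃ Fin n} {I : Finset (Col r κ)} {i : Fin n} :
    i ∈ positions P I ↔ ∃ c ∈ I, P (Sum.inl c) = i := by
  simp only [positions, Finset.mem_map, exists_exists_and_eq_and]
  rfl

lemma apply_mem_positions {P : Col r κ ⊕ Fin l ≃ Fin n} {I : Finset (Col r κ)} {c : Col r κ} :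
    P (Sum.inl c) ∈ positions P I ↔ c ∈ I := by
  rw [mem_positions]
  constructor
  · rintro ⟨c', hc', h⟩
    rwa [← Sum.inl_injective (P.injective h)]
  · exact fun h => ⟨c, h, rfl⟩

/-- A marked set yields a solution of the original instance supported on its positions, and by
uniqueness this solution is `e`. -/
lemma exists_of_marked (huniq : ∀ x, IsSolution H s w x → x = e) {P : Col r κ ⊕ Fin l ≃ Fin n}
    (hB : IsUnit (shortened H P).toCols₁.det) {I : Finset (Col r κ)}
    (hI : I ∈ SearchCircuits.markedSets w (reduced H s P)) :
    I.card = r ∧ supp e ⊆ positions P I := by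
  classical
  rw [SearchCircuits.markedSets, Finset.mem_filter, Finset.mem_powersetCard] at hI
  obtain ⟨⟨-, hcard⟩, y, hy, hyw⟩ := hI
  refine ⟨hcard, fun i hi => ?_⟩
  have he : extend P y = e := huniq _
    ⟨by rw [hammingNorm_extend, hyw], (mulVec_systematic hB y).1 hy.1.2⟩
  have hi' := (Finset.mem_filter.1 hi).2
  rw [← he, extend] at hi'
  rcases h : P.symm i with c | c
  · rw [h] at hi'
    refine mem_positions.2 ⟨c, ?_, by rw [← h, P.apply_symm_apply]⟩
    by_contra hc
    exact hi' (hy.1.1 c hc)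
  · rw [h] at hi'
    simp at hi'

/-- The restriction of `e` solves the system, and independence of the columns excludes every other
solution on `I`. -/
lemma mem_markedSets (he : IsSolution H s w e) {P : Col r κ ⊕ Fin l ≃ Fin n}
    (hB : IsUnit (shortened H P).toCols₁.det) {I : Finset (Col r κ)} (hI : I.card = r)
    (hS : supp e ⊆ positions P I) (hind : IndepCols H (positions P I)) :
    I ∈ SearchCircuits.markedSets w (reduced H s P) := by
  classical
  rw [SearchCircuits.markedSets, Finset.mem_filter, Finset.mem_powersetCard]
  refine ⟨⟨Finset.subset_univ _, hI⟩, ?_⟩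
  set y : Col r κ → ZMod 2 := fun c => e (P (Sum.inl c)) with hy
  have hzero : ∀ i ∉ positions P I, e i = 0 := fun i hi => by
    by_contra h
    exact hi (hS (Finset.mem_filter.2 ⟨Finset.mem_univ _, h⟩))
  have hext : extend P y = e := by
    ext i
    rw [extend]
    rcases h : P.symm i with c | c
    · simp only [Sum.elim_inl, hy]
      rw [← h, P.apply_symm_apply]
    · simp only [Sum.elim_inr, Pi.zero_apply]
      rw [hzero]
      intro hi
      obtain ⟨c', _, hc'⟩ := mem_positions.1 hi
      rw [← hc', P.symm_apply_apply] at h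
      exact Sum.inl_ne_inr h
  refine ⟨y, ⟨⟨fun c hc => hzero _ fun h => hc (apply_mem_positions.1 h),
    (mulVec_systematic hB y).2 (by rw [hext, he.2])⟩, fun z hz hz' => ?_⟩,
    by rw [← hammingNorm_extend P, hext, he.1]⟩
  apply extend_injective P
  rw [hext]
  rw [mulVec_systematic hB] at hz'
  rw [← sub_eq_zero]
  refine hind _ (fun i hi => ?_) (by rw [Matrix.mulVec_sub, hz', he.2, sub_self])
  rw [Pi.sub_apply, hzero i hi, sub_zero, extend]
  rcases h : P.symm i with c | c
  · refine hz c fun hc => hi (mem_positions.2 ⟨c, hc, by rw [← h, P.apply_symm_apply]⟩)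
  · rfl

/-- The columns of the identity matrix. -/
def identityCols (r κ : ℕ) : Finset (Col r κ) := Finset.univ.map Function.Embedding.inl

lemma isUnit_det_of_indepCols {P : Col r κ ⊕ Fin l ≃ Fin n}
    (h : IndepCols H (positions P (identityCols r κ))) :
    IsUnit (shortened H P).toCols₁.det := by
  rw [← Matrix.isUnit_iff_isUnit_det, ← Matrix.mulVec_injective_iff_isUnit]
  rw [← Matrix.coe_mulVecLin, ← LinearMap.ker_eq_bot, LinearMap.ker_eq_bot']
  intro z hz
  have h1 := h (extend P (Sum.elim z 0)) (by
    intro i hi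
    rw [extend]
    rcases h : P.symm i with (c | c) | c
    · exact absurd (mem_positions.2 ⟨Sum.inl c, by simp [identityCols],
        by rw [← h, P.apply_symm_apply]⟩) hi
    · rfl
    · rfl) (by
    rw [mulVec_extend, ← Matrix.fromCols_toCols (shortened H P), Matrix.fromCols_mulVec]
    simpa using hz)
  ext c
  have h2 := congrFun h1 (P (Sum.inl (Sum.inl c)))
  simpa [extend] using h2

lemma card_equiv_pos (hn : r + κ + l = n) :
    0 < Fintype.card (Col r κ ⊕ Fin l ≃ Fin n) := by
  rw [Fintype.card_pos_iff]
  exact ⟨(Fintype.equivFinOfCardEq (by simp [hn]))⟩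

/-- The kept positions form a uniformly random set of size `r + κ`, so this is the proportion of
such sets that contain `S`. -/
lemma card_filter_supp_positions (hn : r + κ + l = n) {S : Finset (Fin n)} (hS : S.card = w)
    (hw : w ≤ r + κ) :
    ((Finset.univ.filter fun P : Col r κ ⊕ Fin l ≃ Fin n =>
      S ⊆ positions P Finset.univ).card : ℝ) =
      Fintype.card (Col r κ ⊕ Fin l ≃ Fin n) * ((r + κ).choose w / n.choose w) := by
  classical
  have h := sum_equiv_map (β := Fin n) ((Finset.univ : Finset (Col r κ)).map
    (Function.Embedding.inl : Col r κ ↪ Col r κ ⊕ Fin l)) fun J => if S ⊆ J then 1 else 0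
  rw [Finset.sum_boole, Finset.sum_boole, card_powersetCard_superset (Finset.subset_univ S)
    (by simp [hS]; exact hw)] at h
  simp only [Finset.card_map, Finset.card_univ, Fintype.card_sum, Fintype.card_fin, hS] at h
  have h1 : (0 : ℝ) < n.choose (r + κ) := by exact_mod_cast Nat.choose_pos (by omega)
  rw [← choose_sub_div_choose hw (by omega : r + κ ≤ n)]
  rw [← mul_div_assoc, eq_div_iff h1.ne', ← h]
  rfl

/-- If the permutation moves some error position out of the kept part, no set is marked, the angle
is zero and the round fails. For the other permutations the trivial bound `sin² ≤ 1` suffices. -/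
lemma successProb_le (hn : r + κ + l = n) (hw : w ≤ r + κ) (hew : hammingNorm e = w)
    (huniq : ∀ x, IsSolution H s w x → x = e) :
    successProb D l H s ≤ ((r + κ).choose w : ℝ) / n.choose w := by
  classical
  have hpos : (0 : ℝ) < Fintype.card (Col r κ ⊕ Fin l ≃ Fin n) := by
    exact_mod_cast card_equiv_pos hn
  rw [successProb_eq, div_le_iff₀ hpos, mul_comm,
    ← card_filter_supp_positions hn (S := supp e) (by rw [card_supp, hew]) hw, ← Finset.sum_boole]
  refine Finset.sum_le_sum fun P _ => ?_
  by_cases hS : supp e ⊆ positions P Finset.univ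
  · rw [if_pos hS]
    split_ifs
    · exact Real.sin_sq_le_one _
    · exact zero_le_one
  · rw [if_neg hS]
    split_ifs with hB
    · have : markedCount H s w P = 0 := by
        rw [markedCount, Finset.card_eq_zero, Finset.eq_empty_iff_forall_notMem]
        intro I hI
        refine hS ((exists_of_marked huniq hB hI).2.trans fun i hi => ?_)
        obtain ⟨c, _, rfl⟩ := mem_positions.1 hi
        exact mem_positions.2 ⟨c, Finset.mem_univ _, rfl⟩
      rw [this]
      simp [SearchCircuits.angle]
    · exact le_rfl

lemma card_filter_positions {P : Col r κ ⊕ Fin l ≃ Fin n} {S : Finset (Fin n)} {a : ℕ}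
    (p : Finset (Fin n) → Prop)
    [DecidablePred p] :
    (((Finset.univ : Finset (Col r κ)).powersetCard a).filter fun I =>
      S ⊆ positions P I ∧ p (positions P I)).card =
    (((positions P Finset.univ).powersetCard a).filter fun J => S ⊆ J ∧ p J).card := by
  have hmono : ∀ I, positions P I ⊆ positions P Finset.univ := fun I => by
    rw [positions, positions, Finset.map_subset_map, Finset.map_subset_map]
    exact Finset.subset_univ _
  refine Finset.card_bij (fun I _ => positions P I) ?_ ?_ ?_
  · intro I hI
    rw [Finset.mem_filter, Finset.mem_powersetCard] at hI ⊢
    exact ⟨⟨hmono I, by simpa [positions] using hI.1.2⟩, hI.2⟩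
  · intro I _ J _ h
    exact Finset.map_injective _ (Finset.map_injective _ h)
  · intro J hJ
    rw [Finset.mem_filter, Finset.mem_powersetCard] at hJ
    have hJ' : positions P (Finset.univ.filter fun c => P (Sum.inl c) ∈ J) = J := by
      ext i
      rw [mem_positions]
      constructor
      · rintro ⟨c, hc, rfl⟩
        exact (Finset.mem_filter.1 hc).2
      · intro hi
        obtain ⟨c, _, rfl⟩ := mem_positions.1 (hJ.1.1 hi)
        exact ⟨c, Finset.mem_filter.2 ⟨Finset.mem_univ _, hi⟩, rfl⟩
    refine ⟨_, ?_, hJ'⟩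
    rw [Finset.mem_filter, Finset.mem_powersetCard, hJ']
    refine ⟨⟨Finset.subset_univ _, ?_⟩, hJ.2⟩
    rw [← hJ.1.2]
    conv_rhs => rw [← hJ']
    simp [positions]

/-- The number of linearly independent sets of `a` columns between `S` and `U`. -/
def indepCount (H : Matrix (Fin r) (Fin n) (ZMod 2)) (S U : Finset (Fin n)) (a : ℕ) : ℕ :=
  open Classical in ((U.powersetCard a).filter fun J => S ⊆ J ∧ IndepCols H J).card

/-- Marked sets lie between the support of `e` and the kept positions. The bound says that the
fraction `β` in `le_sin_angle_sq` is at most one. -/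
lemma markedCount_le (hw : w ≤ r) (hew : hammingNorm e = w)
    (huniq : ∀ x, IsSolution H s w x → x = e) {P : Col r κ ⊕ Fin l ≃ Fin n}
    (hB : IsUnit (shortened H P).toCols₁.det) (hS : supp e ⊆ positions P Finset.univ) :
    markedCount H s w P ≤ (r + κ - w).choose (r - w) := by
  classical
  have h1 : ((positions P (Finset.univ : Finset (Col r κ))).powersetCard r).filter
      (fun J => supp e ⊆ J) = ((positions P (Finset.univ : Finset (Col r κ))).powersetCard r).filter
      (fun J => supp e ⊆ J ∧ True) := by simp
  have h2 := card_powersetCard_superset hS (a := r) (by rw [card_supp, hew]; exact hw)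
  have h3 : (positions P (Finset.univ : Finset (Col r κ))).card = r + κ := by simp [positions]
  rw [card_supp, hew, h3, h1] at h2
  refine le_trans (Finset.card_le_card fun I hI => ?_)
    (le_of_eq ((card_filter_positions (S := supp e) (a := r) fun _ => True).trans h2))
  obtain ⟨h4, h5⟩ := exists_of_marked huniq hB hI
  exact Finset.mem_filter.2 ⟨Finset.mem_powersetCard.2 ⟨Finset.subset_univ _, h4⟩, h5, trivial⟩

lemma indepCount_le_markedCount (he : IsSolution H s w e) {P : Col r κ ⊕ Fin l ≃ Fin n}
    (hB : IsUnit (shortened H P).toCols₁.det) :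
    indepCount H (supp e) (positions P Finset.univ) r ≤ markedCount H s w P := by
  classical
  rw [indepCount, ← card_filter_positions, markedCount]
  refine Finset.card_le_card fun I hI => ?_
  rw [Finset.mem_filter, Finset.mem_powersetCard] at hI
  exact mem_markedSets he hB hI.1.2 hI.2.1 hI.2.2

/-- A lower bound for the success probability in terms of independent sets of columns. -/
lemma le_successProb (hw : w ≤ r) (he : IsSolution H s w e)
    (huniq : ∀ x, IsSolution H s w x → x = e) :
    (∑ P : Col r κ ⊕ Fin l ≃ Fin n, open Classical in
      if supp e ⊆ positions P Finset.univ ∧ IndepCols H (positions P (identityCols r κ)) then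
        (indepCount H (supp e) (positions P Finset.univ) r : ℝ) /
          (r + κ - w).choose (r - w) / 100 else 0) /
      Fintype.card (Col r κ ⊕ Fin l ≃ Fin n) ≤ successProb D l H s := by
  classical
  rw [successProb_eq]
  refine div_le_div_of_nonneg_right (Finset.sum_le_sum fun P _ => ?_) (Nat.cast_nonneg _)
  split_ifs with h1 hB hB
  · refine le_trans ?_ (le_sin_angle_sq hw (markedCount_le hw he.1 huniq hB h1.1))
    gcongr
    exact indepCount_le_markedCount he hB
  · exact absurd (isUnit_det_of_indepCols h1.2) hB
  · positivity
  · exact le_rfl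

end

/-! ### Frequencies -/

/-- The relative frequency of a property in a finite type. -/
def freq {V : Type*} (p : V → Prop) : ℝ := (Nat.card {v : V // p v} : ℝ) / Nat.card V

section
variable {V : Type*} [Fintype V]

lemma natCard_subtype (p : V → Prop) [DecidablePred p] :
    Nat.card {v // p v} = (Finset.univ.filter p).card := by
  rw [Nat.card_eq_fintype_card, Fintype.card_subtype]

lemma freq_eq (p : V → Prop) [DecidablePred p] :
    freq p = ((Finset.univ.filter p).card : ℝ) / Fintype.card V := by
  rw [freq, natCard_subtype, Nat.card_eq_fintype_card]

lemma freq_mono {p q : V → Prop} (h : ∀ v, p v → q v) : freq p ≤ freq q := by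
  classical
  rw [freq_eq, freq_eq]
  gcongr with v
  exact h v

lemma freq_exists_le {ι : Type*} (s : Finset ι) (p : ι → V → Prop) :
    freq (fun v => ∃ i ∈ s, p i v) ≤ ∑ i ∈ s, freq (p i) := by
  classical
  simp only [freq_eq]
  rw [← Finset.sum_div]
  gcongr
  have : (Finset.univ.filter fun v => ∃ i ∈ s, p i v) = s.biUnion fun i =>
      Finset.univ.filter (p i) := by
    ext v
    simp
  rw [this]
  exact_mod_cast Finset.card_biUnion_le

lemma freq_or_le (p q : V → Prop) : freq (fun v => p v ∨ q v) ≤ freq p + freq q := by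
  classical
  rw [freq_eq, freq_eq, freq_eq, ← add_div]
  gcongr
  rw [Finset.filter_or]
  exact_mod_cast Finset.card_union_le _ _

lemma freq_add_freq_not [Nonempty V] (p : V → Prop) : freq p + freq (fun v => ¬ p v) = 1 := by
  classical
  rw [freq_eq, freq_eq, ← add_div, ← Nat.cast_add, Finset.card_filter_add_card_filter_not,
    Finset.card_univ]
  exact div_self (by exact_mod_cast Fintype.card_ne_zero)

/-- Markov's inequality for the number of properties that hold. -/
lemma freq_half_lt_le [Nonempty V] {ι : Type*} (s : Finset ι) (p : ι → V → Prop) {η : ℝ}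
    (hη : 0 ≤ η) (h : ∀ i ∈ s, freq (p i) ≤ η) :
    freq (fun v => open Classical in (s.card : ℝ) / 2 < (s.filter fun i => p i v).card) ≤
      2 * η := by
  classical
  have hV : (0 : ℝ) < Fintype.card V := by exact_mod_cast Fintype.card_pos
  rcases s.eq_empty_or_nonempty with rfl | hs
  · have : freq (fun _ : V => False) = 0 := by rw [freq_eq]; simp
    simp only [Finset.card_empty, Nat.cast_zero, zero_div, Finset.filter_empty, lt_self_iff_false]
    rw [this]
    positivity
  · have hs' : (0 : ℝ) < s.card := by exact_mod_cast hs.card_pos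
    have h1 : ∑ v : V, ((s.filter fun i => p i v).card : ℝ) ≤ s.card * (η * Fintype.card V) := by
      -- Double counting of the pairs of an element and a property that it has.
      have h2 : ∑ v : V, ((s.filter fun i => p i v).card : ℝ) =
          ∑ i ∈ s, ((Finset.univ.filter fun v => p i v).card : ℝ) := by
        simp only [← Finset.sum_boole]
        exact Finset.sum_comm
      rw [h2]
      refine (Finset.sum_le_card_nsmul _ _ (η * Fintype.card V) fun i hi => ?_).trans (by simp)
      have := h i hi
      rwa [freq_eq, div_le_iff₀ hV] at this
    have h3 : ((Finset.univ.filter fun v : V =>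
        (s.card : ℝ) / 2 < (s.filter fun i => p i v).card).card : ℝ) * (s.card / 2) ≤
        ∑ v : V, ((s.filter fun i => p i v).card : ℝ) := by
      rw [← nsmul_eq_mul]
      refine (Finset.card_nsmul_le_sum _ (fun v => ((s.filter fun i => p i v).card : ℝ)) _
        fun v hv => (Finset.mem_filter.1 hv).2.le).trans ?_
      exact Finset.sum_le_sum_of_subset_of_nonneg (Finset.subset_univ _)
        fun _ _ _ => Nat.cast_nonneg _
    rw [freq_eq, div_le_iff₀ hV]
    have h4 := h3.trans h1
    have h5 : (2 * η * Fintype.card V) * ((s.card : ℝ) / 2) = s.card * (η * Fintype.card V) := by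
      ring
    rw [← h5] at h4
    exact le_of_mul_le_mul_right h4 (by positivity)

end

/-- A surjective homomorphism maps the uniform distribution to the uniform distribution. -/
lemma freq_comp {V U : Type*} [Fintype V] [Fintype U] [AddCommGroup V] [AddCommGroup U]
    (f : V →+ U) (hf : Function.Surjective f) (p : U → Prop) :
    freq (fun v => p (f v)) = freq p := by
  classical
  set k := (Finset.univ.filter fun v => f v = 0).card with hk
  -- The fibres are the cosets of the kernel.
  have hfib : ∀ u, (Finset.univ.filter fun v => f v = u).card = k := by
    intro u
    obtain ⟨v0, rfl⟩ := hf u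
    refine Finset.card_bij' (fun v _ => v - v0) (fun v _ => v + v0) ?_ ?_ ?_ ?_ <;> simp
    intro a ha
    rw [ha, sub_self]
  have h1 : ∀ q : U → Prop, (Finset.univ.filter fun v => q (f v)).card =
      (Finset.univ.filter q).card * k := by
    intro q
    rw [Finset.card_eq_sum_card_fiberwise (f := f) (t := Finset.univ.filter q)
      (fun v hv => by simpa using hv)]
    rw [Finset.sum_congr rfl (g := fun _ => k), Finset.sum_const, smul_eq_mul]
    intro u hu
    rw [← hfib u, Finset.filter_filter]
    congr 1
    ext v
    simp only [Finset.mem_filter, Finset.mem_univ, true_and, and_iff_right_iff_imp]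
    rintro rfl
    exact (Finset.mem_filter.1 hu).2
  have hkpos : (0 : ℝ) < k := by
    have : 0 < k := Finset.card_pos.2 ⟨0, by simp⟩
    exact_mod_cast this
  have h2 := h1 fun _ => True
  simp only [Finset.filter_true, Finset.card_univ] at h2
  rw [freq_eq, freq_eq, h1 p, h2]
  push_cast
  rw [mul_div_mul_right _ _ hkpos.ne']

/-! ### Uniformly random binary matrices -/

section
variable {r n : ℕ}

/-- For `x ≠ 0` the homomorphism `H ↦ H x` is onto, so `H x` is uniformly distributed. -/
lemma freq_mulVec_eq_zero {x : Fin n → ZMod 2} (hx : x ≠ 0) :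
    freq (fun H : Matrix (Fin r) (Fin n) (ZMod 2) => H.mulVec x = 0) = 1 / 2 ^ r := by
  classical
  obtain ⟨j, hj⟩ := Function.ne_iff.1 hx
  have hj1 : x j = 1 := (zmod_two_cases (x j)).resolve_left hj
  let f : Matrix (Fin r) (Fin n) (ZMod 2) →+ (Fin r → ZMod 2) :=
    { toFun := fun H => H.mulVec x
      map_zero' := Matrix.zero_mulVec x
      map_add' := fun A B => Matrix.add_mulVec A B x }
  have hf : Function.Surjective f := by
    intro u
    refine ⟨Matrix.of fun i j' => if j' = j then u i else 0, ?_⟩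
    ext i
    simp [f, Matrix.mulVec, dotProduct, hj1]
  have h := freq_comp f hf fun u => u = 0
  refine h.trans ?_
  rw [freq_eq]
  simp [Finset.filter_eq']

lemma freq_vecMul {u : Fin r → ZMod 2} (hu : u ≠ 0) (p : (Fin n → ZMod 2) → Prop) :
    freq (fun H : Matrix (Fin r) (Fin n) (ZMod 2) => p (Matrix.vecMul u H)) = freq p := by
  classical
  obtain ⟨i, hi⟩ := Function.ne_iff.1 hu
  have hi1 : u i = 1 := (zmod_two_cases (u i)).resolve_left hi
  let f : Matrix (Fin r) (Fin n) (ZMod 2) →+ (Fin n → ZMod 2) :=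
    { toFun := fun H => Matrix.vecMul u H
      map_zero' := Matrix.vecMul_zero u
      map_add' := fun A B => Matrix.vecMul_add A B u }
  have hf : Function.Surjective f := by
    intro x
    refine ⟨Matrix.of fun i' j => if i' = i then x j else 0, ?_⟩
    ext j
    simp [f, Matrix.vecMul, dotProduct, hi1]
  exact freq_comp f hf p

/-- A rank deficit means that a nonzero combination of the rows vanishes. Each combination is
uniformly distributed; the union bound runs over fewer than `2 ^ r` of them. -/
lemma freq_rank_ne_le :
    freq (fun H : Matrix (Fin r) (Fin n) (ZMod 2) => H.rank ≠ r) ≤ 2 ^ r / 2 ^ n := by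
  classical
  have h1 : ∀ H : Matrix (Fin r) (Fin n) (ZMod 2), H.rank ≠ r →
      ∃ u ∈ (Finset.univ.filter fun u : Fin r → ZMod 2 => u ≠ 0), Matrix.vecMul u H = 0 := by
    intro H hH
    by_contra hcon
    apply hH
    have hinj : Function.Injective H.vecMul := by
      intro u v huv
      by_contra hne
      refine hcon ⟨u - v, ?_, ?_⟩
      · simpa [sub_eq_zero] using hne
      · rw [Matrix.sub_vecMul]
        exact sub_eq_zero.2 huv
    rw [Matrix.vecMul_injective_iff] at hinj
    simpa using hinj.rank_matrix
  refine (freq_mono h1).trans ((freq_exists_le _ _).trans ?_)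
  refine (Finset.sum_le_card_nsmul _ _ ((1 : ℝ) / 2 ^ n) fun u hu => ?_).trans ?_
  · have h2 := freq_vecMul (n := n) (Finset.mem_filter.1 hu).2 fun x => x = 0
    refine le_of_eq (h2.trans ?_)
    rw [freq_eq]
    simp [Finset.filter_eq']
  · rw [nsmul_eq_mul, mul_one_div]
    gcongr
    have : ((Finset.univ : Finset (Fin r → ZMod 2)).card : ℝ) = 2 ^ r := by simp
    rw [← this]
    exact_mod_cast Finset.card_filter_le _ _

/-- Properties of uniformly random matrices and of uniformly random parity-check matrices. -/
lemma le_proportion (hrn : r < n) (p : Matrix (Fin r) (Fin n) (ZMod 2) → Prop) {η : ℝ}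
    (h : freq (fun H : Matrix (Fin r) (Fin n) (ZMod 2) => ¬ p H) ≤ η)
    {q : ParityCheck r n → Prop} (hq : ∀ H : ParityCheck r n, p H.1 → q H) :
    1 - 2 * η ≤ proportion q := by
  classical
  have hM : (0 : ℝ) < Fintype.card (Matrix (Fin r) (Fin n) (ZMod 2)) := by
    exact_mod_cast Fintype.card_pos
  -- Because `r < n`, at least half of all matrices have full rank. Conditioning on full rank
  -- therefore at most doubles the probability of the exceptional event.
  have hrank : (Fintype.card (Matrix (Fin r) (Fin n) (ZMod 2)) : ℝ) / 2 ≤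
      Fintype.card (ParityCheck r n) := by
    have h1 := freq_rank_ne_le (r := r) (n := n)
    have h2 := freq_add_freq_not fun H : Matrix (Fin r) (Fin n) (ZMod 2) => H.rank = r
    have h3 : (2 : ℝ) ^ r / 2 ^ n ≤ 1 / 2 := by
      rw [div_le_div_iff₀ (by positivity) (by positivity), one_mul, ← pow_succ]
      exact pow_le_pow_right₀ (by norm_num) hrn
    have h4 : 1 / 2 ≤ freq fun H : Matrix (Fin r) (Fin n) (ZMod 2) => H.rank = r := by
      have h5 : freq (fun H : Matrix (Fin r) (Fin n) (ZMod 2) => ¬ H.rank = r) ≤ 1 / 2 :=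
        h1.trans h3
      linarith
    rw [freq, Nat.card_eq_fintype_card, Nat.card_eq_fintype_card, le_div_iff₀ hM] at h4
    linarith
  have hP : (0 : ℝ) < Fintype.card (ParityCheck r n) := by linarith
  have : Nonempty (ParityCheck r n) := Fintype.card_pos_iff.1 (by exact_mod_cast hP)
  have hbad : freq (fun H : ParityCheck r n => ¬ q H) ≤ 2 * η := by
    rw [freq_eq, div_le_iff₀ hP]
    rw [freq_eq, div_le_iff₀ hM] at h
    have h6 : ((Finset.univ.filter fun H : ParityCheck r n => ¬ q H).card : ℝ) ≤
        (Finset.univ.filter fun H : Matrix (Fin r) (Fin n) (ZMod 2) => ¬ p H).card := by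
      rw [Nat.cast_le]
      refine Finset.card_le_card_of_injOn (fun H => H.1) ?_ ?_
      · intro H hH
        have hH' := (Finset.mem_filter.1 hH).2
        exact Finset.mem_coe.2 (Finset.mem_filter.2 ⟨Finset.mem_univ _, fun h => hH' (hq H h)⟩)
      · exact fun H _ H' _ h => Subtype.ext h
    have hη : 0 ≤ η := by
      by_contra hneg
      have : η * (Fintype.card (Matrix (Fin r) (Fin n) (ZMod 2)) : ℝ) < 0 :=
        mul_neg_of_neg_of_pos (not_le.1 hneg) hM
      have h0 : (0 : ℝ) ≤ (Finset.univ.filter fun H : Matrix (Fin r) (Fin n) (ZMod 2) =>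
        ¬ p H).card := Nat.cast_nonneg _
      linarith
    nlinarith
  have h7 := freq_add_freq_not q
  have h8 : proportion q = freq q := rfl
  rw [h8]
  linarith

/-- Union bound over the nonzero vectors supported on `J`. For `r - m` columns this is `2^(-m)`,
whereas for `r` columns it is trivial; hence independence is first established for slightly smaller
sets. -/
lemma freq_not_indepCols_le (J : Finset (Fin n)) :
    freq (fun H : Matrix (Fin r) (Fin n) (ZMod 2) => ¬ IndepCols H J) ≤ 2 ^ J.card / 2 ^ r := by
  classical
  set T : Finset (Fin n → ZMod 2) :=
    Fintype.piFinset fun i => if i ∈ J then Finset.univ else {0} with hT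
  have hcard : T.card = 2 ^ J.card := by
    rw [hT, Fintype.card_piFinset, ← Finset.prod_subset (Finset.subset_univ J)]
    · rw [Finset.prod_congr rfl (g := fun _ => 2), Finset.prod_const]
      intro i hi
      simp [hi]
    · intro i _ hi
      simp [hi]
  have h1 : ∀ H : Matrix (Fin r) (Fin n) (ZMod 2), ¬ IndepCols H J →
      ∃ x ∈ T.filter (· ≠ 0), H.mulVec x = 0 := by
    intro H hH
    rw [IndepCols] at hH
    push Not at hH
    obtain ⟨x, h2, h3, h4⟩ := hH
    refine ⟨x, Finset.mem_filter.2 ⟨Fintype.mem_piFinset.2 fun i => ?_, h4⟩, h3⟩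
    split_ifs with hi
    · exact Finset.mem_univ _
    · rw [Finset.mem_singleton, h2 i hi]
  refine (freq_mono h1).trans ((freq_exists_le _ _).trans ?_)
  refine (Finset.sum_le_card_nsmul _ _ ((1 : ℝ) / 2 ^ r) fun x hx =>
    (freq_mulVec_eq_zero (Finset.mem_filter.1 hx).2).le).trans ?_
  rw [nsmul_eq_mul, mul_one_div]
  gcongr
  have : ((2 ^ J.card : ℕ) : ℝ) = 2 ^ J.card := by push_cast; rfl
  rw [← this, ← hcard]
  exact_mod_cast Finset.card_filter_le _ _

/-- A random instance has no second solution of small weight. -/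
lemma freq_not_unique_le (e : Fin n → ZMod 2) (w : ℕ) :
    freq (fun H : Matrix (Fin r) (Fin n) (ZMod 2) =>
      ¬ ∀ x, IsSolution H (H.mulVec e) w x → x = e) ≤ n.choose w / 2 ^ r := by
  classical
  have h1 : ∀ H : Matrix (Fin r) (Fin n) (ZMod 2),
      (¬ ∀ x, IsSolution H (H.mulVec e) w x → x = e) →
      ∃ x ∈ Finset.univ.filter fun x : Fin n → ZMod 2 => hammingNorm x = w ∧ x ≠ e,
        H.mulVec (x - e) = 0 := by
    intro H hH
    push Not at hH
    obtain ⟨x, h2, h3⟩ := hH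
    refine ⟨x, Finset.mem_filter.2 ⟨Finset.mem_univ _, h2.1, h3⟩, ?_⟩
    rw [Matrix.mulVec_sub, h2.2, sub_self]
  refine (freq_mono h1).trans ((freq_exists_le _ _).trans ?_)
  refine (Finset.sum_le_card_nsmul _ _ ((1 : ℝ) / 2 ^ r) fun x hx =>
    (freq_mulVec_eq_zero (sub_ne_zero.2 (Finset.mem_filter.1 hx).2.2)).le).trans ?_
  rw [nsmul_eq_mul, mul_one_div]
  gcongr
  have h2 : n.choose w = ((Finset.univ : Finset (Fin n)).powersetCard w).card := by simp
  rw [h2]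
  refine Finset.card_le_card_of_injOn supp ?_ ?_
  · intro x hx
    refine Finset.mem_coe.2 (Finset.mem_powersetCard.2 ⟨Finset.subset_univ _, ?_⟩)
    rw [card_supp]
    exact (Finset.mem_filter.1 hx).2.1
  · intro x _ y _ h
    ext i
    have h3 := Finset.ext_iff.1 h i
    simp only [supp, Finset.mem_filter, Finset.mem_univ, true_and] at h3
    rcases zmod_two_cases (x i) with hx | hx <;> rcases zmod_two_cases (y i) with hy | hy <;>
      simp_all

/-- Every nonzero combination of the rows has at least `d` nonzero entries in the columns `U`. -/
def RowDistance (H : Matrix (Fin r) (Fin n) (ZMod 2)) (U : Finset (Fin n)) (d : ℕ) : Prop :=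
  ∀ u : Fin r → ZMod 2, u ≠ 0 → d ≤ (U.filter fun i => Matrix.vecMul u H i ≠ 0).card

/-- The generating function factorises over the coordinates: those in `U` contribute `1 + x`, the
others `2`. -/
lemma sum_pow_weight (U : Finset (Fin n)) (x : ℝ) :
    ∑ v : Fin n → ZMod 2, x ^ (U.filter fun i => v i ≠ 0).card =
      (1 + x) ^ U.card * 2 ^ (n - U.card) := by
  classical
  have h1 : ∀ v : Fin n → ZMod 2, x ^ (U.filter fun i => v i ≠ 0).card =
      ∏ i, if i ∈ U ∧ v i ≠ 0 then x else 1 := by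
    intro v
    rw [Finset.prod_ite, Finset.prod_const, Finset.prod_const_one, mul_one]
    congr 2
    ext i
    simp
  have h2 := Finset.prod_univ_sum (fun _ : Fin n => (Finset.univ : Finset (ZMod 2)))
    (fun i b => if i ∈ U ∧ b ≠ 0 then x else 1)
  rw [Finset.sum_congr rfl fun v _ => h1 v]
  rw [Fintype.piFinset_univ] at h2
  rw [← h2]
  have h3 : ∀ i, ∑ b : ZMod 2, (if i ∈ U ∧ b ≠ 0 then x else 1) = if i ∈ U then 1 + x else 2 := by
    intro i
    rw [sum_zmod_two]
    by_cases hi : i ∈ U <;> simp [hi]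
    norm_num
  simp only [h3]
  rw [Finset.prod_ite, Finset.prod_const, Finset.prod_const]
  congr 2
  · simp
  · rw [Finset.filter_not, Finset.card_sdiff_of_subset (Finset.filter_subset _ _)]
    simp

/-- Chernoff's method: a vector of weight less than `d` on `U` contributes at least `x ^ d` to the
generating function. Every nonzero combination of the rows is uniform, and there are at most `2 ^
r`. -/
lemma freq_not_rowDistance_le (U : Finset (Fin n)) (d : ℕ) {x : ℝ} (hx0 : 0 < x) (hx1 : x ≤ 1) :
    freq (fun H : Matrix (Fin r) (Fin n) (ZMod 2) => ¬ RowDistance H U d) ≤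
      2 ^ r * ((1 + x) ^ U.card / (x ^ d * 2 ^ U.card)) := by
  classical
  have h1 : ∀ H : Matrix (Fin r) (Fin n) (ZMod 2), ¬ RowDistance H U d →
      ∃ u ∈ Finset.univ.filter fun u : Fin r → ZMod 2 => u ≠ 0,
        (U.filter fun i => Matrix.vecMul u H i ≠ 0).card < d := by
    intro H hH
    rw [RowDistance] at hH
    push Not at hH
    obtain ⟨u, hu, h⟩ := hH
    exact ⟨u, Finset.mem_filter.2 ⟨Finset.mem_univ _, hu⟩, h⟩
  have hU : U.card ≤ n := by simpa using Finset.card_le_univ U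
  refine (freq_mono h1).trans ((freq_exists_le _ _).trans ?_)
  refine (Finset.sum_le_card_nsmul _ _ ((1 + x) ^ U.card / (x ^ d * 2 ^ U.card))
    fun u hu => ?_).trans ?_
  · have h2 := freq_vecMul (n := n) (Finset.mem_filter.1 hu).2
      fun v => (U.filter fun i => v i ≠ 0).card < d
    refine (le_of_eq h2).trans ?_
    have hV : (Fintype.card (Fin n → ZMod 2) : ℝ) = 2 ^ n := by simp
    rw [freq_eq, hV, div_le_div_iff₀ (by positivity) (by positivity)]
    have h3 : ((Finset.univ.filter fun v : Fin n → ZMod 2 =>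
        (U.filter fun i => v i ≠ 0).card < d).card : ℝ) * x ^ d ≤
          (1 + x) ^ U.card * 2 ^ (n - U.card) := by
      rw [← sum_pow_weight, ← nsmul_eq_mul]
      refine (Finset.card_nsmul_le_sum _ (fun v : Fin n → ZMod 2 =>
        x ^ (U.filter fun i => v i ≠ 0).card) _ fun v hv => ?_).trans ?_
      · exact pow_le_pow_of_le_one hx0.le hx1 (Finset.mem_filter.1 hv).2.le
      · exact Finset.sum_le_sum_of_subset_of_nonneg (Finset.subset_univ _)
          fun _ _ _ => by positivity
    have h4 : (2 : ℝ) ^ n = 2 ^ (n - U.card) * 2 ^ U.card := by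
      rw [← pow_add, Nat.sub_add_cancel hU]
    rw [h4, ← mul_assoc, ← mul_assoc]
    gcongr
  · rw [nsmul_eq_mul]
    gcongr
    have : ((Finset.univ : Finset (Fin r → ZMod 2)).card : ℝ) = 2 ^ r := by simp
    rw [← this]
    exact_mod_cast Finset.card_filter_le _ _

end

/-! ### Extending independent sets of columns -/

section
variable {r n : ℕ} {H : Matrix (Fin r) (Fin n) (ZMod 2)} {S U J : Finset (Fin n)} {d : ℕ}

/-- Pigeonhole: the `2 ^ r` combinations of the rows have at most `2 ^ J.card` restrictions to `J`.
-/
lemma exists_vecMul_eq_zero (H : Matrix (Fin r) (Fin n) (ZMod 2)) (hJ : J.card < r) :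
    ∃ u : Fin r → ZMod 2, u ≠ 0 ∧ ∀ j ∈ J, Matrix.vecMul u H j = 0 := by
  have hcard : Fintype.card (J → ZMod 2) < Fintype.card (Fin r → ZMod 2) := by
    simpa using Nat.pow_lt_pow_right (by norm_num : 1 < 2) hJ
  obtain ⟨u, v, huv, h⟩ := Fintype.exists_ne_map_eq_of_card_lt
    (fun (u : Fin r → ZMod 2) (j : J) => Matrix.vecMul u H j) hcard
  refine ⟨u - v, sub_ne_zero.2 huv, fun j hj => ?_⟩
  have h1 := congrFun h ⟨j, hj⟩
  rw [Matrix.sub_vecMul, Pi.sub_apply]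
  exact sub_eq_zero.2 h1

/-- The functional `u` vanishes on the columns in `J` but not on column `i`, so column `i` is
outside their span. -/
lemma IndepCols.insert (hJ : IndepCols H J) {u : Fin r → ZMod 2}
    (hu : ∀ j ∈ J, Matrix.vecMul u H j = 0) {i : Fin n} (hi : Matrix.vecMul u H i ≠ 0) :
    IndepCols H (insert i J) := by
  intro x hx hx0
  refine hJ x (fun j hj => ?_) hx0
  by_cases hji : j = i
  · subst hji
    have h1 : Matrix.vecMul u H ⬝ᵥ x = 0 := by
      rw [← Matrix.dotProduct_mulVec, hx0, dotProduct_zero]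
    rw [dotProduct, Finset.sum_eq_single j] at h1
    · exact (mul_eq_zero.1 h1).resolve_left hi
    · intro k _ hk
      by_cases hkJ : k ∈ J
      · rw [hu k hkJ, zero_mul]
      · rw [hx k (by simp [hk, hkJ]), mul_zero]
    · simp
  · exact hx j (by simp [hji, hj])

/-- Double counting of pairs of nested independent sets of sizes `i` and `i + 1`. The smaller set is
annihilated by some `u ≠ 0` and can be extended by each of the at least `d` columns of `U` where `u
H` is nonzero; from the larger set only elements outside `S` may be removed. -/
lemma indepCount_mul_le (hd : RowDistance H U d) {i : ℕ} (hi : i < r) :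
    indepCount H S U i * d ≤ indepCount H S U (i + 1) * (i + 1 - S.card) := by
  classical
  refine Finset.card_mul_le_card_mul (· ⊆ ·) ?_ ?_
  · intro J hJ
    obtain ⟨hJ1, hSJ, hind⟩ := Finset.mem_filter.1 hJ
    obtain ⟨hJU, hcard⟩ := Finset.mem_powersetCard.1 hJ1
    obtain ⟨u, hu0, hu⟩ := exists_vecMul_eq_zero H (hcard ▸ hi)
    have hnot : ∀ i, Matrix.vecMul u H i ≠ 0 → i ∉ J := fun i hi h => hi (hu i h)
    refine (hd u hu0).trans (Finset.card_le_card_of_injOn (fun i => insert i J) ?_ ?_)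
    · intro i hi
      obtain ⟨hiU, hi0⟩ := Finset.mem_filter.1 hi
      refine Finset.mem_coe.2 (Finset.mem_filter.2 ⟨Finset.mem_filter.2
        ⟨Finset.mem_powersetCard.2 ⟨Finset.insert_subset hiU hJU, ?_⟩,
          hSJ.trans (Finset.subset_insert _ _), hind.insert hu hi0⟩, Finset.subset_insert _ _⟩)
      rw [Finset.card_insert_of_notMem (hnot i hi0), hcard]
    · intro i hi j hj h
      exact (Finset.insert_inj (hnot i (Finset.mem_filter.1 hi).2)).1 h
  · intro J hJ
    obtain ⟨hJ1, hSJ, -⟩ := Finset.mem_filter.1 hJ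
    obtain ⟨-, hcard⟩ := Finset.mem_powersetCard.1 hJ1
    rw [← hcard, ← Finset.card_sdiff_of_subset hSJ]
    refine (Finset.card_le_card (t := (J \ S).image J.erase) fun I hI => ?_).trans
      Finset.card_image_le
    obtain ⟨hI1, hIJ⟩ := Finset.mem_filter.1 hI
    obtain ⟨hI2, hSI, -⟩ := Finset.mem_filter.1 hI1
    obtain ⟨-, hIcard⟩ := Finset.mem_powersetCard.1 hI2
    obtain ⟨x, hx⟩ := Finset.card_eq_one.1 (by
      rw [Finset.card_sdiff_of_subset hIJ, hcard, hIcard]; omega : (J \ I).card = 1)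
    have hxm : x ∈ J \ I := by simp [hx]
    obtain ⟨hxJ, hxI⟩ := Finset.mem_sdiff.1 hxm
    refine Finset.mem_image.2 ⟨x, Finset.mem_sdiff.2 ⟨hxJ, fun h => hxI (hSI h)⟩, ?_⟩
    rw [Finset.erase_eq, ← hx, Finset.sdiff_sdiff_eq_self hIJ]

/-- The proportion of linearly independent sets among the sets of `a` columns between `S`
and `U`. -/
def indepRatio (H : Matrix (Fin r) (Fin n) (ZMod 2)) (S U : Finset (Fin n)) (a : ℕ) : ℝ :=
  (indepCount H S U a : ℝ) / (U.card - S.card).choose (a - S.card)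

lemma indepRatio_nonneg (a : ℕ) : 0 ≤ indepRatio H S U a := by
  rw [indepRatio]
  positivity

/-- The double count divided by binomial coefficients, using `C(a, j+1) (j+1) = C(a, j) (a - j)` and
`a - j ≤ U.card`. -/
lemma mul_indepRatio_le_succ (hd : RowDistance H U d) {i : ℕ} (hS : S.card ≤ i) (hir : i < r)
    (hU : r ≤ U.card) :
    (d / U.card : ℝ) * indepRatio H S U i ≤ indepRatio H S U (i + 1) := by
  obtain ⟨j, rfl⟩ := Nat.exists_eq_add_of_le hS
  have h1 := indepCount_mul_le (S := S) hd hir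
  have h2 := Nat.choose_succ_right_eq (U.card - S.card) j
  rw [indepRatio, indepRatio]
  rw [show S.card + j + 1 - S.card = j + 1 by omega] at h1 ⊢
  rw [show S.card + j - S.card = j by omega]
  have hb : (0 : ℝ) < (U.card - S.card).choose j := by exact_mod_cast Nat.choose_pos (by omega)
  have hb' : (0 : ℝ) < (U.card - S.card).choose (j + 1) := by
    exact_mod_cast Nat.choose_pos (by omega)
  have hN : (0 : ℝ) < U.card := by exact_mod_cast (by omega : 0 < U.card)
  have h3 : (U.card - S.card).choose (j + 1) * (j + 1) ≤ (U.card - S.card).choose j * U.card := by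
    rw [h2]
    exact Nat.mul_le_mul_left _ (by omega)
  have h1' : (indepCount H S U (S.card + j) : ℝ) * d ≤
      indepCount H S U (S.card + j + 1) * (j + 1) := by exact_mod_cast h1
  have h3' : ((U.card - S.card).choose (j + 1) : ℝ) * (j + 1) ≤
      (U.card - S.card).choose j * U.card := by exact_mod_cast h3
  rw [div_mul_div_comm, div_le_div_iff₀ (by positivity) hb']
  have hj : (0 : ℝ) < j + 1 := by positivity
  refine le_of_mul_le_mul_right ?_ hj
  calc (d : ℝ) * indepCount H S U (S.card + j) * (U.card - S.card).choose (j + 1) * (j + 1)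
      = (indepCount H S U (S.card + j) * d) *
        ((U.card - S.card).choose (j + 1) * (j + 1)) := by ring
    _ ≤ (indepCount H S U (S.card + j + 1) * (j + 1)) *
        ((U.card - S.card).choose j * U.card) := by gcongr
    _ = _ := by ring

lemma pow_mul_indepRatio_le (hd : RowDistance H U d) {i : ℕ} (hS : S.card ≤ i) (m : ℕ)
    (him : i + m ≤ r) (hU : r ≤ U.card) :
    (d / U.card : ℝ) ^ m * indepRatio H S U i ≤ indepRatio H S U (i + m) := by
  induction m with
  | zero => simp
  | succ m ih =>
    rw [pow_succ', mul_assoc]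
    refine le_trans ?_ (mul_indepRatio_le_succ hd (by omega : S.card ≤ i + m)
      (by rw [← Nat.add_assoc] at him; exact him) hU)
    exact mul_le_mul_of_nonneg_left (ih (by omega)) (by positivity)

/-- For most matrices, a fair share of the sets of `r` columns between `S` and `U` is
linearly independent. -/
lemma freq_indepRatio_lt_le (hSU : S ⊆ U) {m : ℕ} (hm : S.card + m ≤ r) (hU : r ≤ U.card)
    {x : ℝ} (hx0 : 0 < x) (hx1 : x ≤ 1) :
    freq (fun H : Matrix (Fin r) (Fin n) (ZMod 2) =>
      indepRatio H S U r < (d / U.card : ℝ) ^ m / 2) ≤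
      2 * (1 / 2) ^ m + 2 ^ r * ((1 + x) ^ U.card / (x ^ d * 2 ^ U.card)) := by
  classical
  set T := (U.powersetCard (r - m)).filter fun J => S ⊆ J with hT
  have hTcard : T.card = (U.card - S.card).choose (r - m - S.card) :=
    card_powersetCard_superset hSU (by omega)
  -- Markov's inequality over the sets of `r - m` columns, each of which is dependent with
  -- probability at most `2^(-m)`.
  have h1 := freq_half_lt_le T
    (fun J (H : Matrix (Fin r) (Fin n) (ZMod 2)) => ¬ IndepCols H J) (η := (1 / 2) ^ m)
    (by positivity) (fun J hJ => by
      refine (freq_not_indepCols_le J).trans (le_of_eq ?_)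
      rw [(Finset.mem_powersetCard.1 (Finset.mem_filter.1 hJ).1).2, div_pow, one_pow,
        div_eq_div_iff (by positivity) (by positivity), one_mul, ← pow_add]
      congr 1
      omega)
  refine (freq_mono fun H hH => ?_).trans ((freq_or_le _ _).trans
    (add_le_add h1 (freq_not_rowDistance_le U d hx0 hx1)))
  by_contra hcon
  obtain ⟨hcon1, hcon2⟩ := not_or.1 hcon
  rw [not_not] at hcon2
  replace hcon1 := not_lt.1 hcon1
  refine absurd hH (not_lt.2 ?_)
  -- From size `r - m` to size `r` there are `m` extensions, each losing a factor `d / U.card`.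
  have h2 := pow_mul_indepRatio_le (S := S) hcon2 (i := r - m) (by omega) m (by omega) hU
  rw [Nat.sub_add_cancel (by omega : m ≤ r)] at h2
  refine le_trans ?_ h2
  rw [div_eq_mul_one_div]
  refine mul_le_mul_of_nonneg_left ?_ (by positivity)
  have hpos : (0 : ℝ) < (U.card - S.card).choose (r - m - S.card) := by
    exact_mod_cast Nat.choose_pos (by omega)
  rw [indepRatio, le_div_iff₀ hpos, ← hTcard]
  have h3 := Finset.card_filter_add_card_filter_not (s := T) fun J => IndepCols H J
  have h4 : (T.filter fun J => IndepCols H J).card = indepCount H S U (r - m) := by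
    rw [indepCount, hT, Finset.filter_filter]
  rw [h4] at h3
  have h3' : (indepCount H S U (r - m) : ℝ) + (T.filter fun J => ¬ IndepCols H J).card =
      T.card := by exact_mod_cast h3
  have h5 : ((T.filter fun J => ¬ IndepCols H J).card : ℝ) ≤ (T.card : ℝ) / 2 := by
    refine le_trans (le_of_eq ?_) hcon1
    congr!
  linarith

end

/-! ### Averaging over permutations -/

section
variable {r κ l n w : ℕ}

lemma positions_sumCongr_trans (σ : Col r κ ≃ Col r κ) (P : Col r κ ⊕ Fin l ≃ Fin n)
    (I : Finset (Col r κ)) :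
    positions ((Equiv.sumCongr σ (Equiv.refl (Fin l))).trans P) I =
      positions P (I.map σ.toEmbedding) := by
  ext i
  simp only [mem_positions, Finset.mem_map_equiv]
  constructor
  · rintro ⟨c, hc, rfl⟩
    exact ⟨σ c, by simpa using hc, rfl⟩
  · rintro ⟨c, hc, rfl⟩
    exact ⟨σ.symm c, hc, by simp⟩

lemma card_positions_univ (P : Col r κ ⊕ Fin l ≃ Fin n) :
    (positions P Finset.univ).card = r + κ := by simp [positions]

/-- Averaging over the permutations with the same set of kept positions. -/
lemma sum_positions_identityCols (F : Finset (Fin n) → ℝ) (p : Finset (Fin n) → Prop)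
    [DecidablePred p] :
    ∑ P : Col r κ ⊕ Fin l ≃ Fin n,
      F (positions P Finset.univ) * (if p (positions P (identityCols r κ)) then 1 else 0) =
    ∑ P : Col r κ ⊕ Fin l ≃ Fin n, F (positions P Finset.univ) *
      ((((positions P Finset.univ).powersetCard r).filter p).card / (r + κ).choose r) := by
  classical
  have hcard : (identityCols r κ).card = r := by simp [identityCols]
  have hperm : (0 : ℝ) < Fintype.card (Col r κ ≃ Col r κ) := by
    exact_mod_cast Fintype.card_pos_iff.2 ⟨Equiv.refl _⟩
  have hchoose : (0 : ℝ) < (r + κ).choose r := by exact_mod_cast Nat.choose_pos (by omega)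
  -- A random permutation of the kept columns makes the pivot block a uniformly random `r`-subset of
  -- the kept positions.
  have h1 : ∀ P : Col r κ ⊕ Fin l ≃ Fin n, ∑ σ : Col r κ ≃ Col r κ,
      (if p (positions P ((identityCols r κ).map σ.toEmbedding)) then (1 : ℝ) else 0) =
      Fintype.card (Col r κ ≃ Col r κ) *
        ((((positions P Finset.univ).powersetCard r).filter p).card / (r + κ).choose r) := by
    intro P
    have h2 := sum_equiv_map (β := Col r κ) (identityCols r κ)
      fun I => if p (positions P I) then (1 : ℝ) else 0
    rw [Finset.sum_boole, Finset.sum_boole, hcard] at h2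
    have h3 := card_filter_positions (P := P) (S := ∅) (a := r) p
    simp only [Finset.empty_subset, true_and] at h3
    rw [h3] at h2
    simp only [Fintype.card_sum, Fintype.card_fin] at h2
    rw [Finset.sum_boole, ← mul_div_assoc, eq_div_iff hchoose.ne', h2]
  -- Precomposition with `σ` permutes the summation range and leaves the set of kept positions
  -- unchanged.
  have h4 : ∀ σ : Col r κ ≃ Col r κ, ∑ P : Col r κ ⊕ Fin l ≃ Fin n,
      F (positions P Finset.univ) * (if p (positions P (identityCols r κ)) then 1 else 0) =
      ∑ P : Col r κ ⊕ Fin l ≃ Fin n, F (positions P Finset.univ) *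
        (if p (positions P ((identityCols r κ).map σ.toEmbedding)) then 1 else 0) := by
    intro σ
    rw [← ((Equiv.sumCongr σ (Equiv.refl (Fin l))).symm.equivCongr (Equiv.refl (Fin n))).sum_comp]
    refine Finset.sum_congr rfl fun P _ => ?_
    have h5 : ((Equiv.sumCongr σ (Equiv.refl (Fin l))).symm.equivCongr (Equiv.refl (Fin n))) P =
        (Equiv.sumCongr σ (Equiv.refl (Fin l))).trans P := by
      ext
      simp [Equiv.equivCongr]
    rw [h5, positions_sumCongr_trans, positions_sumCongr_trans]
    congr 3
    simp
  have h6 := Finset.sum_congr (s₁ := Finset.univ) rfl fun σ _ => h4 σ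
  rw [Finset.sum_const, Finset.card_univ, nsmul_eq_mul, Finset.sum_comm] at h6
  simp only [← Finset.mul_sum, h1] at h6
  refine mul_left_cancel₀ hperm.ne' (h6.trans ?_)
  rw [Finset.mul_sum]
  refine Finset.sum_congr rfl fun P _ => ?_
  ring

variable {H : Matrix (Fin r) (Fin n) (ZMod 2)} {e : Fin n → ZMod 2}

/-- The success probability in terms of the shares of independent sets of columns. -/
lemma sum_indepRatio_le_successProb (D : SearchCircuits r κ w) (hw : w ≤ r)
    (hew : hammingNorm e = w) (huniq : ∀ x, IsSolution H (H.mulVec e) w x → x = e) :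
    (∑ P : Col r κ ⊕ Fin l ≃ Fin n with supp e ⊆ positions P Finset.univ,
      indepRatio H (supp e) (positions P Finset.univ) r *
        indepRatio H ∅ (positions P Finset.univ) r) / 100 /
      Fintype.card (Col r κ ⊕ Fin l ≃ Fin n) ≤ successProb D l H (H.mulVec e) := by
  classical
  refine le_trans (le_of_eq ?_) (le_successProb D hw ⟨hew, rfl⟩ huniq)
  congr 1
  have h := sum_positions_identityCols (r := r) (κ := κ) (l := l) (fun U => if supp e ⊆ U then
    (indepCount H (supp e) U r : ℝ) / (r + κ - w).choose (r - w) / 100 else 0) (IndepCols H)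
  rw [Finset.sum_div, Finset.sum_filter]
  refine Eq.trans ?_ (h.symm.trans ?_)
  · refine Finset.sum_congr rfl fun P _ => ?_
    split_ifs
    · rw [indepRatio, indepRatio, indepCount, indepCount, card_positions_univ, card_supp, hew]
      simp only [Finset.empty_subset, true_and, Finset.card_empty, Nat.sub_zero]
      ring
    · rw [zero_mul]
  · refine Finset.sum_congr rfl fun P _ => ?_
    by_cases h1 : supp e ⊆ positions P Finset.univ <;>
      by_cases h2 : IndepCols H (positions P (identityCols r κ)) <;> simp [h1, h2]

/-- Markov's inequality once more, now over the permutations that keep the error. Apart from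
exceptional matrices, for at least half of them both shares of independent sets are at least `γ /
2`, which gives the constant `(γ/2)² / 2 / 100 = γ² / 800`. -/
lemma freq_successProb_le (D : SearchCircuits r κ w) (hn : r + κ + l = n)
    (hew : hammingNorm e = w) {m d : ℕ} (hm : w + m ≤ r) {x : ℝ} (hx0 : 0 < x) (hx1 : x ≤ 1) :
    freq (fun H : Matrix (Fin r) (Fin n) (ZMod 2) =>
      ¬ (((d / (r + κ : ℕ) : ℝ) ^ m) ^ 2 / 800 * (((r + κ).choose w : ℝ) / n.choose w) ≤
          successProb D l H (H.mulVec e) ∧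
        successProb D l H (H.mulVec e) ≤ ((r + κ).choose w : ℝ) / n.choose w)) ≤
      4 * (2 * (1 / 2) ^ m + 2 ^ r * ((1 + x) ^ (r + κ) / (x ^ d * 2 ^ (r + κ)))) * 2 +
        n.choose w / 2 ^ r := by
  classical
  set γ : ℝ := (d / (r + κ : ℕ) : ℝ) ^ m with hγ
  set T := (Finset.univ : Finset (Col r κ ⊕ Fin l ≃ Fin n)).filter
    fun P => supp e ⊆ positions P Finset.univ with hT
  set η : ℝ := 2 * (1 / 2) ^ m + 2 ^ r * ((1 + x) ^ (r + κ) / (x ^ d * 2 ^ (r + κ))) with hη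
  have hη0 : 0 ≤ η := by positivity
  have h1 := freq_half_lt_le T
    (fun P (H : Matrix (Fin r) (Fin n) (ZMod 2)) =>
      indepRatio H (supp e) (positions P Finset.univ) r < γ / 2 ∨
      indepRatio H ∅ (positions P Finset.univ) r < γ / 2) (η := η + η) (by linarith)
    (fun P hP => by
      refine (freq_or_le _ _).trans (add_le_add ?_ ?_)
      · have := freq_indepRatio_lt_le (Finset.mem_filter.1 hP).2 (m := m) (r := r) (d := d)
          (by rw [card_supp, hew]; exact hm) (by rw [card_positions_univ]; omega) hx0 hx1
        rwa [card_positions_univ] at this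
      · have := freq_indepRatio_lt_le (Finset.empty_subset (positions P Finset.univ)) (m := m)
          (r := r) (d := d) (by rw [Finset.card_empty]; omega)
          (by rw [card_positions_univ]; omega) hx0 hx1
        rwa [card_positions_univ] at this)
  refine (freq_mono fun H hH => ?_).trans ((freq_or_le _ _).trans
    (add_le_add (h1.trans (by linarith)) (freq_not_unique_le e w)))
  by_contra hcon
  obtain ⟨hcon1, hcon2⟩ := not_or.1 hcon
  rw [not_not] at hcon2
  replace hcon1 := not_lt.1 hcon1
  refine hH ⟨?_, successProb_le D hn (by omega) hew hcon2⟩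
  refine le_trans ?_ (sum_indepRatio_le_successProb D (by omega) hew hcon2)
  have hpos : (0 : ℝ) < Fintype.card (Col r κ ⊕ Fin l ≃ Fin n) := by
    exact_mod_cast card_equiv_pos hn
  have hTcard := card_filter_supp_positions hn (S := supp e) (w := w)
    (by rw [card_supp, hew]) (by omega)
  rw [← hT] at hTcard
  rw [le_div_iff₀ hpos, mul_assoc, mul_comm _ (Fintype.card _ : ℝ), ← hTcard]
  set bad : (Col r κ ⊕ Fin l ≃ Fin n) → Prop := fun P =>
      indepRatio H (supp e) (positions P Finset.univ) r < γ / 2 ∨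
      indepRatio H ∅ (positions P Finset.univ) r < γ / 2 with hbad
  have h3 := Finset.card_filter_add_card_filter_not (s := T) bad
  have h3' : ((T.filter bad).card : ℝ) + (T.filter fun P => ¬ bad P).card = T.card := by
    exact_mod_cast h3
  have h5 : ((T.filter bad).card : ℝ) ≤ (T.card : ℝ) / 2 := by
    refine le_trans (le_of_eq ?_) hcon1
    congr!
  have h6 : ((T.filter fun P => ¬ bad P).card : ℝ) * (γ ^ 2 / 4) ≤
      ∑ P ∈ T, indepRatio H (supp e) (positions P Finset.univ) r *
        indepRatio H ∅ (positions P Finset.univ) r := by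
    rw [← nsmul_eq_mul]
    refine (Finset.card_nsmul_le_sum _ (fun P : Col r κ ⊕ Fin l ≃ Fin n =>
      indepRatio H (supp e) (positions P Finset.univ) r *
        indepRatio H ∅ (positions P Finset.univ) r) _ fun P hP => ?_).trans ?_
    · obtain ⟨h7, h8⟩ := not_or.1 (Finset.mem_filter.1 hP).2
      have hγ0 : 0 ≤ γ / 2 := by positivity
      calc γ ^ 2 / 4 = (γ / 2) * (γ / 2) := by ring
        _ ≤ _ := mul_le_mul (not_lt.1 h7) (not_lt.1 h8) hγ0 (hγ0.trans (not_lt.1 h7))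
    · exact Finset.sum_le_sum_of_subset_of_nonneg (Finset.filter_subset _ _)
        fun _ _ _ => mul_nonneg (indepRatio_nonneg _) (indepRatio_nonneg _)
  have h9 : (T.card : ℝ) / 2 * (γ ^ 2 / 4) ≤
      ∑ P ∈ T, indepRatio H (supp e) (positions P Finset.univ) r *
        indepRatio H ∅ (positions P Finset.univ) r := by
    refine le_trans ?_ h6
    gcongr
    linarith
  linarith

/-- The case in which no matrix column is stored. -/
lemma indepRatio_le_successProb (D : SearchCircuits r 0 w) (hn : r + l = n) (hw : w ≤ r)
    (hew : hammingNorm e = w) (huniq : ∀ x, IsSolution H (H.mulVec e) w x → x = e) :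
    indepRatio H (supp e) Finset.univ r / 100 * ((r.choose w : ℝ) / n.choose w) ≤
      successProb D l H (H.mulVec e) := by
  classical
  refine le_trans (le_of_eq ?_) (le_successProb D hw ⟨hew, rfl⟩ huniq)
  have hid : identityCols r 0 = Finset.univ := by
    ext c
    rcases c with c | c
    · simp [identityCols]
    · exact c.elim0
  have h := sum_equiv_map (β := Fin n) ((Finset.univ : Finset (Col r 0)).map
    (Function.Embedding.inl : Col r 0 ↪ Col r 0 ⊕ Fin l))
    fun J => if supp e ⊆ J ∧ IndepCols H J then (1 / 100 : ℝ) else 0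
  simp only [Finset.card_map, Finset.card_univ, Fintype.card_sum, Fintype.card_fin,
    add_zero] at h
  have h1 : (0 : ℝ) < n.choose r := by exact_mod_cast Nat.choose_pos (by omega)
  have hpos : (0 : ℝ) < Fintype.card (Col r 0 ⊕ Fin l ≃ Fin n) := by
    exact_mod_cast card_equiv_pos (by omega)
  have h2 : ∑ J ∈ (Finset.univ : Finset (Fin n)).powersetCard r,
      (if supp e ⊆ J ∧ IndepCols H J then (1 / 100 : ℝ) else 0) =
      indepCount H (supp e) Finset.univ r / 100 := by
    rw [← Finset.sum_filter, Finset.sum_const, nsmul_eq_mul, indepCount, mul_one_div]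
  rw [h2] at h
  have h3 : ∀ P : Col r 0 ⊕ Fin l ≃ Fin n,
      (if supp e ⊆ positions P Finset.univ ∧ IndepCols H (positions P (identityCols r 0)) then
        (indepCount H (supp e) (positions P Finset.univ) r : ℝ) /
          (r + 0 - w).choose (r - w) / 100 else 0) =
      if supp e ⊆ positions P Finset.univ ∧ IndepCols H (positions P Finset.univ) then
        (1 / 100 : ℝ) else 0 := by
    intro P
    rw [hid]
    split_ifs with h4
    · have h5 : indepCount H (supp e) (positions P Finset.univ) r = 1 := by
        have h6 : (positions P Finset.univ).powersetCard r = {positions P Finset.univ} := by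
          have h7 := Finset.powersetCard_self (positions P Finset.univ)
          rwa [card_positions_univ, add_zero] at h7
        rw [indepCount, h6, Finset.filter_singleton, if_pos h4, Finset.card_singleton]
      rw [h5, add_zero, Nat.choose_self]
      norm_num
    · rfl
  rw [Finset.sum_congr rfl fun P _ => h3 P]
  have h7 : (∑ P : Col r 0 ⊕ Fin l ≃ Fin n,
      if supp e ⊆ positions P Finset.univ ∧ IndepCols H (positions P Finset.univ) then
        (1 / 100 : ℝ) else 0) = Fintype.card (Col r 0 ⊕ Fin l ≃ Fin n) *
        (indepCount H (supp e) Finset.univ r / 100) / n.choose r := by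
    rw [eq_div_iff h1.ne', ← h]
    rfl
  rw [h7, ← choose_sub_div_choose hw (by omega), indepRatio, card_supp, hew, Finset.card_univ,
    Fintype.card_fin]
  have h8 : (0 : ℝ) < (n - w).choose (r - w) := by exact_mod_cast Nat.choose_pos (by omega)
  field_simp

/-- With `κ = 0` exactly `r` positions are kept, so there is no room for extensions inside them. The
kept set is however itself a uniformly random `r`-set, so the share of independent sets among all
`n` columns is what matters, and it enters only once. -/
lemma freq_successProb_le_of_zero (D : SearchCircuits r 0 w) (hn : r + l = n)
    (hew : hammingNorm e = w) {m d : ℕ} (hm : w + m ≤ r) {x : ℝ} (hx0 : 0 < x) (hx1 : x ≤ 1) :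
    freq (fun H : Matrix (Fin r) (Fin n) (ZMod 2) =>
      ¬ ((d / n : ℝ) ^ m / 200 * ((r.choose w : ℝ) / n.choose w) ≤
          successProb D l H (H.mulVec e) ∧
        successProb D l H (H.mulVec e) ≤ (r.choose w : ℝ) / n.choose w)) ≤
      2 * (1 / 2) ^ m + 2 ^ r * ((1 + x) ^ n / (x ^ d * 2 ^ n)) + n.choose w / 2 ^ r := by
  have h1 := freq_indepRatio_lt_le (Finset.subset_univ (supp e)) (m := m) (r := r) (d := d)
    (by rw [card_supp, hew]; exact hm) (by simp; omega) hx0 hx1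
  rw [Finset.card_univ, Fintype.card_fin] at h1
  refine (freq_mono fun H hH => ?_).trans ((freq_or_le _ _).trans
    (add_le_add h1 (freq_not_unique_le e w)))
  by_contra hcon
  obtain ⟨hcon1, hcon2⟩ := not_or.1 hcon
  rw [not_not] at hcon2
  replace hcon1 := not_lt.1 hcon1
  refine hH ⟨le_trans ?_ (indepRatio_le_successProb D hn (by omega) hew hcon2),
    successProb_le D (by omega) (by omega) hew hcon2⟩
  refine mul_le_mul_of_nonneg_right ?_ (by positivity)
  linarith

end

/-! ### Asymptotics -/

section
variable {m n w : ℕ}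

/-- Factor by factor, `(m - i) / (n - i) ≤ m / n`. -/
lemma pow_mul_choose_le (hmn : m ≤ n) (hw : w ≤ m) : n ^ w * m.choose w ≤ m ^ w * n.choose w := by
  have h1 : n ^ w * m.descFactorial w ≤ m ^ w * n.descFactorial w := by
    rw [Nat.descFactorial_eq_prod_range, Nat.descFactorial_eq_prod_range,
      ← Finset.card_range w, ← Finset.prod_const, ← Finset.prod_const, Finset.card_range,
      ← Finset.prod_mul_distrib, ← Finset.prod_mul_distrib]
    refine Finset.prod_le_prod' fun i hi => ?_
    have hi' := Finset.mem_range.1 hi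
    zify [(by omega : i ≤ m), (by omega : i ≤ n)]
    have h2 : (m : ℤ) ≤ n := by exact_mod_cast hmn
    have h3 : (0 : ℤ) ≤ i := by positivity
    nlinarith
  rw [Nat.descFactorial_eq_factorial_mul_choose, Nat.descFactorial_eq_factorial_mul_choose] at h1
  refine Nat.le_of_mul_le_mul_left ?_ (Nat.factorial_pos w)
  calc _ = n ^ w * (w.factorial * m.choose w) := by ring
    _ ≤ _ := h1
    _ = _ := by ring

/-- Factor by factor, `(m - w) / (n - w) ≤ (m - i) / (n - i)` for `i < w`. -/
lemma pow_sub_mul_choose_le (hmn : m ≤ n) (hw : w ≤ m) :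
    (m - w) ^ w * n.choose w ≤ (n - w) ^ w * m.choose w := by
  have h1 : (m - w) ^ w * n.descFactorial w ≤ (n - w) ^ w * m.descFactorial w := by
    rw [Nat.descFactorial_eq_prod_range, Nat.descFactorial_eq_prod_range]
    nth_rewrite 2 [← Finset.card_range w]
    nth_rewrite 5 [← Finset.card_range w]
    rw [← Finset.prod_const, ← Finset.prod_const,
      ← Finset.prod_mul_distrib, ← Finset.prod_mul_distrib]
    refine Finset.prod_le_prod' fun i hi => ?_
    have hi' := Finset.mem_range.1 hi
    zify [(by omega : i ≤ m), (by omega : i ≤ n), hw, hw.trans hmn]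
    have h2 : (m : ℤ) ≤ n := by exact_mod_cast hmn
    have h3 : (i : ℤ) ≤ w := by exact_mod_cast hi'.le
    nlinarith
  rw [Nat.descFactorial_eq_factorial_mul_choose, Nat.descFactorial_eq_factorial_mul_choose] at h1
  refine Nat.le_of_mul_le_mul_left ?_ (Nat.factorial_pos w)
  calc _ = (m - w) ^ w * (w.factorial * n.choose w) := by ring
    _ ≤ _ := h1
    _ = _ := by ring

lemma log_choose_sub_ge (hmn : m ≤ n) (hw : w < m) :
    w * Real.log (n / m : ℝ) ≤ Real.log (n.choose w) - Real.log (m.choose w) := by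
  have hm : (0 : ℝ) < m := by exact_mod_cast (by omega : 0 < m)
  have hn : (0 : ℝ) < n := by exact_mod_cast (by omega : 0 < n)
  have h1 : (0 : ℝ) < m.choose w := by exact_mod_cast Nat.choose_pos hw.le
  have h2 : (0 : ℝ) < n.choose w := by exact_mod_cast Nat.choose_pos (by omega)
  have h3 : (n : ℝ) ^ w * m.choose w ≤ m ^ w * n.choose w := by
    exact_mod_cast pow_mul_choose_le hmn hw.le
  rw [← Real.log_pow, ← Real.log_div h2.ne' h1.ne']
  refine Real.log_le_log (by positivity) ?_
  rw [div_pow, div_le_div_iff₀ (by positivity) h1]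
  linarith

lemma log_choose_sub_le (hmn : m ≤ n) (hw : w < m) :
    Real.log (n.choose w) - Real.log (m.choose w) ≤ w * Real.log ((n - w) / (m - w) : ℝ) := by
  have hm : (0 : ℝ) < m - w := by
    rw [sub_pos]
    exact_mod_cast hw
  have hn : (0 : ℝ) < n - w := by
    rw [sub_pos]
    exact_mod_cast (by omega : w < n)
  have h1 : (0 : ℝ) < m.choose w := by exact_mod_cast Nat.choose_pos hw.le
  have h2 : (0 : ℝ) < n.choose w := by exact_mod_cast Nat.choose_pos (by omega)
  have h3 : ((m : ℝ) - w) ^ w * n.choose w ≤ (n - w) ^ w * m.choose w := by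
    rw [← Nat.cast_sub hw.le, ← Nat.cast_sub (by omega : w ≤ n)]
    exact_mod_cast pow_sub_mul_choose_le hmn hw.le
  rw [← Real.log_pow, ← Real.log_div h2.ne' h1.ne']
  refine Real.log_le_log (by positivity) ?_
  rw [div_pow, div_le_div_iff₀ h1 (by positivity)]
  linarith

/-- After division by `ω`, the bounds are `log (n / m)` and `log ((n - ω) / (m - ω))`, and both tend
to `-log β` because `ω = o(n)`. -/
lemma tendsto_log_choose_sub {m ω : ℕ → ℕ} {β : ℝ} (hβ : 0 < β) (hmn : ∀ᶠ n in atTop, m n ≤ n)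
    (hm : Tendsto (fun n => (m n : ℝ) / n) atTop (𝓝 β)) (hω1 : ∀ᶠ n in atTop, 1 ≤ ω n)
    (hω : Tendsto (fun n => (ω n : ℝ) / n) atTop (𝓝 0)) :
    Tendsto (fun n => (Real.log (n.choose (ω n)) - Real.log ((m n).choose (ω n))) / ω n) atTop
      (𝓝 (-Real.log β)) := by
  have hlt : ∀ᶠ n in atTop, ω n < m n := by
    filter_upwards [hm.eventually_const_lt (half_lt_self hβ),
      hω.eventually_lt_const (half_pos hβ), eventually_gt_atTop 0] with n h1 h2 hn
    have hn' : (0 : ℝ) < n := by exact_mod_cast hn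
    have h3 := h2.trans h1
    rw [div_lt_div_iff_of_pos_right hn'] at h3
    exact_mod_cast h3
  have hlow : Tendsto (fun n : ℕ => Real.log (n / m n : ℝ)) atTop (𝓝 (-Real.log β)) := by
    have h1 := (Real.continuousAt_log hβ.ne').tendsto.comp hm
    refine h1.neg.congr fun n => ?_
    rw [Function.comp_apply, ← Real.log_inv, inv_div]
  have hupp : Tendsto (fun n : ℕ => Real.log ((n - ω n) / (m n - ω n) : ℝ)) atTop
      (𝓝 (-Real.log β)) := by
    have h1 : Tendsto (fun n : ℕ => (1 - (ω n : ℝ) / n) / ((m n : ℝ) / n - (ω n : ℝ) / n)) atTop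
        (𝓝 ((1 - 0) / (β - 0))) :=
      (tendsto_const_nhds.sub hω).div (hm.sub hω) (by simpa using hβ.ne')
    have h2 := (Real.continuousAt_log (by simpa using hβ.ne')).tendsto.comp h1
    rw [sub_zero, sub_zero, one_div, Real.log_inv] at h2
    refine h2.congr' ?_
    filter_upwards [eventually_gt_atTop 0] with n hn
    have hn' : (n : ℝ) ≠ 0 := by exact_mod_cast hn.ne'
    rw [Function.comp_apply, ← sub_div]
    nth_rewrite 1 [← div_self hn']
    rw [← sub_div, div_div_div_cancel_right₀ hn']
  refine tendsto_of_tendsto_of_tendsto_of_le_of_le' hlow hupp ?_ ?_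
  · filter_upwards [hlt, hmn, hω1] with n h1 h2 h3
    have hw : (0 : ℝ) < ω n := by exact_mod_cast h3
    rw [le_div_iff₀ hw, mul_comm]
    exact log_choose_sub_ge h2 h1
  · filter_upwards [hlt, hmn, hω1] with n h1 h2 h3
    have hw : (0 : ℝ) < ω n := by exact_mod_cast h3
    rw [div_le_iff₀ hw, mul_comm]
    exact log_choose_sub_le h2 h1

end

lemma tendsto_log_one_sub_div : Tendsto (fun x : ℝ => Real.log (1 - x) / x) (𝓝[≠] 0) (𝓝 (-1)) := by
  have h1 : HasDerivAt (fun x : ℝ => Real.log (1 - x)) (-1) 0 := by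
    have h2 : HasDerivAt (fun x : ℝ => 1 - x) (-1) 0 := (hasDerivAt_id 0).const_sub 1
    simpa using h2.log (by norm_num)
  have h3 := h1.tendsto_slope
  refine h3.congr fun x => ?_
  rw [slope_def_field]
  simp

/-- The entropy difference for small error rates. -/
lemma tendsto_binEntropy_sub {β τ : ℕ → ℝ} {b : ℝ} (hb : 0 < b) (hβ : Tendsto β atTop (𝓝 b))
    (hτ0 : ∀ᶠ n in atTop, 0 < τ n) (hτ : Tendsto τ atTop (𝓝 0)) :
    Tendsto (fun n => (Real.binEntropy (τ n) - β n * Real.binEntropy (τ n / β n)) / τ n) atTop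
      (𝓝 (-Real.log b)) := by
  have hτ' : Tendsto τ atTop (𝓝[≠] 0) := tendsto_nhdsWithin_iff.2
    ⟨hτ, hτ0.mono fun n h => h.ne'⟩
  have hβ0 : ∀ᶠ n in atTop, 0 < β n := hβ.eventually_const_lt hb
  have hσ : Tendsto (fun n => τ n / β n) atTop (𝓝 0) := by
    rw [← zero_div b]
    exact hτ.div hβ hb.ne'
  have hσ' : Tendsto (fun n => τ n / β n) atTop (𝓝[≠] 0) := tendsto_nhdsWithin_iff.2
    ⟨hσ, by filter_upwards [hτ0, hβ0] with n h1 h2 using (div_pos h1 h2).ne'⟩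
  have h1 := (tendsto_const_nhds (x := (1 : ℝ))).sub hτ |>.mul
    (tendsto_log_one_sub_div.comp hτ')
  have h2 := (tendsto_const_nhds (x := (1 : ℝ))).sub hσ |>.mul
    (tendsto_log_one_sub_div.comp hσ')
  -- The terms `-log τ` of the two entropies cancel up to `-log β`; the two limits of `log (1 - x) /
  -- x` cancel each other.
  have h3 := (((Real.continuousAt_log hb.ne').tendsto.comp hβ).neg.sub h1).add h2
  rw [show -Real.log b - (1 - 0) * -1 + (1 - 0) * -1 = -Real.log b by ring] at h3
  refine h3.congr' ?_
  filter_upwards [hτ0, hβ0] with n h4 h5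
  simp only [Function.comp_apply, Real.binEntropy, Real.log_inv, Real.log_div h4.ne' h5.ne']
  field_simp
  ring

/-- The numerator is the difference of two expressions of the type treated in
`tendsto_binEntropy_sub`, for `1 - R` and `1 - α`, and the denominator is the first of them; after
division by `τ` everything converges. -/
lemma tendsto_exponent {R δ : ℝ} (hR0 : 0 < R) (hR1 : R < 1) (hδ0 : 0 ≤ δ) {ρ τ : ℕ → ℝ}
    (hρ : Tendsto ρ atTop (𝓝 R)) (hτ0 : ∀ᶠ n in atTop, 0 < τ n) (hτ : Tendsto τ atTop (𝓝 0)) :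
    Tendsto (fun n => exponent (ρ n) δ (τ n)) atTop (𝓝 (sublinearExponent R δ)) := by
  have hβ0 : 0 < 1 - (1 - δ) * R := by nlinarith
  have hv := tendsto_binEntropy_sub (sub_pos.2 hR1) (tendsto_const_nhds.sub hρ) hτ0 hτ
  have hu := tendsto_binEntropy_sub hβ0
    (tendsto_const_nhds.sub (tendsto_const_nhds.mul hρ)) hτ0 hτ
  have hlog : Real.log (1 - R) < 0 := Real.log_neg (by linarith) (by linarith)
  have h1 := (tendsto_const_nhds (x := (1 : ℝ))).sub
    (((hv.sub hu).div hv (by linarith)).const_mul (1 / 2))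
  have h2 : 1 - 1 / 2 * ((-Real.log (1 - R) - -Real.log (1 - (1 - δ) * R)) / -Real.log (1 - R)) =
      sublinearExponent R δ := by
    rw [sublinearExponent]
    have := hlog.ne
    field_simp
    ring
  rw [h2] at h1
  refine h1.congr' ?_
  filter_upwards [hτ0] with n h3
  rw [exponent]
  rw [Pi.div_apply, ← sub_div, div_div_div_cancel_right₀ h3.ne', ← mul_div_assoc]
  congr 3
  ring

lemma keptColumns_le {δ : ℝ} (hδ1 : δ ≤ 1) (k : ℕ) : keptColumns δ k ≤ k := by
  refine Nat.floor_le_of_le ?_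
  have : (0 : ℝ) ≤ k := Nat.cast_nonneg k
  nlinarith

lemma tendsto_keptColumns {R δ : ℝ} (hδ0 : 0 ≤ δ) {k : ℕ → ℕ}
    (hk : Tendsto (fun n => (k n : ℝ) / n) atTop (𝓝 R)) :
    Tendsto (fun n => (keptColumns δ (k n) : ℝ) / n) atTop (𝓝 (δ * R)) := by
  have h1 : Tendsto (fun n => δ * ((k n : ℝ) / n) - 1 / (n : ℝ)) atTop (𝓝 (δ * R - 0)) :=
    (hk.const_mul δ).sub tendsto_one_div_atTop_nhds_zero_nat
  rw [sub_zero] at h1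
  refine tendsto_of_tendsto_of_tendsto_of_le_of_le h1 (hk.const_mul δ) (fun n => ?_) fun n => ?_
  · dsimp only
    rw [← mul_div_assoc, ← sub_div]
    refine div_le_div_of_nonneg_right ?_ (Nat.cast_nonneg n)
    have := Nat.lt_floor_add_one (δ * (k n : ℝ))
    rw [keptColumns]
    linarith
  · dsimp only
    rw [← mul_div_assoc]
    exact div_le_div_of_nonneg_right (Nat.floor_le (by positivity)) (Nat.cast_nonneg n)

lemma eventually_le_of_tendsto_div {R : ℝ} (hR1 : R < 1) {k : ℕ → ℕ}
    (hk : Tendsto (fun n => (k n : ℝ) / n) atTop (𝓝 R)) : ∀ᶠ n in atTop, k n ≤ n := by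
  filter_upwards [hk.eventually_lt_const hR1, eventually_gt_atTop 0] with n h1 hn
  have hn' : (0 : ℝ) < n := by exact_mod_cast hn
  rw [div_lt_one hn'] at h1
  exact_mod_cast h1.le

lemma tendsto_sub_div {R : ℝ} (hR1 : R < 1) {k : ℕ → ℕ}
    (hk : Tendsto (fun n => (k n : ℝ) / n) atTop (𝓝 R)) :
    Tendsto (fun n => ((n - k n : ℕ) : ℝ) / n) atTop (𝓝 (1 - R)) := by
  refine (tendsto_const_nhds.sub hk).congr' ?_
  filter_upwards [eventually_le_of_tendsto_div hR1 hk, eventually_gt_atTop 0] with n h1 hn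
  have hn' : (n : ℝ) ≠ 0 := by exact_mod_cast hn.ne'
  rw [Nat.cast_sub h1, sub_div, div_self hn']

lemma eventually_matrixQubits_le {R δ : ℝ} (hR1 : R < 1) (hδ0 : 0 ≤ δ) {k : ℕ → ℕ}
    (hk : Tendsto (fun n => (k n : ℝ) / n) atTop (𝓝 R)) :
    ∀ᶠ n in atTop, (matrixQubits (n - k n) (keptColumns δ (k n)) : ℝ)
      ≤ δ * (1 - (k n : ℝ) / n) * ((k n : ℝ) / n) * (n : ℝ) ^ 2 := by
  filter_upwards [eventually_le_of_tendsto_div hR1 hk, eventually_gt_atTop 0] with n h1 hn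
  have hn' : (n : ℝ) ≠ 0 := by exact_mod_cast hn.ne'
  have h2 : (keptColumns δ (k n) : ℝ) ≤ δ * k n := Nat.floor_le (by positivity)
  have h3 : (0 : ℝ) ≤ (n - k n : ℕ) := Nat.cast_nonneg _
  rw [matrixQubits, Fintype.card_prod, Fintype.card_fin, Fintype.card_fin, Nat.cast_mul]
  refine (mul_le_mul_of_nonneg_left h2 h3).trans (le_of_eq ?_)
  rw [Nat.cast_sub h1]
  field_simp

lemma tendsto_matrixQubits {R δ : ℝ} (hR1 : R < 1) (hδ0 : 0 ≤ δ) {k : ℕ → ℕ}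
    (hk : Tendsto (fun n => (k n : ℝ) / n) atTop (𝓝 R)) :
    Tendsto (fun n => (matrixQubits (n - k n) (keptColumns δ (k n)) : ℝ) / (n : ℝ) ^ 2)
      atTop (𝓝 (δ * (1 - R) * R)) := by
  have h1 := (tendsto_sub_div hR1 hk).mul (tendsto_keptColumns hδ0 hk)
  rw [show (1 - R) * (δ * R) = δ * (1 - R) * R by ring] at h1
  refine h1.congr fun n => ?_
  rw [matrixQubits, Fintype.card_prod, Fintype.card_fin, Fintype.card_fin, Nat.cast_mul, sq,
    div_mul_div_comm]

lemma tendsto_exp_natCast_mul {f : ℕ → ℝ} {c : ℝ} (hc : c < 0) (hf : Tendsto f atTop (𝓝 c)) :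
    Tendsto (fun n : ℕ => Real.exp (n * f n)) atTop (𝓝 0) :=
  Real.tendsto_exp_atBot.comp (tendsto_natCast_atTop_atTop.atTop_mul_neg hc hf)

lemma choose_mul_pow_le (n w : ℕ) {y : ℝ} (hy : 0 ≤ y) : n.choose w * y ^ w ≤ Real.exp (n * y) := by
  have h1 : (n.choose w : ℝ) * y ^ w ≤ (y + 1) ^ n := by
    rw [add_pow]
    by_cases hw : w ≤ n
    · refine le_trans (le_of_eq ?_) (Finset.single_le_sum
        (f := fun i => y ^ i * 1 ^ (n - i) * (n.choose i : ℝ))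
        (fun i _ => by positivity) (Finset.mem_range.2 (Nat.lt_succ_of_le hw)))
      simp [mul_comm]
    · rw [Nat.choose_eq_zero_of_lt (not_le.1 hw)]
      simp only [Nat.cast_zero, zero_mul]
      positivity
  refine h1.trans ?_
  rw [mul_comm, Real.exp_mul, Real.rpow_natCast]
  exact pow_le_pow_left₀ (by positivity) (Real.add_one_le_exp y) n

lemma two_pow_eq_exp (n : ℕ) : (2 : ℝ) ^ n = Real.exp (n * Real.log 2) := by
  rw [mul_comm, Real.exp_mul, Real.exp_log two_pos, Real.rpow_natCast]

lemma pow_eq_exp {y : ℝ} (hy : 0 < y) (n : ℕ) : y ^ n = Real.exp (n * Real.log y) := by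
  rw [mul_comm, Real.exp_mul, Real.exp_log hy, Real.rpow_natCast]

/-- The estimate `C(n,ω) y^ω ≤ e^(ny)` with `y = β / 4` gives an exponent asymptotic to `n (β/4 - β
log 2)`, which is negative. This makes `e` the unique solution with high probability. -/
lemma tendsto_choose_div_two_pow {r ω : ℕ → ℕ} {β : ℝ} (hβ : 0 < β)
    (hr : Tendsto (fun n => (r n : ℝ) / n) atTop (𝓝 β))
    (hω : Tendsto (fun n => (ω n : ℝ) / n) atTop (𝓝 0)) :
    Tendsto (fun n => (n.choose (ω n) : ℝ) / 2 ^ r n) atTop (𝓝 0) := by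
  have hlog := Real.log_two_gt_d9
  have hy : 0 < β / 4 := by positivity
  have h1 : Tendsto (fun n => β / 4 - (ω n : ℝ) / n * Real.log (β / 4) -
      (r n : ℝ) / n * Real.log 2) atTop (𝓝 (β / 4 - 0 * Real.log (β / 4) - β * Real.log 2)) :=
    (tendsto_const_nhds.sub (hω.mul_const _)).sub (hr.mul_const _)
  refine squeeze_zero' (Eventually.of_forall fun n => by positivity) ?_
    (tendsto_exp_natCast_mul (by nlinarith) h1)
  filter_upwards [eventually_gt_atTop 0] with n hn
  have hn' : (n : ℝ) ≠ 0 := by exact_mod_cast hn.ne'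
  have h2 := choose_mul_pow_le n (ω n) hy.le
  rw [pow_eq_exp hy, ← le_div_iff₀ (Real.exp_pos _), ← Real.exp_sub] at h2
  rw [two_pow_eq_exp, div_le_iff₀ (Real.exp_pos _), ← Real.exp_add]
  refine h2.trans (le_of_eq ?_)
  congr 1
  field_simp
  ring

/-- With `x = η / 4`, both `(1 + x) ^ N` and, by the choice of `ρ`, `x ^ (-d)` are at most
`e^(nη/4)`, while `2 ^ (r - N) ≤ 2 ^ (-ηn)`. The bound decays since `log 2 > 1/2`. -/
lemma eventually_tail_le {η : ℝ} (hη0 : 0 < η) (hη1 : η ≤ 1) :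
    ∃ ρ x : ℝ, 0 < ρ ∧ 0 < x ∧ x ≤ 1 ∧ ∀ ε : ℝ, 0 < ε → ∀ᶠ n : ℕ in atTop, ∀ r N d : ℕ,
      N ≤ n → r + η * n ≤ N → d ≤ ρ * n →
        2 ^ r * ((1 + x) ^ N / (x ^ d * 2 ^ N)) ≤ ε := by
  have hlog := Real.log_two_gt_d9
  have hx0 : 0 < η / 4 := by positivity
  have hlx : Real.log (η / 4) ≤ 0 := Real.log_nonpos hx0.le (by linarith)
  set L := -Real.log (η / 4) with hL
  have hL0 : 0 ≤ L := by linarith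
  refine ⟨η / 4 / (1 + L), η / 4, by positivity, hx0, by linarith, fun ε hε => ?_⟩
  have h1 := tendsto_exp_natCast_mul (c := η / 2 - η * Real.log 2) (by nlinarith)
    tendsto_const_nhds
  filter_upwards [h1.eventually_le_const hε] with n hn r N d hN hr hd
  refine le_trans ?_ hn
  have hNr : (N : ℝ) ≤ n := by exact_mod_cast hN
  have h2 : (1 + η / 4) ^ N ≤ Real.exp (n * (η / 4)) := by
    have h3 : (1 + η / 4) ^ N ≤ Real.exp (η / 4) ^ N := by
      refine pow_le_pow_left₀ (by positivity) ?_ N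
      rw [add_comm]
      exact Real.add_one_le_exp _
    rw [← Real.exp_nat_mul] at h3
    exact h3.trans (Real.exp_le_exp.2 (by gcongr))
  have h4 : (d : ℝ) * L ≤ n * (η / 4) := by
    calc (d : ℝ) * L ≤ (η / 4 / (1 + L) * n) * L := by gcongr
      _ = n * (η / 4) * (L / (1 + L)) := by ring
      _ ≤ n * (η / 4) * 1 := by
        gcongr
        rw [div_le_one (by positivity)]
        linarith
      _ = _ := by ring
  rw [two_pow_eq_exp, two_pow_eq_exp, pow_eq_exp hx0, ← Real.exp_add, ← mul_div_assoc,
    div_le_iff₀ (Real.exp_pos _)]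
  refine (mul_le_mul_of_nonneg_left h2 (Real.exp_pos _).le).trans ?_
  rw [← Real.exp_add, ← Real.exp_add, Real.exp_le_exp]
  have h5 : (r : ℝ) * Real.log 2 + η * n * Real.log 2 ≤ N * Real.log 2 := by
    rw [← add_mul]
    gcongr
  have h6 : (d : ℝ) * Real.log (η / 4) = -(d * L) := by rw [hL]; ring
  rw [h6]
  nlinarith

lemma half_mul_le_floor {ρ : ℝ} {n : ℕ} (hn : 2 ≤ ρ * n) : ρ / 2 * n ≤ ⌊ρ * n⌋₊ := by
  have := Nat.lt_floor_add_one (ρ * n)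
  linarith

/-- With high probability the success probability of a round is, up to a constant, the
probability that the permutation moves the error to the kept positions. -/
lemma exists_eventually_freq_le {R δ : ℝ} (hR0 : 0 < R) (hR1 : R < 1) (hδ0 : 0 ≤ δ) (hδ1 : δ ≤ 1)
    {k ω : ℕ → ℕ} (hk : Tendsto (fun n => (k n : ℝ) / n) atTop (𝓝 R))
    (hω1 : ∀ᶠ n in atTop, 1 ≤ ω n) (hω : Tendsto (fun n => (ω n : ℝ) / n) atTop (𝓝 0))
    {ε : ℝ} (hε : 0 < ε) :
    ∃ g : ℝ, 0 < g ∧ ∀ᶠ n in atTop, ∀ e : Fin n → ZMod 2, hammingNorm e = ω n →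
      ∀ D : SearchCircuits (n - k n) (keptColumns δ (k n)) (ω n),
        freq (fun H : Matrix (Fin (n - k n)) (Fin n) (ZMod 2) =>
          ¬ (g * (((n - k n + keptColumns δ (k n)).choose (ω n) : ℝ) / n.choose (ω n)) ≤
              successProb D (k n - keptColumns δ (k n)) H (H.mulVec e) ∧
            successProb D (k n - keptColumns δ (k n)) H (H.mulVec e) ≤
              ((n - k n + keptColumns δ (k n)).choose (ω n) : ℝ) / n.choose (ω n))) ≤ ε := by
  -- The number `m` of extensions depends only on `ε`, so the loss `g` is a constant. The value `ε /
  -- 64` leaves room for the Markov factors.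
  obtain ⟨m, hm⟩ := exists_pow_lt_of_lt_one (by positivity : 0 < ε / 64)
    (by norm_num : (1 / 2 : ℝ) < 1)
  have hr := tendsto_sub_div hR1 hk
  have hwm : ∀ᶠ n in atTop, ω n + m ≤ n - k n := by
    have h1 : Tendsto (fun n => (ω n : ℝ) / n + (m : ℝ) / n) atTop (𝓝 (0 + 0)) :=
      hω.add (tendsto_const_div_atTop_nhds_zero_nat _)
    rw [add_zero] at h1
    filter_upwards [h1.eventually_lt_const (half_pos (sub_pos.2 hR1)),
      hr.eventually_const_lt (half_lt_self (sub_pos.2 hR1)), eventually_gt_atTop 0] with n h2 h3 hn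
    have hn' : (0 : ℝ) < n := by exact_mod_cast hn
    have h4 := h2.trans h3
    rw [← add_div, div_lt_div_iff_of_pos_right hn'] at h4
    exact_mod_cast h4.le
  have hchoose := (tendsto_choose_div_two_pow (sub_pos.2 hR1) hr hω).eventually_le_const
    (by positivity : 0 < ε / 4)
  have hkn := eventually_le_of_tendsto_div hR1 hk
  -- For `δ = 0` the surplus of columns over `r` is all of `k ~ R n`; for `δ > 0` it is the number
  -- of stored columns, about `δ R n`.
  rcases hδ0.eq_or_lt with rfl | hδ
  · obtain ⟨ρ, x, hρ, hx0, hx1, htail⟩ := eventually_tail_le (half_pos hR0) (by linarith)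
    refine ⟨(ρ / 2) ^ m / 200, by positivity, ?_⟩
    filter_upwards [htail (ε / 64) (by positivity), hchoose, hkn, hwm, eventually_gt_atTop 0,
      hk.eventually_const_lt (half_lt_self hR0),
      (tendsto_natCast_atTop_atTop.const_mul_atTop hρ).eventually_ge_atTop 2]
      with n h1 h2 h3 h4 hn h5 h6 e he
    have hn' : (0 : ℝ) < n := by exact_mod_cast hn
    have hκ : keptColumns 0 (k n) = 0 := by simp [keptColumns]
    rw [hκ]
    intro D
    rw [lt_div_iff₀ hn'] at h5
    have h7 := h1 (n - k n) n ⌊ρ * n⌋₊ le_rfl (by rw [Nat.cast_sub h3]; linarith)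
      (Nat.floor_le (by positivity))
    have h8 := freq_successProb_le_of_zero D (l := k n - 0) (by omega : n - k n + (k n - 0) = n) he
      (m := m) (d := ⌊ρ * n⌋₊) h4 hx0 hx1
    refine (freq_mono fun H hH => ?_).trans (h8.trans (by linarith))
    refine fun hcon => hH ⟨le_trans ?_ hcon.1, hcon.2⟩
    rw [add_zero]
    refine mul_le_mul_of_nonneg_right ?_ (by positivity)
    gcongr ?_ ^ m / 200
    rw [le_div_iff₀ hn']
    exact half_mul_le_floor h6
  · have hη0 : 0 < δ * R / 2 := by positivity
    obtain ⟨ρ, x, hρ, hx0, hx1, htail⟩ := eventually_tail_le hη0 (by nlinarith)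
    refine ⟨((ρ / 2) ^ m) ^ 2 / 800, by positivity, ?_⟩
    filter_upwards [htail (ε / 64) (by positivity), hchoose, hkn, hwm, eventually_gt_atTop 0,
      (tendsto_keptColumns hδ0 hk).eventually_const_lt (half_lt_self (mul_pos hδ hR0)),
      (tendsto_natCast_atTop_atTop.const_mul_atTop hρ).eventually_ge_atTop 2, hω1]
      with n h1 h2 h3 h4 hn h5 h6 hω1n e he D
    have hn' : (0 : ℝ) < n := by exact_mod_cast hn
    have hκ := keptColumns_le hδ1 (k n)
    rw [lt_div_iff₀ hn'] at h5
    have h7 := h1 (n - k n) (n - k n + keptColumns δ (k n)) ⌊ρ * n⌋₊ (by omega)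
      (by rw [Nat.cast_add]; linarith) (Nat.floor_le (by positivity))
    have h8 := freq_successProb_le D
      (by omega : n - k n + keptColumns δ (k n) + (k n - keptColumns δ (k n)) = n) he
      (m := m) (d := ⌊ρ * n⌋₊) h4 hx0 hx1
    refine (freq_mono fun H hH => ?_).trans (h8.trans (by linarith))
    refine fun hcon => hH ⟨le_trans ?_ hcon.1, hcon.2⟩
    have hN : (0 : ℝ) < (n - k n + keptColumns δ (k n) : ℕ) := by
      exact_mod_cast (by omega : 0 < n - k n + keptColumns δ (k n))
    have hNn : ((n - k n + keptColumns δ (k n) : ℕ) : ℝ) ≤ n := by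
      exact_mod_cast (by omega : n - k n + keptColumns δ (k n) ≤ n)
    refine mul_le_mul_of_nonneg_right ?_ (by positivity)
    gcongr (?_ ^ m) ^ 2 / 800
    rw [le_div_iff₀ hN]
    exact (mul_le_mul_of_nonneg_left hNn (by positivity)).trans (half_mul_le_floor h6)

/-- Absorbs the quantum and the classical cost of a round into a single power. -/
lemma two_mul_pow_add_le (n a A : ℕ) :
    2 * ((n : ℝ) + 2) ^ a + (n ^ A + A) ≤ ((n : ℝ) + 2) ^ (a + 2 + A) := by
  set B : ℝ := (n : ℝ) + 2 with hB
  have hB2 : 2 ≤ B := by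
    rw [hB]
    linarith [Nat.cast_nonneg (α := ℝ) n]
  have h1 : (1 : ℝ) ≤ B ^ A := one_le_pow₀ (by linarith)
  have h2 : (n : ℝ) ^ A ≤ B ^ A := pow_le_pow_left₀ (by positivity) (by linarith) A
  have h3 : (A : ℝ) ≤ B ^ A := by
    have h4 : (A : ℝ) ≤ 2 ^ A := by exact_mod_cast Nat.lt_two_pow_self.le
    exact h4.trans (pow_le_pow_left₀ (by norm_num) hB2 A)
  have h5 : (1 : ℝ) ≤ B ^ a := one_le_pow₀ (by linarith)
  have h6 : B ^ a ≤ B ^ a * B ^ A := le_mul_of_one_le_right (by positivity) h1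
  have h7 : B ^ A ≤ B ^ a * B ^ A := le_mul_of_one_le_left (by positivity) h5
  have h8 : (4 : ℝ) ≤ B ^ 2 := by nlinarith
  calc 2 * B ^ a + (n ^ A + A) ≤ 4 * (B ^ a * B ^ A) := by linarith
    _ ≤ B ^ 2 * (B ^ a * B ^ A) := by gcongr
    _ = B ^ (a + 2 + A) := by ring

section
variable {r κ w n c A : ℕ}

lemma le_cost_add (hw : w ≤ r) : 1 / 2 / Real.sqrt (goodProportion r κ w) ≤
    ((searchCircuits r κ w).amplified.cost + c : ℕ) := by
  have hs0 : 0 < Real.sqrt (goodProportion r κ w) := Real.sqrt_pos.2 (goodProportion_pos hw)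
  have hj : Real.pi / (4 * Real.sqrt (goodProportion r κ w)) < iterations r κ w + 1 :=
    Nat.lt_floor_add_one _
  have h1 : (iterations r κ w + 1 : ℝ) ≤ ((searchCircuits r κ w).amplified.cost + c : ℕ) := by
    exact_mod_cast (le_cost_amplified r κ w).trans (Nat.le_add_right _ _)
  refine le_trans (le_trans ?_ hj.le) h1
  rw [div_div, div_le_div_iff₀ (by positivity) (by positivity)]
  nlinarith [Real.pi_gt_three]

lemma cost_add_le (hw : w ≤ r) (hN : r + κ ≤ n) (hc : c ≤ n ^ A + A) :
    (((searchCircuits r κ w).amplified.cost + c : ℕ) : ℝ) ≤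
      ((n : ℝ) + 2) ^ (24 + A) / Real.sqrt (goodProportion r κ w) := by
  set s := Real.sqrt (goodProportion r κ w) with hs
  have hs0 : 0 < s := Real.sqrt_pos.2 (goodProportion_pos hw)
  have hs1 : s ≤ 1 := Real.sqrt_le_one.2 (goodProportion_le_one r κ w)
  have hj : (iterations r κ w : ℝ) ≤ Real.pi / (4 * s) := Nat.floor_le (by positivity)
  have h1 : ((searchCircuits r κ w).amplified.cost : ℝ) ≤
      ((r + κ + 2 : ℕ) : ℝ) ^ 22 * (iterations r κ w + 1) := by
    exact_mod_cast cost_amplified_le r κ w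
  have h2 : ((r + κ + 2 : ℕ) : ℝ) ≤ (n : ℝ) + 2 := by
    exact_mod_cast (by omega : r + κ + 2 ≤ n + 2)
  have h3 : (iterations r κ w + 1 : ℝ) ≤ 2 / s := by
    have h4 : Real.pi / (4 * s) ≤ 1 / s := by
      rw [div_le_div_iff₀ (by positivity) hs0]
      nlinarith [Real.pi_le_four]
    have h5 : 1 ≤ 1 / s := (one_le_div hs0).2 hs1
    have h6 : 2 / s = 1 / s + 1 / s := by ring
    linarith
  have h7 : ((searchCircuits r κ w).amplified.cost : ℝ) ≤ ((n : ℝ) + 2) ^ 22 * (2 / s) :=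
    h1.trans (mul_le_mul (pow_le_pow_left₀ (Nat.cast_nonneg _) h2 _) h3 (by positivity)
      (by positivity))
  have h8 : (c : ℝ) ≤ n ^ A + A := by exact_mod_cast hc
  have h9 : (n : ℝ) ^ A + A ≤ (n ^ A + A) / s := by
    rw [le_div_iff₀ hs0]
    exact mul_le_of_le_one_right (by positivity) hs1
  rw [Nat.cast_add]
  refine (add_le_add h7 (h8.trans h9)).trans ?_
  rw [← mul_div_assoc, ← add_div, mul_comm _ (2 : ℝ)]
  exact div_le_div_of_nonneg_right (two_mul_pow_add_le n 22 A) hs0.le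

/-- The logarithm of the running time for a given success probability of a round. -/
lemma abs_log_time_sub_le (hw : w ≤ r) (hN : r + κ ≤ n) (hn : 2 ≤ n)
    (hc : c ≤ n ^ A + A) {g p : ℝ} (hg : 0 < g) (hgn : -Real.log g ≤ Real.log n)
    (hlow : g * (((r + κ).choose w : ℝ) / n.choose w) ≤ p)
    (hupp : p ≤ ((r + κ).choose w : ℝ) / n.choose w) :
    |Real.log (((searchCircuits r κ w).amplified.cost + c : ℕ) / p) -
      (Real.log (n.choose w) -
        (Real.log ((r + κ).choose w) + Real.log (r.choose w)) / 2)| ≤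
      (2 * (24 + A) + 1) * Real.log n := by
  have hCr : (0 : ℝ) < r.choose w := by exact_mod_cast Nat.choose_pos hw
  have hCN : (0 : ℝ) < (r + κ).choose w := by exact_mod_cast Nat.choose_pos (by omega)
  have hCn : (0 : ℝ) < n.choose w := by exact_mod_cast Nat.choose_pos (by omega)
  have hn' : (2 : ℝ) ≤ n := by exact_mod_cast hn
  have hlogn : Real.log 2 ≤ Real.log n := Real.log_le_log two_pos hn'
  have hlog2 := Real.log_pos one_lt_two
  have hc1 := le_cost_add (κ := κ) (c := c) hw
  have hc2 := cost_add_le hw hN hc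
  have hq0 : 0 < goodProportion r κ w := goodProportion_pos hw
  set s := Real.sqrt (goodProportion r κ w) with hs
  have hs0 : 0 < s := Real.sqrt_pos.2 hq0
  have hlogs : Real.log s = (Real.log (r.choose w) - Real.log ((r + κ).choose w)) / 2 := by
    rw [hs, Real.log_sqrt hq0.le, goodProportion, Real.log_div hCr.ne' hCN.ne']
  generalize ((searchCircuits r κ w).amplified.cost + c : ℕ) = C at *
  set P := ((r + κ).choose w : ℝ) / n.choose w with hP
  have hP0 : 0 < P := div_pos hCN hCn
  have hlogP : Real.log P = Real.log ((r + κ).choose w) - Real.log (n.choose w) := by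
    rw [hP, Real.log_div hCN.ne' hCn.ne']
  have hp0 : 0 < p := (mul_pos hg hP0).trans_le hlow
  have hlogp1 : Real.log g + Real.log P ≤ Real.log p := by
    rw [← Real.log_mul hg.ne' hP0.ne']
    exact Real.log_le_log (mul_pos hg hP0) hlow
  have hlogp2 : Real.log p ≤ Real.log P := Real.log_le_log hp0 hupp
  have hpos : (0 : ℝ) < C := lt_of_lt_of_le (by positivity) hc1
  have hl1 : -Real.log 2 - Real.log s ≤ Real.log C := by
    refine le_trans (le_of_eq ?_) (Real.log_le_log (by positivity) hc1)
    rw [Real.log_div (by norm_num) hs0.ne', one_div, Real.log_inv]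
  have hl2 : Real.log C ≤ (24 + A) * (2 * Real.log n) - Real.log s := by
    refine (Real.log_le_log hpos hc2).trans ?_
    rw [Real.log_div (by positivity) hs0.ne', Real.log_pow]
    -- This replacement of `n + 2` by `n ^ 2` causes the factor two in the constant; its summand one
    -- pays for `-log g` and `log 2`.
    have h1 : (n : ℝ) + 2 ≤ (n : ℝ) ^ 2 := by nlinarith
    have h2 := Real.log_le_log (by positivity) h1
    rw [Real.log_pow] at h2
    push_cast at h2 ⊢
    gcongr
  have hA : 0 ≤ (A : ℝ) * Real.log n := mul_nonneg (Nat.cast_nonneg _) (by linarith)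
  rw [Real.log_div hpos.ne' hp0.ne', abs_le]
  constructor <;> linarith

end

/-- The logarithm of the running time up to polynomial factors. -/
def logTime (n r κ w : ℕ) : ℝ :=
  Real.log (n.choose w) - (Real.log ((r + κ).choose w) + Real.log (r.choose w)) / 2

section
variable {R δ : ℝ} {k ω c : ℕ → ℕ}

lemma tendsto_log_classicalTime_div (hR1 : R < 1)
    (hk : Tendsto (fun n => (k n : ℝ) / n) atTop (𝓝 R)) (hω1 : ∀ᶠ n in atTop, 1 ≤ ω n)
    (hω : Tendsto (fun n => (ω n : ℝ) / n) atTop (𝓝 0)) (hle : ∀ᶠ n in atTop, ω n ≤ n - k n) :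
    Tendsto (fun n => Real.log (classicalTime n (k n) (ω n)) / ω n) atTop
      (𝓝 (-Real.log (1 - R))) := by
  refine (tendsto_log_choose_sub (sub_pos.2 hR1) (Eventually.of_forall fun n => Nat.sub_le n (k n))
    (tendsto_sub_div hR1 hk) hω1 hω).congr' ?_
  filter_upwards [hle] with n h1
  rw [classicalTime, Real.log_div]
  · exact_mod_cast (Nat.choose_pos (h1.trans (Nat.sub_le _ _))).ne'
  · exact_mod_cast (Nat.choose_pos h1).ne'

lemma eventually_weight_le (hR1 : R < 1) (hk : Tendsto (fun n => (k n : ℝ) / n) atTop (𝓝 R))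
    (hω : Tendsto (fun n => (ω n : ℝ) / n) atTop (𝓝 0)) : ∀ᶠ n in atTop, ω n ≤ n - k n := by
  filter_upwards [hω.eventually_lt_const (half_pos (sub_pos.2 hR1)),
    (tendsto_sub_div hR1 hk).eventually_const_lt (half_lt_self (sub_pos.2 hR1)),
    eventually_gt_atTop 0] with n h2 h3 hn
  have hn' : (0 : ℝ) < n := by exact_mod_cast hn
  have h4 := h2.trans h3
  rw [div_lt_div_iff_of_pos_right hn'] at h4
  exact_mod_cast h4.le

/-- The quantity `logTime` is the mean of `log C(n,ω) - log C(r,ω)` and `log C(n,ω) - log C(r+κ,ω)`,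
whose limits after division by `ω` are `-log (1 - R)` and `-log (1 - (1-δ)R)`. Their mean is `t(δ)`
times the limit for `T_C`. -/
lemma tendsto_logTime_sub_div (hR0 : 0 < R) (hR1 : R < 1) (hδ0 : 0 ≤ δ) (hδ1 : δ ≤ 1)
    (hk : Tendsto (fun n => (k n : ℝ) / n) atTop (𝓝 R)) (hω1 : ∀ᶠ n in atTop, 1 ≤ ω n)
    (hω : Tendsto (fun n => (ω n : ℝ) / n) atTop (𝓝 0)) :
    Tendsto (fun n => (logTime n (n - k n) (keptColumns δ (k n)) (ω n) -
      sublinearExponent R δ * Real.log (classicalTime n (k n) (ω n))) / ω n) atTop (𝓝 0) := by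
  have hle := eventually_weight_le hR1 hk hω
  have hβ : 0 < 1 - R + δ * R := by nlinarith
  have h1 := tendsto_log_choose_sub (sub_pos.2 hR1)
    (Eventually.of_forall fun n => Nat.sub_le n (k n)) (tendsto_sub_div hR1 hk) hω1 hω
  have h2 := tendsto_log_choose_sub (m := fun n => n - k n + keptColumns δ (k n)) hβ
    (by
      filter_upwards [eventually_le_of_tendsto_div hR1 hk] with n hn
      have := keptColumns_le hδ1 (k n)
      omega)
    (by
      refine ((tendsto_sub_div hR1 hk).add (tendsto_keptColumns hδ0 hk)).congr fun n => ?_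
      rw [Nat.cast_add, add_div]) hω1 hω
  have h3 := tendsto_log_classicalTime_div hR1 hk hω1 hω hle
  have h4 := ((h1.add h2).const_mul (1 / 2)).sub (h3.const_mul (sublinearExponent R δ))
  have hlog : Real.log (1 - R) ≠ 0 := (Real.log_neg (by linarith) (by linarith)).ne
  have h5 : 1 / 2 * (-Real.log (1 - R) + -Real.log (1 - R + δ * R)) -
      sublinearExponent R δ * -Real.log (1 - R) = 0 := by
    rw [sublinearExponent, show 1 - (1 - δ) * R = 1 - R + δ * R by ring]
    field_simp
    ring
  rw [h5] at h4
  refine h4.congr fun n => ?_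
  rw [logTime]
  ring

/-- The constant `K` does not depend on `ε`: only `g` does, and eventually `-log g ≤ log n`. -/
lemma exists_eventually_le_proportion (hR0 : 0 < R) (hR1 : R < 1) (hδ0 : 0 ≤ δ) (hδ1 : δ ≤ 1)
    (hk : Tendsto (fun n => (k n : ℝ) / n) atTop (𝓝 R)) (hω1 : ∀ᶠ n in atTop, 1 ≤ ω n)
    (hω : Tendsto (fun n => (ω n : ℝ) / n) atTop (𝓝 0)) (hc : ∃ a : ℕ, ∀ n, c n ≤ n ^ a + a) :
    ∃ K : ℝ, ∀ ε : ℝ, 0 < ε → ∀ᶠ n in atTop, ∀ e : Fin n → ZMod 2, hammingNorm e = ω n →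
      1 - ε ≤ proportion fun H : ParityCheck (n - k n) n =>
        Solves (searchCircuits (n - k n) (keptColumns δ (k n)) (ω n))
          (k n - keptColumns δ (k n)) H.1 (H.1.mulVec e) ∧
        expectedTime (searchCircuits (n - k n) (keptColumns δ (k n)) (ω n)) (c n)
          (k n - keptColumns δ (k n)) H.1 (H.1.mulVec e) ≠ ⊤ ∧
        |Real.log (expectedTime (searchCircuits (n - k n) (keptColumns δ (k n)) (ω n)) (c n)
          (k n - keptColumns δ (k n)) H.1 (H.1.mulVec e)).toReal -
            logTime n (n - k n) (keptColumns δ (k n)) (ω n)| ≤ K * Real.log n := by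
  obtain ⟨a, ha⟩ := hc
  refine ⟨2 * (24 + a) + 1, fun ε hε => ?_⟩
  obtain ⟨g, hg, hfreq⟩ := exists_eventually_freq_le hR0 hR1 hδ0 hδ1 hk hω1 hω (half_pos hε)
  have hlogn : ∀ᶠ n : ℕ in atTop, -Real.log g ≤ Real.log n :=
    (Real.tendsto_log_atTop.comp tendsto_natCast_atTop_atTop).eventually_ge_atTop _
  filter_upwards [hfreq, hlogn, eventually_ge_atTop 2, eventually_le_of_tendsto_div hR1 hk,
    eventually_weight_le hR1 hk hω, hk.eventually_const_lt hR0] with n h1 h2 hn h3 h4 h5 e he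
  have hk0 : 0 < k n := by
    rcases Nat.eq_zero_or_pos (k n) with h | h
    · simp [h] at h5
    · exact h
  have hκ := keptColumns_le hδ1 (k n)
  have h6 := le_proportion (by omega : n - k n < n) _ (h1 e he (searchCircuits _ _ _))
    (q := fun H : ParityCheck (n - k n) n =>
        Solves (searchCircuits (n - k n) (keptColumns δ (k n)) (ω n))
          (k n - keptColumns δ (k n)) H.1 (H.1.mulVec e) ∧
        expectedTime (searchCircuits (n - k n) (keptColumns δ (k n)) (ω n)) (c n)
          (k n - keptColumns δ (k n)) H.1 (H.1.mulVec e) ≠ ⊤ ∧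
        |Real.log (expectedTime (searchCircuits (n - k n) (keptColumns δ (k n)) (ω n)) (c n)
          (k n - keptColumns δ (k n)) H.1 (H.1.mulVec e)).toReal -
            logTime n (n - k n) (keptColumns δ (k n)) (ω n)| ≤
              (2 * (24 + a) + 1) * Real.log n) ?_
  · linarith
  · rintro H ⟨hlow, hupp⟩
    have hpos : 0 < successProb (searchCircuits (n - k n) (keptColumns δ (k n)) (ω n))
        (k n - keptColumns δ (k n)) H.1 (H.1.mulVec e) := by
      refine lt_of_lt_of_le (mul_pos hg (div_pos ?_ ?_)) hlow
      · exact_mod_cast Nat.choose_pos (by omega)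
      · exact_mod_cast Nat.choose_pos (by omega)
    obtain ⟨h7, h8⟩ := expectedTime_of_pos (searchCircuits (n - k n) (keptColumns δ (k n)) (ω n))
      H.1 (H.1.mulVec e) (c n) hpos
    refine ⟨solves_of_pos _ _ _ hpos, h7, ?_⟩
    rw [h8, logTime]
    exact abs_log_time_sub_le h4 (by omega) hn (ha n) hg h2 hlow hupp

lemma proportion_mono {r n : ℕ} {p q : ParityCheck r n → Prop} (h : ∀ H, p H → q H) :
    proportion p ≤ proportion q := by
  classical
  exact freq_mono h

end

end HybridPrange

end

theorem mainTheorem4 :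
    ∃ D : ∀ r κ w : ℕ, SearchCircuits r κ w,
      (∃ d : ℕ, ∀ r κ w : ℕ,
        (D r κ w).anc ≤ (r + κ + 2) ^ d ∧
        (D r κ w).prep.cost ≤ (r + κ + 2) ^ d ∧
        (D r κ w).oracle.cost ≤ (r + κ + 2) ^ d) ∧
      ∀ (R δ : ℝ), 0 < R → R < 1 → 0 ≤ δ → δ ≤ 1 →
      ∀ (k ω c : ℕ → ℕ),
        Tendsto (fun n => (k n : ℝ) / n) atTop (𝓝 R) →
        (∀ᶠ n in atTop, 1 ≤ ω n) →
        Tendsto (fun n => (ω n : ℝ) / n) atTop (𝓝 0) →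
        (∃ a : ℕ, ∀ n, c n ≤ n ^ a + a) →
        -- the exponent for error rate `τ` converges to the exponent for sublinear weight
        Tendsto (fun n => exponent ((k n : ℝ) / n) δ ((ω n : ℝ) / n)) atTop
          (𝓝 (sublinearExponent R δ)) ∧
        -- the number of qubits for the matrix
        (∀ᶠ n in atTop, (matrixQubits (n - k n) (keptColumns δ (k n)) : ℝ)
          ≤ δ * (1 - (k n : ℝ) / n) * ((k n : ℝ) / n) * (n : ℝ) ^ 2) ∧
        Tendsto (fun n => (matrixQubits (n - k n) (keptColumns δ (k n)) : ℝ) / (n : ℝ) ^ 2)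
          atTop (𝓝 (δ * (1 - R) * R)) ∧
        -- the running time is `T_C ^ (t(δ) + o(1))` up to a polynomial factor
        (∃ K : ℝ, ∀ ε : ℝ, 0 < ε → ∀ᶠ n in atTop,
          ∀ e : Fin n → ZMod 2, hammingNorm e = ω n →
            1 - ε ≤ proportion fun H : ParityCheck (n - k n) n =>
              let s := H.1.mulVec e
              let κ := keptColumns δ (k n)
              let A := D (n - k n) κ (ω n)
              let T := expectedTime A (c n) (k n - κ) H.1 s
              let TC := classicalTime n (k n) (ω n)
              Solves A (k n - κ) H.1 s ∧ T ≠ ⊤ ∧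
                |Real.log T.toReal - sublinearExponent R δ * Real.log TC|
                  ≤ ε * Real.log TC + K * Real.log n) ∧
        -- for weights above the logarithmic range, `log T / log T_C = t(δ) + o(1)`
        (Tendsto (fun n : ℕ => Real.log n / (ω n : ℝ)) atTop (𝓝 0) →
          ∀ ε : ℝ, 0 < ε → ∀ᶠ n in atTop,
            ∀ e : Fin n → ZMod 2, hammingNorm e = ω n →
              1 - ε ≤ proportion fun H : ParityCheck (n - k n) n =>
                let s := H.1.mulVec e
                let κ := keptColumns δ (k n)
                let A := D (n - k n) κ (ω n)
                let T := expectedTime A (c n) (k n - κ) H.1 s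
                let TC := classicalTime n (k n) (ω n)
                Solves A (k n - κ) H.1 s ∧ T ≠ ⊤ ∧
                  |Real.log T.toReal / Real.log TC - sublinearExponent R δ| ≤ ε) := by
  refine ⟨searchCircuits, ⟨20, fun r κ w =>
    ⟨anc_le r κ w, cost_prep_le r κ w, cost_oracle_le r κ w⟩⟩, ?_⟩
  intro R δ hR0 hR1 hδ0 hδ1 k ω c hk hω1 hω hc
  have hω0 : ∀ᶠ n : ℕ in atTop, 0 < (ω n : ℝ) / n := by
    filter_upwards [hω1, eventually_gt_atTop 0] with n h1 hn
    exact div_pos (by exact_mod_cast h1) (by exact_mod_cast hn)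
  have hTC := tendsto_log_classicalTime_div hR1 hk hω1 hω (eventually_weight_le hR1 hk hω)
  have hX := (tendsto_logTime_sub_div hR0 hR1 hδ0 hδ1 hk hω1 hω).abs
  rw [abs_zero] at hX
  have ha : 0 < -Real.log (1 - R) := neg_pos.2 (Real.log_neg (by linarith) (by linarith))
  have hTC' := hTC.eventually_const_lt (half_lt_self ha)
  obtain ⟨K, hK⟩ := exists_eventually_le_proportion hR0 hR1 hδ0 hδ1 hk hω1 hω hc
  -- Since `log T_C` is eventually at least a positive constant times `ω`, an error `o(ω)` is `o(log
  -- T_C)`.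
  have hX' : ∀ ε : ℝ, 0 < ε → ∀ᶠ n in atTop, 0 < Real.log (classicalTime n (k n) (ω n)) ∧
      |logTime n (n - k n) (keptColumns δ (k n)) (ω n) -
        sublinearExponent R δ * Real.log (classicalTime n (k n) (ω n))| ≤
          ε * Real.log (classicalTime n (k n) (ω n)) := by
    intro ε hε
    filter_upwards [hTC', hX.eventually_lt_const (mul_pos hε (half_pos ha)), hω1] with n h1 h2 h3
    have hw : (0 : ℝ) < ω n := by exact_mod_cast h3
    rw [lt_div_iff₀ hw] at h1
    rw [abs_div, abs_of_pos hw, div_lt_iff₀ hw] at h2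
    refine ⟨lt_trans (by positivity) h1, h2.le.trans ?_⟩
    rw [mul_assoc]
    exact mul_le_mul_of_nonneg_left h1.le hε.le
  refine ⟨tendsto_exponent hR0 hR1 hδ0 hk hω0 hω, eventually_matrixQubits_le hR1 hδ0 hk,
    tendsto_matrixQubits hR1 hδ0 hk, ⟨K, fun ε hε => ?_⟩, fun hlog ε hε => ?_⟩
  · filter_upwards [hK ε hε, hX' ε hε] with n h1 h2 e he
    refine (h1 e he).trans (proportion_mono ?_)
    rintro H ⟨h3, h4, h5⟩
    exact ⟨h3, h4, (abs_sub_le _ _ _).trans (by linarith [h2.2])⟩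
  -- Under the stronger assumption the polynomial factor is negligible as well: `log n = o(ω)`,
  -- hence `log n = o(log T_C)`. Each of the two errors receives `ε / 2`.
  · have hlog' : ∀ᶠ n : ℕ in atTop, K * Real.log n ≤
        ε / 2 * Real.log (classicalTime n (k n) (ω n)) := by
      have h1 := hlog.const_mul K
      rw [mul_zero] at h1
      filter_upwards [h1.eventually_lt_const (mul_pos (half_pos hε) (half_pos ha)), hTC', hω1]
        with n h2 h3 h4
      have hw : (0 : ℝ) < ω n := by exact_mod_cast h4
      rw [lt_div_iff₀ hw] at h3
      rw [← mul_div_assoc, div_lt_iff₀ hw, mul_assoc] at h2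
      exact h2.le.trans (mul_le_mul_of_nonneg_left h3.le (half_pos hε).le)
    filter_upwards [hK ε hε, hX' (ε / 2) (half_pos hε), hlog'] with n h1 h2 h3 e he
    refine (h1 e he).trans (proportion_mono ?_)
    rintro H ⟨h4, h5, h6⟩
    refine ⟨h4, h5, ?_⟩
    rw [div_sub' h2.1.ne', abs_div, abs_of_pos h2.1, div_le_iff₀ h2.1, mul_comm (Real.log _)]
    exact (abs_sub_le _ _ _).trans (by linarith [h2.2])
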